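/- **Theorem.** Let $(\mathcal A,\varphi)$ be a tracial ($C^*$-)probability space, i.e. a unital $C^*$-algebra with a tracial state, and let $(x_i)_{i\ge1}$ be a sequence of freely independent self-adjoint elements of $\mathcal A$ with $\varphi(x_i)=0$ and $\varphi(x_i^2)=\sigma^2$ for all $i$. For $p>0$ and a Borel function $F:\mathbb R\to[0,\infty]$ put $\|F(x_i)\|_{L^p_\varphi}=\big(\int F^p\,d\nu_{x_i}\big)^{1/p}$, where $\nu_{x_i}$ is the spectral distribution of $x_i$; also put $t^-=\min(t,0)$, $t^+=\max(t,0)$, and for $0<\gamma\le 1$ let $\|h\|_{\gamma,I}$ be the least $C\in[0,\infty]$ such that $|h(s)-h(t)|\le C|s-t|^\gamma$ for $s,t\in I$. Fix an integer $k\ge1$ and real numbers $\zeta>0$, $0<\gamma\le1$, $0<\alpha<1$, and assume $$\sup_{i\ge1}\varphi\big(|x_i|^{\max(k,3)(1+\zeta)}\big)<\infty .$$ Let $g:\mathbb R\to\mathbb C$ be twice continuously differentiable with $g''$ $\gamma$-Hölder continuous on every compact interval, and $g(0)=1$. Write $|g^2|$ for the function $t\mapsto|g(t)|^2$ and assume that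 the three quantities $$\sup_{i}\Big\|\big\||g^2|\big\|_{1,[\alpha x_i^-,\alpha x_i^+]}\Big\|_{L_\varphi^{k(1+\zeta^{-1})}},\quad \sup_{i}\Big\|\big\||g^2|'\big\|_{1,[\alpha x_i^-,\alpha x_i^+]}\Big\|_{L_\varphi^{k(1+\zeta^{-1})}},\quad \sup_{i}\Big\|\big\||g^2|''\big\|_{\gamma,[\alpha x_i^-,\alpha x_i^+]}\Big\|_{L_\varphi^{k(1+\zeta^{-1})}}$$ are finite. Let $\pi_n=g\big(\tfrac{x_1}{\sqrt n}\big)\cdots g\big(\tfrac{x_n}{\sqrt n}\big)$. Then the $k$-th free cumulant of $\pi_n\pi_n^*$ satisfies $$\lim_{n\to\infty}\kappa_k^\varphi(\pi_n\pi_n^*)=\frac{k^{k-1}}{k!}\,\big(|g^2|'(0)\,\sigma\big)^{2(k-1)}\,e^{\frac k2|g^2|''(0)\sigma^2}.$$ -/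

import Mathlib

open Filter Topology MeasureTheory Set
open scoped NNReal ENNReal CompactlySupported ComplexOrder

namespace FreeProb

/-- A tracial state on a unital C⋆-algebra `A`: a unital positive linear functional with
`φ (a b) = φ (b a)`. The pair `(A, φ)` is a tracial (C⋆-)probability space. -/
structure TracialState (A : Type*) [CStarAlgebra A] extends A →ₗ[ℂ] ℂ where
  map_one' : toFun 1 = 1
  nonneg' : ∀ a : A, 0 ≤ toFun (star a * a)
  trace' : ∀ a b : A, toFun (a * b) = toFun (b * a)

noncomputable instance {A : Type*} [CStarAlgebra A] : FunLike (TracialState A) A ℂ where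
  coe φ := φ.toFun
  coe_injective φ ψ h := by
    cases φ
    cases ψ
    congr
    exact DFunLike.coe_injective h

instance {A : Type*} [CStarAlgebra A] : LinearMapClass (TracialState A) ℂ A ℂ where
  map_add φ := φ.map_add'
  map_smulₛₗ φ := φ.map_smul'

/-- The family `x` is freely independent: the unital subalgebras generated by the single
elements are free, i.e. alternating products of centered elements are centered. -/
def IsFree {A ι : Type*} [CStarAlgebra A] (φ : TracialState A) (x : ι → A) : Prop :=
  ∀ (m : ℕ) (i : Fin (m + 1) → ι) (a : Fin (m + 1) → A),
    (∀ j, a j ∈ Algebra.adjoin ℂ {x (i j)}) →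
    (∀ j, φ (a j) = 0) →
    (∀ j : Fin m, i j.castSucc ≠ i j.succ) →
    φ (List.ofFn a).prod = 0

/-! ### Free cumulants -/

/-- A partition of `{0, …, n - 1}` is noncrossing if there are no `a < b < c < d` with `a, c` in one
block and `b, d` in a different block. -/
def IsNoncrossing {n : ℕ} (π : Finpartition (Finset.univ : Finset (Fin n))) : Prop :=
  ∀ V ∈ π.parts, ∀ W ∈ π.parts, ∀ a b c d : Fin n,
    a < b → b < c → c < d → a ∈ V → c ∈ V → b ∈ W → d ∈ W → V = W

/-- The set `NC(n)` of noncrossing partitions. -/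
noncomputable def NC (n : ℕ) : Finset (Finpartition (Finset.univ : Finset (Fin n))) := by
  classical exact Finset.univ.filter IsNoncrossing

/-- The set `NC(n) \ {1ₙ}` of noncrossing partitions other than the one-block partition. -/
noncomputable def NC' (n : ℕ) : Finset (Finpartition (Finset.univ : Finset (Fin n))) := by
  classical exact (NC n).filter (fun π => Finset.univ ∉ π.parts)

/-- The sequence of free cumulants of a moment sequence `m`, defined by solving the
moment-cumulant formula `m n = ∑ π ∈ NC n, ∏ V ∈ π, κ (#V)` for the top cumulant. All blocks of
`π ∈ NC' n` have fewer than `n` elements. -/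
noncomputable def cumulantOfMoments (m : ℕ → ℂ) (n : ℕ) : ℂ :=
  m n - ∑ π ∈ NC' n, ∏ V ∈ π.parts, if V.card < n then cumulantOfMoments m V.card else 0
termination_by n

/-- The `k`-th free cumulant `κ_k(a) = κ_k(a, …, a)` of `a` with respect to `φ`. -/
noncomputable def freeCumulant {A : Type*} [CStarAlgebra A] (φ : TracialState A) (k : ℕ) (a : A) :
    ℂ :=
  cumulantOfMoments (fun j => φ (a ^ j)) k

/-- The moment-cumulant formula. -/
theorem moment_cumulant (m : ℕ → ℂ) {n : ℕ} (hn : 0 < n) :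
    m n = ∑ π ∈ NC n, ∏ V ∈ π.parts, cumulantOfMoments m V.card := by
  classical
  have hne : (Finset.univ : Finset (Fin n)) ≠ ⊥ := by
    have : (⟨0, hn⟩ : Fin n) ∈ (Finset.univ : Finset (Fin n)) := Finset.mem_univ _
    intro h
    rw [h] at this
    exact absurd this (Finset.notMem_empty _)
  have h1 : (Finpartition.indiscrete hne) ∈ NC n := by
    simp only [NC, Finset.mem_filter, Finset.mem_univ, true_and]
    intro V hV W hW a b c d _ _ _ _ _ _ _
    simp only [Finpartition.indiscrete_parts, Finset.mem_singleton] at hV hW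
    rw [hV, hW]
  have huniq : ∀ π : Finpartition (Finset.univ : Finset (Fin n)),
      Finset.univ ∈ π.parts → π = Finpartition.indiscrete hne := by
    intro π hπ
    ext V
    simp only [Finpartition.indiscrete_parts, Finset.mem_singleton]
    constructor
    · intro hV
      obtain ⟨v, hv⟩ := π.nonempty_of_mem_parts hV
      exact π.eq_of_mem_parts hV hπ hv (Finset.mem_univ v)
    · rintro rfl
      exact hπ
  have hNC : NC n = insert (Finpartition.indiscrete hne) (NC' n) := by
    ext π
    simp only [NC', Finset.mem_insert, Finset.mem_filter]
    constructor
    · intro h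
      by_cases hu : Finset.univ ∈ π.parts
      · exact Or.inl (huniq π hu)
      · exact Or.inr ⟨h, hu⟩
    · rintro (h | h)
      · rw [h]
        exact h1
      · exact h.1
  have hnot : Finpartition.indiscrete hne ∉ NC' n := by
    simp [NC']
  rw [hNC, Finset.sum_insert hnot]
  have hs : ∑ π ∈ NC' n, ∏ V ∈ π.parts, cumulantOfMoments m V.card =
      ∑ π ∈ NC' n, ∏ V ∈ π.parts,
        if V.card < n then cumulantOfMoments m V.card else 0 := by
    refine Finset.sum_congr rfl fun π hπ => Finset.prod_congr rfl fun V hV => ?_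
    have hlt : V.card < n := by
      have hV' : V ≠ Finset.univ := by
        rintro rfl
        exact (Finset.mem_filter.1 hπ).2 hV
      simpa using Finset.card_lt_card (Finset.ssubset_univ_iff.2 hV')
    rw [if_pos hlt]
  rw [hs, Finpartition.indiscrete_parts, Finset.prod_singleton, Finset.card_univ, Fintype.card_fin,
    cumulantOfMoments]
  ring

/-! ### Spectral distribution and `L^p` norms -/

/-- The positive functional `f ↦ φ (f (x))` on compactly supported continuous functions. -/
noncomputable def functionalOf {A : Type*} [CStarAlgebra A] (φ : TracialState A) (x : A) :
    C_c(ℝ, ℝ) →ₚ[ℝ] ℝ where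
  toFun f := (φ (cfc (fun t : ℝ => f t) x)).re
  map_add' f g := by
    have h : cfc (fun t : ℝ => (f + g) t) x
        = cfc (fun t : ℝ => f t) x + cfc (fun t : ℝ => g t) x :=
      cfc_add x (fun t : ℝ => f t) (fun t : ℝ => g t)
        f.continuous.continuousOn g.continuous.continuousOn
    rw [h, map_add, Complex.add_re]
  map_smul' c f := by
    have h : cfc (fun t : ℝ => (c • f) t) x = (c : ℂ) • cfc (fun t : ℝ => f t) x := by
      have := cfc_smul c (fun t : ℝ => f t) x f.continuous.continuousOn
      simpa using this
    rw [h, map_smul]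
    simp
  monotone' := by
    intro f g hfg
    change (φ (cfc (fun t : ℝ => f t) x)).re ≤ (φ (cfc (fun t : ℝ => g t) x)).re
    have hc : Continuous (fun t : ℝ => Real.sqrt (g t - f t)) :=
      (g.continuous.sub f.continuous).sqrt
    have h : cfc (fun t : ℝ => g t) x = cfc (fun t : ℝ => f t) x +
        star (cfc (fun t : ℝ => Real.sqrt (g t - f t)) x) *
          cfc (fun t : ℝ => Real.sqrt (g t - f t)) x := by
      have h2 : cfc (fun t : ℝ => f t + Real.sqrt (g t - f t) * Real.sqrt (g t - f t)) x =
          cfc (fun t : ℝ => f t) x +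
            cfc (fun t : ℝ => Real.sqrt (g t - f t) * Real.sqrt (g t - f t)) x :=
        cfc_add x (fun t : ℝ => f t) (fun t : ℝ => Real.sqrt (g t - f t) * Real.sqrt (g t - f t))
          f.continuous.continuousOn (hc.mul hc).continuousOn
      have h3 := cfc_mul (fun t : ℝ => Real.sqrt (g t - f t))
        (fun t : ℝ => Real.sqrt (g t - f t)) x hc.continuousOn hc.continuousOn
      rw [← cfc_star]
      simp only [star_trivial]
      rw [← h3, ← h2]
      congr 1
      funext t
      have h0 : 0 ≤ g t - f t := sub_nonneg.2 (hfg t)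
      simp [Real.mul_self_sqrt h0]
    have hp := φ.nonneg' (cfc (fun t : ℝ => Real.sqrt (g t - f t)) x)
    have hp' := (Complex.le_def.1 hp).1
    rw [h, map_add, Complex.add_re]
    exact le_add_of_nonneg_right hp'

/-- The spectral distribution `ν_x` of the self-adjoint element `x`: the measure on `ℝ` with
`∫ f dν_x = φ (f (x))` for all continuous compactly supported `f`. -/
noncomputable def spectralDistribution {A : Type*} [CStarAlgebra A] (φ : TracialState A) (x : A) :
    Measure ℝ :=
  RealRMK.rieszMeasure (functionalOf φ x)

/-- The absolute moment `φ (|x|^p)` of a self-adjoint element, as an extended nonnegative real. -/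
noncomputable def absMoment {A : Type*} [CStarAlgebra A] (φ : TracialState A) (p : ℝ) (x : A) :
    ℝ≥0∞ :=
  ∫⁻ t, ENNReal.ofReal (|t| ^ p) ∂(spectralDistribution φ x)

/-- The `L^p` norm `‖F(x)‖_p` with respect to `φ` of `F(x)`, for a self-adjoint element `x` and
a function `F : ℝ → [0, ∞]`. -/
noncomputable def normLp {A : Type*} [CStarAlgebra A] (φ : TracialState A) (p : ℝ) (F : ℝ → ℝ≥0∞)
    (x : A) : ℝ≥0∞ :=
  (∫⁻ t, F t ^ p ∂(spectralDistribution φ x)) ^ (1 / p)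

/-! ### Hölder conditions -/

/-- The Hölder semi-norm `‖h‖_{γ, I}` of `h` on `I`: the least constant `C ∈ [0, ∞]` with
`|h s - h t| ≤ C |s - t| ^ γ` for all `s, t ∈ I`. -/
noncomputable def holderSeminormOn (γ : ℝ≥0) (h : ℝ → ℝ) (I : Set ℝ) : ℝ≥0∞ :=
  eHolderNorm γ (I.domRestrict h)

/-- The function `t ↦ ‖h‖_{γ, [α t⁻, α t⁺]}` with `t⁻ = min t 0` and `t⁺ = max t 0`. -/
noncomputable def localHolder (γ : ℝ≥0) (α : ℝ) (h : ℝ → ℝ) (t : ℝ) : ℝ≥0∞ :=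
  holderSeminormOn γ h (Icc (α * min t 0) (α * max t 0))

/-- `g` is of class `C^{2,γ}`: twice continuously differentiable with `g''` Hölder continuous of
exponent `γ` on every compact interval. -/
def IsC2Holder (γ : ℝ≥0) (g : ℝ → ℂ) : Prop :=
  ContDiff ℝ 2 g ∧ ∀ a b : ℝ, ∃ C : ℝ≥0, HolderOnWith C γ (iteratedDeriv 2 g) (Icc a b)

/-- The real function `|g²| : t ↦ |g(t)|²`. -/
noncomputable def absSq (g : ℝ → ℂ) (t : ℝ) : ℝ := ‖g t‖ ^ 2

/-! ### The product -/

/-- The element `g(x)`, for `g : ℝ → ℂ` continuous and `x` self-adjoint, by continuous functional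
calculus. -/
noncomputable def applyFun {A : Type*} [CStarAlgebra A] (g : ℝ → ℂ) (x : A) : A :=
  cfc (fun z : ℂ => g z.re) x

/-- The product `π_n = g(x₁/√n) g(x₂/√n) ⋯ g(xₙ/√n)`; the sequence `x₁, x₂, …` is indexed
as `x 0, x 1, …`. -/
noncomputable def prodPi {A : Type*} [CStarAlgebra A] (g : ℝ → ℂ) (x : ℕ → A) (n : ℕ) : A :=
  (List.ofFn fun i : Fin n => applyFun g (((Real.sqrt n)⁻¹ : ℂ) • x i)).prod

end FreeProb

/-!
The moments of `π_n π_n⋆` are computed by free multiplicative convolution. Write `h = |g|²` and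
`y_i = x_i / √n`. Since `φ` is a trace, `g(y₁) B g(y₁)⋆` has the same moments as `h(y₁) B`, and
`h(y₁)` is free from the algebra generated by the other `x_i`. By induction the S-transform of
`π_n π_n⋆` is the product of the S-transforms of the `h(y_i)` (`isSTransform_prod_mul_star`).
S-transforms are treated here as formal power series. Their multiplicativity
(`IsSTransform.mul`, `IsSTransform.mul_of_freeFamily`) is proved by factoring the resolvent of `a b`
through those of `a` and `b`, and the relation to the free cumulants, namely that `w S(w)` is the
compositional inverse of the cumulant series (`IsSTransform.cumulantSeries_subst`), follows from the
first-return decomposition of noncrossing partitions (`ncSum_rec`).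

If `p_j` denotes the `j`-th moment of `h(y_i) - 1`, then the S-transform of `h(y_i)` is
`1 - ∑ p_{m+1} w ^ m` up to terms of second order in the `p_j` (`isBigO_coeff_sSeries`). The Hölder
conditions and Young's inequality give `p₁ = h''(0) σ² / (2n) + o(1/n)`,
`p₂ = (h'(0) σ)² / n + o(1/n)` and `p_j = o(1/n)` for `3 ≤ j ≤ k`, uniformly in `i`
(`isLittleO_perturbationMoment`). Multiplying `n` such factors, the coefficients of the S-transform
of `π_n π_n⋆` converge to those of `exp(-h''(0) σ² / 2 - (h'(0) σ)² w)` (`tendsto_coeff_prod`). The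
coefficients of compositional inverses depend continuously on those of the series
(`tendsto_coeff_of_subst_eq_X`), and `w e ^ (c + d w)` is inverted by the tree function
`∑ j ^ (j - 1) / j! (-d) ^ (j - 1) e ^ (-j c) w ^ j` (`treeSeries_subst`), whose `k`-th coefficient
is the limit of the cumulants.
-/

namespace FreeProb

/-! ### Noncrossing partitions of subsets of a linear order -/

section NoncrossingSums

variable {α : Type*} [LinearOrder α]

/-- `P` is (the set of blocks of) a noncrossing partition of the finite subset `S` of a linear
order. In contrast to `NC n`, the ground set is allowed to vary, so that partitions can be cut into
pieces. -/
structure IsNCPartition (S : Finset α) (P : Finset (Finset α)) : Prop where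
  nonempty : ∀ V ∈ P, V.Nonempty
  sub : ∀ V ∈ P, ∀ s ∈ V, s ∈ S
  cover : ∀ s ∈ S, ∃ V ∈ P, s ∈ V
  disj : ∀ V ∈ P, ∀ W ∈ P, ∀ s, s ∈ V → s ∈ W → V = W
  nc : ∀ V ∈ P, ∀ W ∈ P, ∀ a b c d : α,
    a < b → b < c → c < d → a ∈ V → c ∈ V → b ∈ W → d ∈ W → V = W

open Classical in
/-- The finite set of noncrossing partitions of `S`. -/
noncomputable def ncPartitions (S : Finset α) : Finset (Finset (Finset α)) :=
  S.powerset.powerset.filter (IsNCPartition S)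

lemma mem_ncPartitions {S : Finset α} {P : Finset (Finset α)} :
    P ∈ ncPartitions S ↔ IsNCPartition S P := by
  simp only [ncPartitions, Finset.mem_filter, Finset.mem_powerset, and_iff_right_iff_imp]
  intro h V hV
  exact Finset.mem_powerset.2 fun s hs => h.sub V hV s hs

/-- The sum over all noncrossing partitions of `S` of the product of the weights `f (#V)` of the
blocks, where the block containing `a` is counted with `r` additional elements. -/
noncomputable def ncSum (f : ℕ → ℂ) (S : Finset α) (a : α) (r : ℕ) : ℂ :=
  ∑ P ∈ ncPartitions S, ∏ V ∈ P, f (V.card + if a ∈ V then r else 0)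

lemma ncSum_zero_eq (f : ℕ → ℂ) (S : Finset α) (a b : α) : ncSum f S a 0 = ncSum f S b 0 := by
  simp [ncSum]

/-- Glue a partition `P₁` of the elements strictly between `a` and `j` to a partition `P₂` of the
elements from `j` on, adding `a` to the block of `j`. -/
def glue (a j : α) (P₁ P₂ : Finset (Finset α)) : Finset (Finset α) :=
  P₁ ∪ P₂.image fun V => if j ∈ V then insert a V else V

lemma mem_glue {a j : α} {P₁ P₂ : Finset (Finset α)} {V : Finset α} :
    V ∈ glue a j P₁ P₂ ↔
      V ∈ P₁ ∨ ∃ U ∈ P₂, (j ∈ U ∧ V = insert a U) ∨ (j ∉ U ∧ V = U) := by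
  simp only [glue, Finset.mem_union, Finset.mem_image]
  grind

variable {S : Finset α} {a : α}

lemma isNCPartition_glue (ha : a ∈ S) (hmin : ∀ s ∈ S, a ≤ s) {j : α} (hj : j ∈ S) (haj : a < j)
    {P₁ P₂ : Finset (Finset α)}
    (h₁ : IsNCPartition ((S.erase a).filter (· < j)) P₁)
    (h₂ : IsNCPartition (S.filter (j ≤ ·)) P₂) :
    IsNCPartition S (glue a j P₁ P₂) := by
  have s₁ : ∀ V ∈ P₁, ∀ s ∈ V, s ∈ S ∧ a < s ∧ s < j := by
    intro V hV s hs
    have := h₁.sub V hV s hs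
    have := hmin s
    grind
  have s₂ : ∀ V ∈ P₂, ∀ s ∈ V, s ∈ S ∧ j ≤ s := by
    intro V hV s hs
    have := h₂.sub V hV s hs
    grind
  refine ⟨?_, ?_, ?_, ?_, ?_⟩
  · intro V hV
    rcases mem_glue.1 hV with h | ⟨U, hU, ⟨_, rfl⟩ | ⟨_, rfl⟩⟩
    · exact h₁.nonempty V h
    · exact Finset.insert_nonempty _ _
    · exact h₂.nonempty _ hU
  · intro V hV s hs
    rcases mem_glue.1 hV with h | ⟨U, hU, ⟨_, rfl⟩ | ⟨_, rfl⟩⟩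
    · exact (s₁ V h s hs).1
    · rcases Finset.mem_insert.1 hs with rfl | hs
      · exact ha
      · exact (s₂ U hU s hs).1
    · exact (s₂ _ hU s hs).1
  · intro s hs
    rcases lt_or_ge s j with hsj | hsj
    · by_cases hsa : s = a
      · obtain ⟨U, hU, hjU⟩ := h₂.cover j (by simp [hj])
        exact ⟨insert a U, mem_glue.2 (Or.inr ⟨U, hU, Or.inl ⟨hjU, rfl⟩⟩), by simp [hsa]⟩
      · obtain ⟨U, hU, hjU⟩ := h₁.cover s (by simp [hs, hsa, hsj])
        exact ⟨U, mem_glue.2 (Or.inl hU), hjU⟩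
    · obtain ⟨U, hU, hjU⟩ := h₂.cover s (by simp [hs, hsj])
      by_cases hj' : j ∈ U
      · exact ⟨insert a U, mem_glue.2 (Or.inr ⟨U, hU, Or.inl ⟨hj', rfl⟩⟩), by simp [hjU]⟩
      · exact ⟨U, mem_glue.2 (Or.inr ⟨U, hU, Or.inr ⟨hj', rfl⟩⟩), hjU⟩
  · intro V hV W hW s hsV hsW
    rcases mem_glue.1 hV with h | ⟨U, hU, h⟩ <;> rcases mem_glue.1 hW with h' | ⟨U', hU', h'⟩
    · exact h₁.disj V h W h' s hsV hsW
    · have := s₁ V h s hsV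
      have := s₂ U' hU' s
      grind
    · have := s₁ W h' s hsW
      have := s₂ U hU s
      grind
    · have := h₂.disj U hU U' hU' s
      have := h₂.disj U hU U' hU' j
      have := s₂ U hU s
      have := s₂ U' hU' s
      grind
  · intro V hV W hW p q r t hpq hqr hrt hp hr hq ht
    rcases mem_glue.1 hV with h | ⟨U, hU, h⟩ <;> rcases mem_glue.1 hW with h' | ⟨U', hU', h'⟩
    · exact h₁.nc V h W h' p q r t hpq hqr hrt hp hr hq ht
    · have := s₁ V h p hp
      have := s₁ V h r hr
      have := s₂ U' hU' q
      grind
    · have := s₁ W h' q hq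
      have := s₁ W h' t ht
      have := s₂ U hU r
      grind
    · have hq' : q ∈ U' := by
        have := s₂ U hU p
        grind
      have ht' : t ∈ U' := by
        have := s₂ U hU p
        have := s₂ U' hU' q
        grind
      have hr' : r ∈ U := by
        have := s₂ U' hU' q
        grind
      have e : U = U' := by
        by_cases hpa : p = a
        · have hjU : j ∈ U := by
            have := s₂ U hU p
            grind
          by_cases hqj : q = j
          · exact h₂.disj U hU U' hU' j hjU (hqj ▸ hq')
          · exact h₂.nc U hU U' hU' j q r t
              (lt_of_le_of_ne (s₂ U' hU' q hq').2 (Ne.symm hqj)) hqr hrt hjU hr' hq' ht'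
        · exact h₂.nc U hU U' hU' p q r t hpq hqr hrt (by grind) hr' hq' ht'
      subst e
      grind

lemma glue_inj {j j' : α} (haj : a < j) (haj' : a < j')
    {P₁ P₂ P₁' P₂' : Finset (Finset α)}
    (hj : j ∈ S) (hj' : j' ∈ S) (hmin : ∀ s ∈ S, a ≤ s)
    (h₁ : IsNCPartition ((S.erase a).filter (· < j)) P₁)
    (h₂ : IsNCPartition (S.filter (j ≤ ·)) P₂)
    (h₁' : IsNCPartition ((S.erase a).filter (· < j')) P₁')
    (h₂' : IsNCPartition (S.filter (j' ≤ ·)) P₂')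
    (h : glue a j P₁ P₂ = glue a j' P₁' P₂') : j = j' ∧ P₁ = P₁' ∧ P₂ = P₂' := by
  have key : ∀ {j : α} {P₁ P₂ : Finset (Finset α)}, a < j → j ∈ S →
      IsNCPartition ((S.erase a).filter (· < j)) P₁ → IsNCPartition (S.filter (j ≤ ·)) P₂ →
      (∀ V ∈ glue a j P₁ P₂, a ∈ V → j ∈ V ∧ ∀ i ∈ V, i ≠ a → j ≤ i) ∧
      (∃ V ∈ glue a j P₁ P₂, a ∈ V) ∧
      P₁ = (glue a j P₁ P₂).filter (fun V => ∀ v ∈ V, a < v ∧ v < j) ∧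
      P₂ = ((glue a j P₁ P₂).filter (fun V => ∃ v ∈ V, j ≤ v)).image (·.erase a) := by
    intro j P₁ P₂ haj hj h₁ h₂
    have s₁ : ∀ V ∈ P₁, ∀ s ∈ V, s ∈ S ∧ a < s ∧ s < j := by
      intro V hV s hs
      have := h₁.sub V hV s hs
      have := hmin s
      grind
    have s₂ : ∀ V ∈ P₂, ∀ s ∈ V, s ∈ S ∧ j ≤ s := by
      intro V hV s hs
      have := h₂.sub V hV s hs
      grind
    have n₂ : ∀ V ∈ P₂, ∃ v ∈ V, j ≤ v := by
      intro V hV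
      obtain ⟨v, hv⟩ := h₂.nonempty V hV
      exact ⟨v, hv, (s₂ V hV v hv).2⟩
    have e₂ : ∀ V ∈ P₂, a ∉ V := fun V hV ha => absurd (s₂ V hV a ha).2 (not_le.2 haj)
    refine ⟨?_, ?_, ?_, ?_⟩
    · intro V hV haV
      rcases mem_glue.1 hV with h | ⟨U, hU, h⟩
      · exact absurd (s₁ V h a haV).2.1 (lt_irrefl _)
      · have := e₂ U hU
        have := s₂ U hU
        grind
    · obtain ⟨U, hU, hjU⟩ := h₂.cover j (by simp [hj])
      exact ⟨insert a U, mem_glue.2 (Or.inr ⟨U, hU, Or.inl ⟨hjU, rfl⟩⟩), by simp⟩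
    · ext V
      simp only [Finset.mem_filter, mem_glue]
      constructor
      · exact fun hV => ⟨Or.inl hV, fun v hv => (s₁ V hV v hv).2⟩
      · rintro ⟨hV | ⟨U, hU, h⟩, h'⟩
        · exact hV
        · obtain ⟨v, hv, hjv⟩ := n₂ U hU
          have := h' v
          grind
    · ext V
      simp only [Finset.mem_image, Finset.mem_filter, mem_glue]
      constructor
      · intro hV
        obtain ⟨v, hv, hjv⟩ := n₂ V hV
        have := e₂ V hV
        by_cases hjV : j ∈ V
        · exact ⟨insert a V, ⟨Or.inr ⟨V, hV, Or.inl ⟨hjV, rfl⟩⟩, v, by simp [hv], hjv⟩,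
            Finset.erase_insert this⟩
        · exact ⟨V, ⟨Or.inr ⟨V, hV, Or.inr ⟨hjV, rfl⟩⟩, v, hv, hjv⟩,
            Finset.erase_eq_of_notMem this⟩
      · rintro ⟨W, ⟨hW | ⟨U, hU, h⟩, v, hv, hjv⟩, rfl⟩
        · exact absurd (s₁ W hW v hv).2.2 (not_lt.2 hjv)
        · have := e₂ U hU
          rcases h with ⟨_, rfl⟩ | ⟨_, rfl⟩
          · rwa [Finset.erase_insert this]
          · rwa [Finset.erase_eq_of_notMem this]
  obtain ⟨k1, ⟨V, hV, haV⟩, k3, k4⟩ := key haj hj h₁ h₂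
  obtain ⟨k1', -, k3', k4'⟩ := key haj' hj' h₁' h₂'
  have hjj : j = j' := by
    have p := k1 V hV haV
    have p' := k1' V (h ▸ hV) haV
    exact le_antisymm (p.2 j' p'.1 haj'.ne') (p'.2 j p.1 haj.ne')
  subst hjj
  exact ⟨rfl, by rw [k3, k3', h], by rw [k4, k4', h]⟩

lemma exists_glue (ha : a ∈ S) (hmin : ∀ s ∈ S, a ≤ s) {P : Finset (Finset α)}
    (hP : IsNCPartition S P) (hPa : {a} ∉ P) :
    ∃ j ∈ S.erase a, ∃ P₁ P₂, IsNCPartition ((S.erase a).filter (· < j)) P₁ ∧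
      IsNCPartition (S.filter (j ≤ ·)) P₂ ∧ glue a j P₁ P₂ = P := by
  obtain ⟨V₀, hV₀, haV₀⟩ := hP.cover a ha
  have hne : (V₀.erase a).Nonempty := by
    rw [Finset.nonempty_iff_ne_empty]
    intro h
    have : V₀ = {a} := by
      rw [← Finset.insert_erase haV₀, h]
      rfl
    exact hPa (this ▸ hV₀)
  set j := (V₀.erase a).min' hne with hjdef
  have hjm : j ∈ V₀.erase a := Finset.min'_mem _ _
  have hjV : j ∈ V₀ := Finset.mem_of_mem_erase hjm
  have hja : j ≠ a := Finset.ne_of_mem_erase hjm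
  have hjS : j ∈ S := hP.sub V₀ hV₀ j hjV
  have haj : a < j := lt_of_le_of_ne (hmin j hjS) (Ne.symm hja)
  have hjmin : ∀ i ∈ V₀, i ≠ a → j ≤ i := fun i hi hia =>
    Finset.min'_le _ _ (Finset.mem_erase.2 ⟨hia, hi⟩)
  have hu : ∀ V ∈ P, ∀ s ∈ V, s ∈ V₀ → V = V₀ := fun V hV s hs hs' =>
    hP.disj V hV V₀ hV₀ s hs hs'
  -- a block with an element strictly between `a` and `j` stays between them
  have hbetween : ∀ V ∈ P, ∀ s ∈ V, a < s → s < j → ∀ v ∈ V, a < v ∧ v < j := by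
    intro V hV s hs has hsj v hv
    have hVV : V ≠ V₀ := by
      intro h
      exact absurd (hjmin s (h ▸ hs) has.ne') (not_le.2 hsj)
    have hva : v ≠ a := fun h => hVV (hu V hV a (h ▸ hv) haV₀)
    have hvj : v ≠ j := fun h => hVV (hu V hV j (h ▸ hv) hjV)
    refine ⟨lt_of_le_of_ne (hmin v (hP.sub V hV v hv)) (Ne.symm hva), ?_⟩
    by_contra hcon
    have hjv : j < v := lt_of_le_of_ne (not_lt.1 hcon) (Ne.symm hvj)
    exact hVV (hP.nc V₀ hV₀ V hV a s j v has hsj hjv haV₀ hjV hs hv).symm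
  refine ⟨j, Finset.mem_erase.2 ⟨hja, hjS⟩, P.filter (fun V => ∀ v ∈ V, a < v ∧ v < j),
    (P.filter (fun V => ∃ v ∈ V, j ≤ v)).image (·.erase a), ?_, ?_, ?_⟩
  · refine ⟨?_, ?_, ?_, ?_, ?_⟩
    · exact fun V hV => hP.nonempty V (Finset.mem_filter.1 hV).1
    · intro V hV s hs
      obtain ⟨h1, h2⟩ := Finset.mem_filter.1 hV
      simp [(h2 s hs).2, (h2 s hs).1.ne', hP.sub V h1 s hs]
    · intro s hs
      simp only [Finset.mem_filter, Finset.mem_erase] at hs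
      obtain ⟨V, hV, hsV⟩ := hP.cover s hs.1.2
      exact ⟨V, Finset.mem_filter.2 ⟨hV, hbetween V hV s hsV
        (lt_of_le_of_ne (hmin s hs.1.2) (Ne.symm hs.1.1)) hs.2⟩, hsV⟩
    · exact fun V hV W hW => hP.disj V (Finset.mem_filter.1 hV).1 W (Finset.mem_filter.1 hW).1
    · exact fun V hV W hW => hP.nc V (Finset.mem_filter.1 hV).1 W (Finset.mem_filter.1 hW).1
  · have hge : ∀ V ∈ P, ∀ v ∈ V, j ≤ v → ∀ s ∈ V, s ≠ a → j ≤ s := by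
      intro V hV v hv hjv s hs hsa
      by_contra hcon
      exact absurd (hbetween V hV s hs (lt_of_le_of_ne (hmin s (hP.sub V hV s hs)) (Ne.symm hsa))
        (not_le.1 hcon) v hv).2 (not_lt.2 hjv)
    refine ⟨?_, ?_, ?_, ?_, ?_⟩
    · intro V hV
      simp only [Finset.mem_image, Finset.mem_filter] at hV
      obtain ⟨W, ⟨hW, v, hv, hjv⟩, rfl⟩ := hV
      exact ⟨v, Finset.mem_erase.2 ⟨(haj.trans_le hjv).ne', hv⟩⟩
    · intro V hV s hs
      simp only [Finset.mem_image, Finset.mem_filter] at hV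
      obtain ⟨W, ⟨hW, v, hv, hjv⟩, rfl⟩ := hV
      have := Finset.mem_erase.1 hs
      simp [hge W hW v hv hjv s this.2 this.1, hP.sub W hW s this.2]
    · intro s hs
      simp only [Finset.mem_filter] at hs
      obtain ⟨V, hV, hsV⟩ := hP.cover s hs.1
      exact ⟨V.erase a, Finset.mem_image.2 ⟨V, Finset.mem_filter.2 ⟨hV, s, hsV, hs.2⟩, rfl⟩,
        Finset.mem_erase.2 ⟨(haj.trans_le hs.2).ne', hsV⟩⟩
    · intro V hV W hW s hsV hsW
      simp only [Finset.mem_image, Finset.mem_filter] at hV hW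
      obtain ⟨V, ⟨hV, -⟩, rfl⟩ := hV
      obtain ⟨W, ⟨hW, -⟩, rfl⟩ := hW
      rw [hP.disj V hV W hW s (Finset.mem_of_mem_erase hsV) (Finset.mem_of_mem_erase hsW)]
    · intro V hV W hW p q r t hpq hqr hrt hp hr hq ht
      simp only [Finset.mem_image, Finset.mem_filter] at hV hW
      obtain ⟨V, ⟨hV, -⟩, rfl⟩ := hV
      obtain ⟨W, ⟨hW, -⟩, rfl⟩ := hW
      rw [hP.nc V hV W hW p q r t hpq hqr hrt (Finset.mem_of_mem_erase hp)
        (Finset.mem_of_mem_erase hr) (Finset.mem_of_mem_erase hq) (Finset.mem_of_mem_erase ht)]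
  · have himg : ∀ V ∈ P, (j ∈ V.erase a ∧ V = insert a (V.erase a)) ∨
        (j ∉ V.erase a ∧ V = V.erase a) := by
      intro V hV
      by_cases haV : a ∈ V
      · have := hu V hV a haV haV₀
        subst this
        exact Or.inl ⟨hjm, (Finset.insert_erase haV).symm⟩
      · refine Or.inr ⟨fun h => haV ?_, (Finset.erase_eq_of_notMem haV).symm⟩
        rw [hu V hV j (Finset.mem_of_mem_erase h) hjV]
        exact haV₀
    ext V
    simp only [mem_glue, Finset.mem_image, Finset.mem_filter]
    constructor
    · rintro (h | ⟨U, ⟨W, ⟨hW, -⟩, rfl⟩, h⟩)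
      · exact h.1
      · rcases himg W hW with h' | h'
        · have : V = W := by grind
          exact this ▸ hW
        · have : V = W := by grind
          exact this ▸ hW
    · intro hV
      by_cases h : ∀ v ∈ V, a < v ∧ v < j
      · exact Or.inl ⟨hV, h⟩
      · refine Or.inr ⟨V.erase a, ⟨V, ⟨hV, ?_⟩, rfl⟩, himg V hV⟩
        by_contra hcon
        push Not at hcon
        refine h fun v hv => ⟨lt_of_le_of_ne (hmin v (hP.sub V hV v hv)) fun hav => ?_, hcon v hv⟩
        exact lt_irrefl j (hcon j (hu V hV a (hav ▸ hv) haV₀ ▸ hjV))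

/-- The first-return decomposition of a noncrossing partition: either the smallest element `a` is a
block of its own, or the second smallest element `j` of its block separates the partition into one
of the elements between `a` and `j` and one of the elements from `j` on. -/
lemma ncSum_rec (f : ℕ → ℂ) (ha : a ∈ S) (hmin : ∀ s ∈ S, a ≤ s) (r : ℕ) :
    ncSum f S a r = f (r + 1) * ncSum f (S.erase a) a 0 +
      ∑ j ∈ S.erase a, ncSum f ((S.erase a).filter (· < j)) a 0 *
        ncSum f (S.filter (j ≤ ·)) j (r + 1) := by
  classical
  rw [ncSum, ← Finset.sum_filter_add_sum_filter_not _ (fun P => {a} ∈ P)]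
  congr 1
  · rw [ncSum, Finset.mul_sum]
    have hnot : ∀ P, IsNCPartition (S.erase a) P → ∀ V ∈ P, a ∉ V := fun P hP V hV ha => by
      have := hP.sub V hV a ha
      simp at this
    symm
    refine Finset.sum_bij (fun P _ => insert {a} P) ?_ ?_ ?_ ?_
    · intro P hP
      rw [mem_ncPartitions] at hP
      have hn := hnot P hP
      have hs : ∀ V ∈ P, ∀ s ∈ V, s ∈ S := fun V hV s hs =>
        Finset.mem_of_mem_erase (hP.sub V hV s hs)
      refine Finset.mem_filter.2 ⟨mem_ncPartitions.2 ⟨?_, ?_, ?_, ?_, ?_⟩,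
        Finset.mem_insert_self _ _⟩
      · have := hP.nonempty
        intro V hV
        rcases Finset.mem_insert.1 hV with rfl | hV
        · simp
        · exact this V hV
      · grind
      · intro s hs
        by_cases hsa : s = a
        · exact ⟨{a}, by simp, by simp [hsa]⟩
        · obtain ⟨V, hV, hsV⟩ := hP.cover s (by simp [hs, hsa])
          exact ⟨V, by simp [hV], hsV⟩
      · have := hP.disj
        grind
      · have := hP.nc
        intro V hV W hW p q r t hpq hqr hrt hp hr hq ht
        rcases Finset.mem_insert.1 hV with rfl | hV <;>
          rcases Finset.mem_insert.1 hW with rfl | hW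
        · rfl
        · grind
        · grind
        · exact this V hV W hW p q r t hpq hqr hrt hp hr hq ht
    · intro P hP Q hQ h
      have h1 : {a} ∉ P := fun h => hnot P (mem_ncPartitions.1 hP) _ h (by simp)
      have h2 : {a} ∉ Q := fun h => hnot Q (mem_ncPartitions.1 hQ) _ h (by simp)
      have h' : insert {a} P = insert {a} Q := h
      rw [← Finset.erase_insert h1, h', Finset.erase_insert h2]
    · intro P hP
      obtain ⟨hP, haP⟩ := Finset.mem_filter.1 hP
      rw [mem_ncPartitions] at hP
      refine ⟨P.erase {a}, mem_ncPartitions.2 ⟨?_, ?_, ?_, ?_, ?_⟩, Finset.insert_erase haP⟩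
      · exact fun V hV => hP.nonempty V (Finset.mem_of_mem_erase hV)
      · intro V hV s hs
        have h1 := Finset.mem_erase.1 hV
        refine Finset.mem_erase.2 ⟨?_, hP.sub V h1.2 s hs⟩
        intro hsa
        exact h1.1 (hP.disj V h1.2 _ haP s hs (by simp [hsa]))
      · intro s hs
        have h1 := Finset.mem_erase.1 hs
        obtain ⟨V, hV, hsV⟩ := hP.cover s h1.2
        refine ⟨V, Finset.mem_erase.2 ⟨?_, hV⟩, hsV⟩
        rintro rfl
        exact h1.1 (by simpa using hsV)
      · exact fun V hV W hW => hP.disj V (Finset.mem_of_mem_erase hV) W (Finset.mem_of_mem_erase hW)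
      · exact fun V hV W hW => hP.nc V (Finset.mem_of_mem_erase hV) W (Finset.mem_of_mem_erase hW)
    · intro P hP
      have hn := hnot P (mem_ncPartitions.1 hP)
      have h1 : {a} ∉ P := fun h => hn _ h (by simp)
      rw [Finset.prod_insert h1]
      simp only [Finset.card_singleton, Finset.mem_singleton, if_true, add_comm 1 r]
      congr 1
      exact Finset.prod_congr rfl fun V hV => by simp [hn V hV]
  · simp_rw [ncSum, Finset.sum_mul_sum, ← Finset.sum_product']
    rw [Finset.sum_sigma']
    symm
    refine Finset.sum_bij (fun p _ => glue a p.1 p.2.1 p.2.2) ?_ ?_ ?_ ?_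
    · rintro ⟨j, P₁, P₂⟩ hp
      simp only [Finset.mem_sigma, Finset.mem_erase, Finset.mem_product, mem_ncPartitions] at hp
      obtain ⟨⟨hja, hjS⟩, h₁, h₂⟩ := hp
      have haj : a < j := lt_of_le_of_ne (hmin j hjS) (Ne.symm hja)
      refine Finset.mem_filter.2
        ⟨mem_ncPartitions.2 (isNCPartition_glue ha hmin hjS haj h₁ h₂), ?_⟩
      intro h
      rcases mem_glue.1 h with h | ⟨U, hU, ⟨hjU, h⟩ | ⟨hjU, h⟩⟩
      · have := h₁.sub _ h a (by simp)
        simp at this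
      · have : j ∈ ({a} : Finset α) := by
          rw [h]
          simp [hjU]
        exact hja (by simpa using this)
      · have := h₂.sub _ hU a (by simp [← h])
        simp only [Finset.mem_filter] at this
        exact absurd this.2 (not_le.2 haj)
    · rintro ⟨j, P₁, P₂⟩ hp ⟨j', P₁', P₂'⟩ hp' h
      simp only [Finset.mem_sigma, Finset.mem_erase, Finset.mem_product, mem_ncPartitions] at hp hp'
      obtain ⟨rfl, rfl, rfl⟩ := glue_inj
        (lt_of_le_of_ne (hmin j hp.1.2) (Ne.symm hp.1.1))
        (lt_of_le_of_ne (hmin j' hp'.1.2) (Ne.symm hp'.1.1)) hp.1.2 hp'.1.2 hmin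
        hp.2.1 hp.2.2 hp'.2.1 hp'.2.2 h
      rfl
    · intro P hP
      obtain ⟨hP, haP⟩ := Finset.mem_filter.1 hP
      obtain ⟨j, hj, P₁, P₂, h₁, h₂, rfl⟩ := exists_glue ha hmin (mem_ncPartitions.1 hP) haP
      exact ⟨⟨j, P₁, P₂⟩, by simp [mem_ncPartitions, h₁, h₂, Finset.mem_erase.1 hj], rfl⟩
    · rintro ⟨j, P₁, P₂⟩ hp
      simp only [Finset.mem_sigma, Finset.mem_erase, Finset.mem_product, mem_ncPartitions] at hp
      obtain ⟨⟨hja, hjS⟩, h₁, h₂⟩ := hp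
      have haj : a < j := lt_of_le_of_ne (hmin j hjS) (Ne.symm hja)
      have n₁ : ∀ V ∈ P₁, a ∉ V := fun V hV h => by
        have := h₁.sub _ hV a h
        simp at this
      have n₂ : ∀ V ∈ P₂, a ∉ V := fun V hV h => by
        have := h₂.sub _ hV a h
        simp only [Finset.mem_filter] at this
        exact absurd this.2 (not_le.2 haj)
      dsimp only
      rw [glue, Finset.prod_union, Finset.prod_image]
      · congr 1
        · exact Finset.prod_congr rfl fun V hV => by simp [n₁ V hV]
        · refine Finset.prod_congr rfl fun V hV => ?_
          by_cases hjV : j ∈ V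
          · simp only [hjV, if_true, Finset.mem_insert_self, Finset.card_insert_of_notMem (n₂ V hV)]
            congr 1
            ring
          · simp [hjV, n₂ V hV]
      · intro V hV W hW h
        have := n₂ V hV
        have := n₂ W hW
        dsimp only at h
        by_cases hjV : j ∈ V <;> by_cases hjW : j ∈ W <;>
          simp only [hjV, hjW, if_true, if_false] at h
        · rw [← Finset.erase_insert (n₂ V hV), h, Finset.erase_insert (n₂ W hW)]
        · grind
        · grind
        · exact h
      · rw [Finset.disjoint_left]
        intro V hV hV'
        obtain ⟨U, hU, rfl⟩ := Finset.mem_image.1 hV'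
        obtain ⟨v, hv⟩ := h₂.nonempty U hU
        have h3 := h₂.sub U hU v hv
        have h4 := h₁.sub _ hV v (by split_ifs <;> simp [hv])
        simp only [Finset.mem_filter] at h3 h4
        exact absurd h4.2 (not_lt.2 h3.2)

lemma sum_card_filter_lt (S : Finset α) (F : ℕ → ℂ) :
    ∑ j ∈ S, F (S.filter (· < j)).card = ∑ i ∈ Finset.range S.card, F i := by
  induction S using Finset.induction_on_max with
  | empty => simp
  | insert b T hb ih =>
    have hbT : b ∉ T := fun h => lt_irrefl b (hb b h)
    rw [Finset.sum_insert hbT, Finset.card_insert_of_notMem hbT, Finset.sum_range_succ, add_comm,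
      ← ih]
    congr 1
    · refine Finset.sum_congr rfl fun j hj => ?_
      rw [Finset.filter_insert, if_neg (not_lt.2 (hb j hj).le)]
    · rw [Finset.filter_insert, if_neg (lt_irrefl b), Finset.filter_true_of_mem hb]

/-- The value of `ncSum f S a r` for a set `S` with `n` elements and smallest element `a`. -/
noncomputable def ncWeight (f : ℕ → ℂ) : ℕ → ℕ → ℂ
  | 0, _ => 1
  | n + 1, r => f (r + 1) * ncWeight f n 0 +
      ∑ i : Fin n, ncWeight f i 0 * ncWeight f (n - i) (r + 1)
termination_by n => n
decreasing_by all_goals omega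

lemma ncWeight_succ (f : ℕ → ℂ) (n r : ℕ) :
    ncWeight f (n + 1) r = f (r + 1) * ncWeight f n 0 +
      ∑ i ∈ Finset.range n, ncWeight f i 0 * ncWeight f (n - i) (r + 1) := by
  rw [ncWeight, ← Fin.sum_univ_eq_sum_range
    (fun i => ncWeight f i 0 * ncWeight f (n - i) (r + 1))]

lemma ncSum_empty (f : ℕ → ℂ) (a : α) (r : ℕ) : ncSum f ∅ a r = 1 := by
  have : ncPartitions (∅ : Finset α) = {∅} := by
    ext P
    rw [mem_ncPartitions, Finset.mem_singleton]
    constructor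
    · intro h
      refine Finset.eq_empty_of_forall_notMem fun V hV => ?_
      obtain ⟨v, hv⟩ := h.nonempty V hV
      exact absurd (h.sub V hV v hv) (Finset.notMem_empty v)
    · rintro rfl
      constructor <;> simp
  simp [ncSum, this]

lemma ncSum_eq_ncWeight (f : ℕ → ℂ) (n : ℕ) : ∀ (S : Finset α) (a : α) (r : ℕ), S.card = n →
    (S.Nonempty → a ∈ S) → (∀ s ∈ S, a ≤ s) → ncSum f S a r = ncWeight f n r := by
  induction n using Nat.strong_induction_on with
  | _ n ih =>
  intro S a r hS ha hmin
  rcases n with _ | n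
  · rw [Finset.card_eq_zero.1 hS, ncSum_empty, ncWeight]
  have ih0 : ∀ m < n + 1, ∀ (T : Finset α), T.card = m → ncSum f T a 0 = ncWeight f m 0 := by
    intro m hm T hT
    rcases T.eq_empty_or_nonempty with rfl | hne
    · rw [ncSum_empty, ← hT, Finset.card_empty, ncWeight]
    · rw [ncSum_zero_eq f T a (T.min' hne)]
      exact ih m hm T _ 0 hT (fun _ => T.min'_mem hne) (fun s hs => T.min'_le s hs)
  have haS : a ∈ S := ha (Finset.card_pos.1 (by omega))
  have hc : (S.erase a).card = n := by rw [Finset.card_erase_of_mem haS, hS]; rfl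
  rw [ncSum_rec f haS hmin, ncWeight_succ, ih0 n (by omega) _ hc, ← hc, ← sum_card_filter_lt]
  congr 1
  refine Finset.sum_congr rfl fun j hj => ?_
  obtain ⟨hja, hjS⟩ := Finset.mem_erase.1 hj
  have hlt : ((S.erase a).filter (· < j)).card < n := by
    rw [← hc]
    refine Finset.card_lt_card (Finset.filter_ssubset.2 ⟨j, hj, lt_irrefl j⟩)
  have h2 : (S.filter (j ≤ ·)).card = n - ((S.erase a).filter (· < j)).card := by
    have h3 := Finset.card_filter_add_card_filter_not (s := S.erase a) (· < j)
    have h4 : (S.erase a).filter (fun s => ¬ s < j) = S.filter (j ≤ ·) := by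
      ext s
      have := hmin j hjS
      simp only [Finset.mem_filter, Finset.mem_erase, not_lt]
      constructor
      · exact fun h => ⟨h.1.2, h.2⟩
      · refine fun h => ⟨⟨?_, h.1⟩, h.2⟩
        rintro rfl
        exact hja (le_antisymm h.2 this)
    rw [h4, hc] at h3
    omega
  rw [ih0 _ (by omega) _ rfl, hc, ih (n - ((S.erase a).filter (· < j)).card) (by omega) _ j (r + 1)
    h2 (fun _ => by simp [hjS]) (fun s hs => (Finset.mem_filter.1 hs).2)]

end NoncrossingSums

/-- The sum over `NC n` depends only on the recursion encoded by `ncWeight`. -/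
lemma sum_NC_eq_ncWeight (f : ℕ → ℂ) {n : ℕ} (hn : 0 < n) :
    ∑ π ∈ NC n, ∏ V ∈ π.parts, f V.card = ncWeight f n 0 := by
  classical
  rw [← ncSum_eq_ncWeight f n (Finset.univ : Finset (Fin n)) ⟨0, hn⟩ 0 (by simp) (by simp)
    (fun s _ => Fin.mk_le_of_le_val (Nat.zero_le _))]
  refine Finset.sum_bij (fun π _ => π.parts) ?_ ?_ ?_ ?_
  · intro π hπ
    have hπ' : IsNoncrossing π := (Finset.mem_filter.1 hπ).2
    refine mem_ncPartitions.2 ⟨fun V hV => π.nonempty_of_mem_parts hV, by simp, ?_, ?_, hπ'⟩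
    · intro s hs
      exact π.exists_mem hs
    · exact fun V hV W hW s hs hs' => π.eq_of_mem_parts hV hW hs hs'
  · exact fun π _ ρ _ h => Finpartition.ext h
  · intro P hP
    rw [mem_ncPartitions] at hP
    let π : Finpartition (Finset.univ : Finset (Fin n)) :=
      Finpartition.ofExistsUnique P (fun V _ => Finset.subset_univ V)
        (fun s hs => by
          obtain ⟨V, hV, hsV⟩ := hP.cover s hs
          exact ⟨V, ⟨hV, hsV⟩, fun W hW => hP.disj W hW.1 V hV s hW.2 hsV⟩)
        (fun h => Finset.not_nonempty_empty (hP.nonempty _ h))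
    exact ⟨π, Finset.mem_filter.2 ⟨Finset.mem_univ _, hP.nc⟩, rfl⟩
  · intro π _
    simp

/-! ### Substitution of power series -/

section PowerSeriesTools

open PowerSeries

variable {R : Type*} [CommRing R]

lemma coeff_pow_eq_zero_of_lt {b : R⟦X⟧} (hb : constantCoeff b = 0) {n s : ℕ} (h : n < s) :
    coeff n (b ^ s) = 0 :=
  X_pow_dvd_iff.1 (pow_dvd_pow_of_dvd (X_dvd_iff.2 hb) s) n h

lemma coeff_subst_eq_sum {b : R⟦X⟧} (hb : constantCoeff b = 0) (f : R⟦X⟧) {n N : ℕ} (h : n < N) :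
    coeff n (f.subst b) = ∑ s ∈ Finset.range N, coeff s f * coeff n (b ^ s) := by
  rw [coeff_subst' (HasSubst.of_constantCoeff_zero' hb)]
  simp only [smul_eq_mul]
  refine finsum_eq_sum_of_support_subset _ fun s hs => ?_
  simp only [Finset.coe_range, Set.mem_Iio]
  by_contra hcon
  exact hs (by simp [coeff_pow_eq_zero_of_lt hb (h.trans_le (not_lt.1 hcon))])

end PowerSeriesTools

/-! ### The functional equation between moments and free cumulants -/

section MomentCumulant

open PowerSeries

/-- The generating series `C(z) = ∑_{s ≥ 1} κ_s zˢ` of the free cumulants of the moment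
sequence `m`. -/
noncomputable def cumulantSeries (m : ℕ → ℂ) : ℂ⟦X⟧ :=
  mk fun s => if s = 0 then 0 else cumulantOfMoments m s

/-- With `B_r` the series of the weights `ncWeight f n r`, `n ≥ 1`, and `M = 1 + B_0`, the recursion
reads `B_r = z M (f (r + 1) + B_{r+1})`. -/
lemma mk_ncWeight_eq (f : ℕ → ℂ) (r : ℕ) :
    (mk fun n => if n = 0 then 0 else ncWeight f n r) =
      X * mk (fun n => ncWeight f n 0) *
        (C (f (r + 1)) + mk fun n => if n = 0 then 0 else ncWeight f n (r + 1)) := by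
  ext n
  rcases n with _ | n
  · simp [mul_assoc]
  · rw [mul_assoc, coeff_succ_X_mul, mul_add, map_add, coeff_mul_C, coeff_mk, coeff_mk,
      if_neg (Nat.succ_ne_zero n), ncWeight_succ, coeff_mul,
      Finset.Nat.sum_antidiagonal_eq_sum_range_succ_mk, Finset.sum_range_succ, mul_comm]
    simp only [coeff_mk, Nat.sub_self, if_true, mul_zero, add_zero]
    congr 1
    refine Finset.sum_congr rfl fun i hi => ?_
    rw [if_neg]
    have := Finset.mem_range.1 hi
    omega

lemma mk_ncWeight_eq_sum (f : ℕ → ℂ) (N : ℕ) :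
    (mk fun n => if n = 0 then 0 else ncWeight f n 0) =
      ∑ s ∈ Finset.range N, C (f (s + 1)) * (X * mk (fun n => ncWeight f n 0)) ^ (s + 1) +
        (X * mk (fun n => ncWeight f n 0)) ^ N *
          mk fun n => if n = 0 then 0 else ncWeight f n N := by
  induction N with
  | zero => simp
  | succ N ih =>
    rw [ih, Finset.sum_range_succ, mk_ncWeight_eq f N]
    ring

/-- The generating series `M(z) = ∑ m_n zⁿ` of the moments and the generating series
`C(z) = ∑_{s ≥ 1} κ_s zˢ` of the free cumulants satisfy `M(z) = 1 + C(z M(z))`. -/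
theorem moment_eq_one_add_cumulantSeries_subst (m : ℕ → ℂ) (h0 : m 0 = 1) :
    (mk m : ℂ⟦X⟧) = 1 + (cumulantSeries m).subst (X * mk m : ℂ⟦X⟧) := by
  set f := cumulantOfMoments m with hf
  have hm : ∀ n, m n = ncWeight f n 0 := by
    intro n
    rcases Nat.eq_zero_or_pos n with rfl | hn
    · rw [h0, ncWeight]
    · rw [moment_cumulant m hn, sum_NC_eq_ncWeight f hn]
  have hm' : m = fun n => ncWeight f n 0 := funext hm
  have hb : constantCoeff (X * mk m : ℂ⟦X⟧) = 0 := by simp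
  have h1 : (mk m : ℂ⟦X⟧) = 1 + mk fun n => if n = 0 then 0 else ncWeight f n 0 := by
    ext n
    rw [map_add, coeff_mk, coeff_mk, coeff_one]
    by_cases hn : n = 0
    · simp [hn, h0]
    · simp [hn, hm n]
  conv_lhs => rw [h1]
  congr 1
  ext n
  rw [coeff_subst_eq_sum hb _ ((Nat.lt_succ_self n).trans (Nat.lt_succ_self (n + 1))),
    Finset.sum_range_succ',
    mk_ncWeight_eq_sum f (n + 1), ← hm', map_add, map_sum]
  have hz : coeff n ((X * mk m : ℂ⟦X⟧) ^ (n + 1) *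
      mk fun l => if l = 0 then 0 else ncWeight f l (n + 1)) = 0 := by
    refine X_pow_dvd_iff.1 (Dvd.dvd.mul_right (pow_dvd_pow_of_dvd (X_dvd_iff.2 hb) _) _) n
      (Nat.lt_succ_self n)
  rw [hz, add_zero]
  simp [cumulantSeries, hf]

end MomentCumulant

/-! ### Power series over an algebra and resolvents -/

section SeriesOverAlgebra

open PowerSeries

variable {A : Type*} [Ring A] [Algebra ℂ A]

/-- A linear functional applied to a power series coefficientwise. -/
noncomputable def mapFunctional (φ : A →ₗ[ℂ] ℂ) (F : A⟦X⟧) : ℂ⟦X⟧ :=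
  mk fun n => φ (coeff n F)

/-- Scalar power series as power series over the algebra. -/
noncomputable abbrev scalarSeries (A : Type*) [Ring A] [Algebra ℂ A] : ℂ⟦X⟧ →+* A⟦X⟧ :=
  PowerSeries.map (algebraMap ℂ A)

lemma coeff_scalarSeries_mul (r : ℂ⟦X⟧) (F : A⟦X⟧) (n : ℕ) :
    coeff n (scalarSeries A r * F) =
      ∑ p ∈ Finset.HasAntidiagonal.antidiagonal n, coeff p.1 r • coeff p.2 F := by
  simp [coeff_mul, Algebra.smul_def]

lemma coeff_scalarSeries_mul_C (r : ℂ⟦X⟧) (a : A) (n : ℕ) :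
    coeff n (scalarSeries A r * C a) = coeff n r • a := by
  simp [coeff_mul_C, Algebra.smul_def]

lemma scalarSeries_commute (r : ℂ⟦X⟧) (F : A⟦X⟧) : Commute (scalarSeries A r) F := by
  ext n
  rw [coeff_mul, coeff_mul, ← Finset.Nat.sum_antidiagonal_swap]
  refine Finset.sum_congr rfl fun p _ => ?_
  simp [Algebra.commutes]

lemma mapFunctional_add (φ : A →ₗ[ℂ] ℂ) (F G : A⟦X⟧) :
    mapFunctional φ (F + G) = mapFunctional φ F + mapFunctional φ G := by
  ext n
  simp [mapFunctional]

lemma mapFunctional_scalarSeries_mul (φ : A →ₗ[ℂ] ℂ) (r : ℂ⟦X⟧) (F : A⟦X⟧) :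
    mapFunctional φ (scalarSeries A r * F) = r * mapFunctional φ F := by
  ext n
  rw [mapFunctional, coeff_mk, coeff_scalarSeries_mul, coeff_mul, map_sum]
  simp [mapFunctional]

lemma mapFunctional_one {φ : A →ₗ[ℂ] ℂ} (h1 : φ 1 = 1) : mapFunctional φ (1 : A⟦X⟧) = 1 := by
  ext n
  simp only [mapFunctional, coeff_mk, coeff_one]
  split_ifs <;> simp [h1]

lemma mapFunctional_eq_zero {φ : A →ₗ[ℂ] ℂ} {F : A⟦X⟧} (h : ∀ n, coeff n F ∈ LinearMap.ker φ) :
    mapFunctional φ F = 0 := by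
  ext n
  simpa [mapFunctional] using h n

lemma coeff_mul_mem {S T : Submodule ℂ A} {F G : A⟦X⟧} {n : ℕ} (hF : ∀ i, coeff i F ∈ S)
    (hG : ∀ i ≤ n, coeff i G ∈ T) : coeff n (F * G) ∈ S * T := by
  rw [coeff_mul]
  exact Submodule.sum_mem _ fun p hp =>
    Submodule.mul_mem_mul (hF _) (hG _ (by
      have := Finset.HasAntidiagonal.mem_antidiagonal.1 hp
      omega))

/-- The resolvent `(1 - χ a)⁻¹` of `a`, for a scalar power series `χ` without constant term. -/
lemma exists_resolvent (χ : ℂ⟦X⟧) (hχ : constantCoeff χ = 0) (a : A) :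
    ∃ R : A⟦X⟧, (1 - scalarSeries A χ * C a) * R = 1 ∧ R * (1 - scalarSeries A χ * C a) = 1 ∧
      ∀ n, coeff n R = ∑ s ∈ Finset.range (n + 1), coeff n (χ ^ s) • a ^ s := by
  have hu : IsUnit (1 - scalarSeries A χ * C a) := by
    rw [isUnit_iff_constantCoeff, map_sub, map_mul, ← coeff_zero_eq_constantCoeff_apply
      (scalarSeries A χ), coeff_map, coeff_zero_eq_constantCoeff_apply, hχ]
    simp
  obtain ⟨⟨U, R, h1, h2⟩, hU⟩ := hu
  dsimp only at hU
  subst hU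
  refine ⟨R, h1, h2, fun n => ?_⟩
  set y := scalarSeries A χ * C a with hy
  have hR : R = 1 + y * R := by
    rw [sub_mul, one_mul] at h1
    rw [← h1]
    abel
  have hgeom : ∀ N, R = ∑ s ∈ Finset.range N, y ^ s + y ^ N * R := by
    intro N
    induction N with
    | zero => simp
    | succ N ih =>
      have : y ^ N * R = y ^ N + y ^ N * (y * R) := by
        conv_lhs => rw [hR, mul_add, mul_one]
      rw [Finset.sum_range_succ, pow_succ, add_assoc, mul_assoc, ← this]
      exact ih
  have hpow : ∀ s, y ^ s = scalarSeries A (χ ^ s) * C (a ^ s) := by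
    intro s
    rw [hy, (scalarSeries_commute χ (C a)).mul_pow, map_pow, map_pow]
  have hz : coeff n (y ^ (n + 1) * R) = 0 := by
    rw [hpow, mul_assoc, coeff_scalarSeries_mul]
    refine Finset.sum_eq_zero fun p hp => ?_
    have := Finset.HasAntidiagonal.mem_antidiagonal.1 hp
    rw [coeff_pow_eq_zero_of_lt hχ (by omega), zero_smul]
  rw [hgeom (n + 1), map_add, hz, add_zero, map_sum]
  exact Finset.sum_congr rfl fun s _ => by rw [hpow, coeff_scalarSeries_mul_C]

lemma mapFunctional_resolvent (φ : A →ₗ[ℂ] ℂ) {χ : ℂ⟦X⟧} (hχ : constantCoeff χ = 0) {a : A}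
    {R : A⟦X⟧} (hR : ∀ n, coeff n R = ∑ s ∈ Finset.range (n + 1), coeff n (χ ^ s) • a ^ s) :
    mapFunctional φ R = (mk fun n => φ (a ^ n) : ℂ⟦X⟧).subst χ := by
  ext n
  rw [coeff_subst_eq_sum hχ _ (Nat.lt_succ_self n)]
  simp [mapFunctional, hR, mul_comm]

end SeriesOverAlgebra

/-! ### Multiplicativity of the S-transform -/

section STransform

open PowerSeries

/-- `T` is the S-transform, as a formal power series, of the moment sequence `m`: with
`χ(w) = w T(w) / (1 + w)`, the moment generating series `M(z) = ∑ m_n zⁿ` satisfies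
`M(χ(w)) = 1 + w`. -/
def IsSTransform (m : ℕ → ℂ) (T : ℂ⟦X⟧) : Prop :=
  (mk m : ℂ⟦X⟧).subst (X * T * (1 + X)⁻¹ : ℂ⟦X⟧) = 1 + X

lemma one_add_X_mul_inv : (1 + X : ℂ⟦X⟧) * (1 + X)⁻¹ = 1 :=
  PowerSeries.mul_inv_cancel _ (by simp)

variable {A : Type*} [Ring A] [Algebra ℂ A]

/-- The centered elements of a subalgebra, with respect to the functional `φ`. -/
def centered (φ : A →ₗ[ℂ] ℂ) (𝒜 : Subalgebra ℂ A) : Submodule ℂ A :=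
  Subalgebra.toSubmodule 𝒜 ⊓ LinearMap.ker φ

/-- The resolvent `(1 - χ a)⁻¹` at the argument given by the S-transform is `1 + w + w α`, where
`α` has centered coefficients. -/
lemma exists_resolvent_centered {φ : A →ₗ[ℂ] ℂ} (h1 : φ 1 = 1) {𝒜 : Subalgebra ℂ A} {a : A}
    (ha : a ∈ 𝒜) {T : ℂ⟦X⟧} (hT : IsSTransform (fun n => φ (a ^ n)) T) :
    ∃ R α : A⟦X⟧, (1 - scalarSeries A (X * T * (1 + X)⁻¹) * C a) * R = 1 ∧
      R * (1 - scalarSeries A (X * T * (1 + X)⁻¹) * C a) = 1 ∧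
      R = 1 + X + X * α ∧ ∀ n, coeff n α ∈ centered φ 𝒜 := by
  have hχ : constantCoeff (X * T * (1 + X)⁻¹ : ℂ⟦X⟧) = 0 := by simp
  obtain ⟨R, hR1, hR2, hR⟩ := exists_resolvent (A := A) _ hχ a
  have hΦ := mapFunctional_resolvent φ hχ hR
  rw [hT] at hΦ
  refine ⟨R, mk fun n => coeff (n + 1) R - coeff n 1, hR1, hR2, ?_, ?_⟩
  · ext n
    rcases n with _ | n
    · simp [hR]
    · simp [coeff_succ_X_mul, coeff_one, coeff_X]
  · intro n
    refine ⟨?_, ?_⟩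
    · rw [coeff_mk, hR, coeff_one]
      refine sub_mem (sum_mem fun s _ => 𝒜.smul_mem (pow_mem ha s) _) ?_
      split_ifs
      · exact one_mem 𝒜
      · exact zero_mem 𝒜
    · have h := congrArg (coeff (n + 1)) hΦ
      simp only [mapFunctional, coeff_mk, map_add, coeff_one, coeff_X] at h
      change φ _ = 0
      rw [coeff_mk, map_sub, h, coeff_one]
      split_ifs <;> simp_all

/-- The equation determines the coefficients of `F` recursively, by words starting with those of
`F₀` or `G`. -/
lemma coeff_mem_of_one_add_X_mul_eq {V S : Submodule ℂ A} (hS : S * V ≤ V) {F F₀ G : A⟦X⟧}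
    (hG : ∀ n, coeff n G ∈ S) (hF₀ : ∀ n, coeff n F₀ ∈ V) (h : (1 + X) * F = F₀ + X * (G * F)) :
    ∀ n, coeff n F ∈ V := by
  intro n
  induction n using Nat.strong_induction_on with
  | _ n ih =>
    have h' := congrArg (coeff n) h
    rw [add_mul, one_mul, map_add, map_add] at h'
    rcases n with _ | n
    · simp only [coeff_zero_X_mul, add_zero] at h'
      rw [h']
      exact hF₀ 0
    · rw [coeff_succ_X_mul, coeff_succ_X_mul] at h'
      rw [eq_sub_of_add_eq h']
      refine sub_mem (add_mem (hF₀ _) (hS (coeff_mul_mem hG fun i hi => ih i (by omega)))) ?_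
      exact ih n (by omega)

/-- **Multiplicativity of the S-transform**, after Haagerup. Freeness of `𝒜` and `ℬ` enters through
a space `V` which contains the words in centered elements that start in `𝒜`. -/
theorem IsSTransform.mul {φ : A →ₗ[ℂ] ℂ} (h1 : φ 1 = 1) {𝒜 ℬ : Subalgebra ℂ A} {a b : A}
    (ha : a ∈ 𝒜) (hb : b ∈ ℬ) {V : Submodule ℂ A} (hV1 : 1 ≤ V) (hVA : centered φ 𝒜 ≤ V)
    (hV : centered φ 𝒜 * centered φ ℬ * V ≤ V)
    (hABV : centered φ 𝒜 * centered φ ℬ * V ≤ LinearMap.ker φ)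
    (hBV : centered φ ℬ * V ≤ LinearMap.ker φ)
    {T T' : ℂ⟦X⟧} (hT : IsSTransform (fun n => φ (a ^ n)) T)
    (hT' : IsSTransform (fun n => φ (b ^ n)) T') :
    IsSTransform (fun n => φ ((a * b) ^ n)) (T * T') := by
  obtain ⟨Ra, α, hRa1, hRa2, hRa, hα⟩ := exists_resolvent_centered h1 ha hT
  obtain ⟨Rb, β, hRb1, hRb2, hRb, hβ⟩ := exists_resolvent_centered h1 hb hT'
  have hχ : constantCoeff (X * (T * T') * (1 + X)⁻¹ : ℂ⟦X⟧) = 0 := by simp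
  obtain ⟨Y, hY1, hY2, hY⟩ := exists_resolvent (A := A) _ hχ (a * b)
  have hΦY := mapFunctional_resolvent φ hχ hY
  rw [IsSTransform, ← hΦY]
  set p := scalarSeries A (X * T * (1 + X)⁻¹) * C a with hp
  set q := scalarSeries A (X * T' * (1 + X)⁻¹) * C b with hq
  set Z := 1 - scalarSeries A (X * (T * T') * (1 + X)⁻¹) * C (a * b) with hZ
  have hX : scalarSeries A X = X := by simp [scalarSeries]
  have hX1 : scalarSeries A (1 + X) = 1 + X := by simp [scalarSeries]
  have hc : ∀ F : A⟦X⟧, F * X = X * F := fun F => by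
    rw [← hX]
    exact (scalarSeries_commute X F).eq.symm
  have hXinj : ∀ F G : A⟦X⟧, X * F = X * G → F = G := by
    intro F G h
    ext n
    have := congrArg (coeff (n + 1)) h
    rwa [coeff_succ_X_mul, coeff_succ_X_mul] at this
  have hXZ : X * Z = X - (1 + X) * (p * q) := by
    have e : (X : ℂ⟦X⟧) * (X * (T * T') * (1 + X)⁻¹) =
        (1 + X) * ((X * T * (1 + X)⁻¹) * (X * T' * (1 + X)⁻¹)) := by
      have := one_add_X_mul_inv
      linear_combination (-X ^ 2 * T * T' * (1 + X : ℂ⟦X⟧)⁻¹) * this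
    have e' := congrArg (scalarSeries A) e
    rw [map_mul (scalarSeries A) X, map_mul (scalarSeries A) (1 + X),
      map_mul (scalarSeries A) (X * T * (1 + X)⁻¹), hX, hX1] at e'
    rw [hZ, mul_sub, mul_one, ← mul_assoc, e', hp, hq, map_mul C]
    have := (scalarSeries_commute (X * T' * (1 + X)⁻¹) (C a)).eq
    generalize scalarSeries A (X * T * (1 + X)⁻¹) = u at *
    generalize scalarSeries A (X * T' * (1 + X)⁻¹) = v at *
    congr 1
    rw [mul_assoc (1 + X), mul_assoc u v, mul_assoc u (C a), ← mul_assoc v, this,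
      mul_assoc (C a)]
  have hRap : Ra * p = Ra - 1 := by
    rw [mul_sub, mul_one] at hRa2
    rw [← hRa2]
    abel
  have hRbq : q * Rb = Rb - 1 := by
    rw [sub_mul, one_mul] at hRb1
    rw [← hRb1]
    abel
  set D : A⟦X⟧ := (1 + X) - X * (α * β) with hD
  -- the resolvents of `a` and `b` reduce that of `a b` to the inverse of `1 + w - w α β`
  have hRZR : Ra * Z * Rb = D := by
    apply hXinj
    have e1 : X * (Ra * Z * Rb) = X * (Ra * Rb) - (1 + X) * ((Ra - 1) * (Rb - 1)) := by
      rw [← hRap, ← hRbq]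
      have : X * (Ra * Z * Rb) = Ra * (X * Z) * Rb := by
        simp only [← mul_assoc]
        rw [hc Ra]
      rw [this, hXZ, mul_sub, sub_mul, hc Ra, mul_assoc]
      congr 1
      have : Ra * (1 + X) = (1 + X) * Ra := by rw [mul_add, add_mul, hc]; simp
      simp only [← mul_assoc]
      rw [this]
    rw [e1, hRa, hRb, hD]
    have hcα := hc α
    clear_value p q Z
    have e2 : ∀ G, α * (X * G) = X * (α * G) := fun G => by rw [← mul_assoc, hc α, mul_assoc]
    simp only [mul_add, add_mul, mul_sub, sub_mul, mul_one, one_mul, mul_assoc, hcα, e2]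
    abel
  have hDu : IsUnit D := by
    rw [isUnit_iff_constantCoeff]
    simp [hD]
  obtain ⟨⟨D', E, hDE, hED⟩, hD'⟩ := hDu
  dsimp only at hD'
  subst hD'
  have hYe : Y = Rb * E * Ra := by
    have e1 : Z * Rb * E = 1 - p := by
      have : (1 - p) * (Ra * Z * Rb * E) = (1 - p) * 1 := by rw [hRZR, hDE]
      simp only [← mul_assoc] at this
      rwa [hRa1, one_mul, mul_one] at this
    have e2 : Z * (Rb * E * Ra) = 1 := by
      simp only [← mul_assoc]
      rw [e1, hRa1]
    calc Y = Y * (Z * (Rb * E * Ra)) := by rw [e2, mul_one]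
      _ = Rb * E * Ra := by rw [← mul_assoc, hY2, one_mul]
  have hαβ : ∀ n, coeff n (α * β) ∈ centered φ 𝒜 * centered φ ℬ := fun n =>
    coeff_mul_mem hα fun i _ => hβ i
  have hE : (1 + X) * E = 1 + X * (α * β * E) := by
    have : (1 + X - X * (α * β)) * E = 1 := hDE
    rw [sub_mul, mul_assoc X] at this
    exact eq_add_of_sub_eq this
  have hEα : (1 + X) * (E * α) = α + X * (α * β * (E * α)) := by
    rw [← mul_assoc, hE, add_mul, one_mul]
    simp only [mul_assoc]
  have hEV := coeff_mem_of_one_add_X_mul_eq hV hαβ (fun n => by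
    rw [coeff_one]
    split_ifs
    · exact Submodule.one_le.1 hV1
    · exact zero_mem V) hE
  have hEαV := coeff_mem_of_one_add_X_mul_eq hV hαβ (fun n => hVA (hα n)) hEα
  -- all words occurring in `(1 + w + w β) E (1 + w + w α)`, except those in `E`, have trace zero
  have v1 : mapFunctional φ (β * E) = 0 :=
    mapFunctional_eq_zero fun n => hBV (coeff_mul_mem hβ fun i _ => hEV i)
  have v2 : mapFunctional φ (β * (E * α)) = 0 :=
    mapFunctional_eq_zero fun n => hBV (coeff_mul_mem hβ fun i _ => hEαV i)
  have v3 : mapFunctional φ (α * β * E) = 0 :=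
    mapFunctional_eq_zero fun n => hABV (coeff_mul_mem hαβ fun i _ => hEV i)
  have v4 : mapFunctional φ (α * β * (E * α)) = 0 :=
    mapFunctional_eq_zero fun n => hABV (coeff_mul_mem hαβ fun i _ => hEαV i)
  have v5 : mapFunctional φ α = 0 := mapFunctional_eq_zero fun n => (hα n).2
  have w1 : (1 + X) * mapFunctional φ E = 1 := by
    have := congrArg (mapFunctional φ) hE
    rw [← hX1, mapFunctional_scalarSeries_mul, mapFunctional_add, ← hX,
      mapFunctional_scalarSeries_mul, v3, mapFunctional_one h1, mul_zero, add_zero] at this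
    exact this
  have w2 : (1 + X) * mapFunctional φ (E * α) = 0 := by
    have := congrArg (mapFunctional φ) hEα
    rw [← hX1, mapFunctional_scalarSeries_mul, mapFunctional_add, ← hX,
      mapFunctional_scalarSeries_mul, v4, v5, mul_zero, add_zero] at this
    exact this
  have hYexp : Y = scalarSeries A ((1 + X) * (1 + X)) * E + scalarSeries A ((1 + X) * X) * (E * α)
      + scalarSeries A (X * (1 + X)) * (β * E) + scalarSeries A (X * X) * (β * (E * α)) := by
    rw [hYe, hRa, hRb]
    have e2 : ∀ F G : A⟦X⟧, F * (X * G) = X * (F * G) := fun F G => by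
      rw [← mul_assoc, hc F, mul_assoc]
    rw [map_mul, map_mul, map_mul, map_mul, hX1, hX]
    simp only [mul_add, add_mul, mul_one, one_mul, mul_assoc, hc E, e2 E, e2 β]
    abel
  rw [hYexp, mapFunctional_add, mapFunctional_add, mapFunctional_add,
    mapFunctional_scalarSeries_mul, mapFunctional_scalarSeries_mul, mapFunctional_scalarSeries_mul,
    mapFunctional_scalarSeries_mul, v1, v2]
  linear_combination (1 + X) * w1 + X * w2

end STransform

/-! ### Words in free families of algebras -/

section Words

variable {A ι : Type*} [Ring A] [Algebra ℂ A] (φ : A →ₗ[ℂ] ℂ) (𝒜 : ι → Subalgebra ℂ A)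

/-- The span of the products `a₁ ⋯ a_r` of centered elements `a_j ∈ 𝒜 (i_j)`, where
`l = [i₁, …, i_r]`. -/
def word (l : List ι) : Submodule ℂ A :=
  (l.map fun i => centered φ (𝒜 i)).prod

/-- The span of the words in centered elements with index list in `L`. -/
def wordSpan (L : Set (List ι)) : Submodule ℂ A :=
  ⨆ l ∈ L, word φ 𝒜 l

/-- Freeness of a family of subalgebras: words in centered elements from changing subalgebras are
centered. -/
def FreeFamily : Prop :=
  ∀ l : List ι, l ≠ [] → l.IsChain (· ≠ ·) → word φ 𝒜 l ≤ LinearMap.ker φ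

/-- The lists over `J` without equal neighbours. -/
def altLists (J : Set ι) : Set (List ι) :=
  {l | l.IsChain (· ≠ ·) ∧ ∀ i ∈ l, i ∈ J}

variable {φ 𝒜}

@[simp] lemma word_nil : word φ 𝒜 ([] : List ι) = 1 := by simp [word]

lemma word_cons (i : ι) (l : List ι) : word φ 𝒜 (i :: l) = centered φ (𝒜 i) * word φ 𝒜 l := by
  simp [word]

lemma word_append (l l' : List ι) : word φ 𝒜 (l ++ l') = word φ 𝒜 l * word φ 𝒜 l' := by
  simp [word]

lemma word_singleton (i : ι) : word φ 𝒜 [i] = centered φ (𝒜 i) := by simp [word]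

lemma word_le_wordSpan {L : Set (List ι)} {l : List ι} (h : l ∈ L) :
    word φ 𝒜 l ≤ wordSpan φ 𝒜 L :=
  le_iSup₂_of_le l h le_rfl

lemma wordSpan_mul_le {L L' : Set (List ι)} {U : Submodule ℂ A}
    (h : ∀ l ∈ L, ∀ l' ∈ L', word φ 𝒜 l * word φ 𝒜 l' ≤ U) :
    wordSpan φ 𝒜 L * wordSpan φ 𝒜 L' ≤ U := by
  simp only [wordSpan, Submodule.iSup_mul, Submodule.mul_iSup, iSup_le_iff]
  exact fun l' hl' l hl => h l hl l' hl'

lemma le_centered_sup_one (h1 : φ 1 = 1) (ℬ : Subalgebra ℂ A) :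
    Subalgebra.toSubmodule ℬ ≤ centered φ ℬ ⊔ 1 := by
  intro x hx
  have hc : x - φ x • (1 : A) ∈ centered φ ℬ := by
    refine ⟨ℬ.sub_mem hx (ℬ.smul_mem ℬ.one_mem _), ?_⟩
    change φ _ = 0
    simp [h1]
  have := Submodule.add_mem_sup hc
    (Submodule.smul_mem (1 : Submodule ℂ A) (φ x) (Submodule.one_le.1 le_rfl))
  simpa using this

/-- If two alternating words meet in the same subalgebra, then the product of the adjacent letters
is again centered up to a scalar, and the scalar leaves a product of shorter words. -/
lemma word_mul_word_le (h1 : φ 1 = 1) {J : Set ι} {l l' : List ι} (hl : l ∈ altLists J)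
    (hl' : l' ∈ altLists J) : word φ 𝒜 l * word φ 𝒜 l' ≤ wordSpan φ 𝒜 (altLists J) := by
  induction l' generalizing l with
  | nil => simpa using word_le_wordSpan hl
  | cons j l₁ ih =>
    rcases l.eq_nil_or_concat with rfl | ⟨l₀, i, rfl⟩
    · simpa using word_le_wordSpan hl'
    have hl₀ : l₀ ∈ altLists J := by
      have := hl.1
      rw [List.concat_eq_append, List.isChain_append] at this
      exact ⟨this.1, fun s hs => hl.2 s (by simp [hs])⟩
    have hl₁ : l₁ ∈ altLists J := ⟨hl'.1.tail, fun s hs => hl'.2 s (by simp [hs])⟩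
    by_cases hij : i = j
    · subst hij
      have hmid : centered φ (𝒜 i) * centered φ (𝒜 i) ≤ centered φ (𝒜 i) ⊔ 1 := by
        refine le_trans ?_ (le_centered_sup_one h1 (𝒜 i))
        rw [Submodule.mul_le]
        exact fun x hx y hy => (𝒜 i).mul_mem hx.1 hy.1
      rw [List.concat_eq_append, word_append, word_singleton, word_cons]
      calc word φ 𝒜 l₀ * centered φ (𝒜 i) * (centered φ (𝒜 i) * word φ 𝒜 l₁)
          = word φ 𝒜 l₀ * (centered φ (𝒜 i) * centered φ (𝒜 i)) * word φ 𝒜 l₁ := by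
            simp only [mul_assoc]
        _ ≤ word φ 𝒜 l₀ * (centered φ (𝒜 i) ⊔ 1) * word φ 𝒜 l₁ := by gcongr
        _ = word φ 𝒜 (l₀ ++ i :: l₁) ⊔ word φ 𝒜 l₀ * word φ 𝒜 l₁ := by
            rw [Submodule.mul_sup, Submodule.sup_mul, mul_one, word_append, word_cons, mul_assoc]
        _ ≤ wordSpan φ 𝒜 (altLists J) := by
            refine sup_le (word_le_wordSpan ⟨?_, ?_⟩) (ih hl₀ hl₁)
            · have := hl.1
              rw [List.concat_eq_append, List.isChain_append] at this
              rw [List.isChain_append]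
              exact ⟨this.1, hl'.1, by simpa using this.2.2⟩
            · intro s hs
              rcases List.mem_append.1 hs with h | h
              · exact hl₀.2 s h
              · exact hl'.2 s h
    · rw [← word_append]
      refine word_le_wordSpan ⟨?_, ?_⟩
      · rw [List.isChain_append]
        exact ⟨hl.1, hl'.1, by simpa using hij⟩
      · intro s hs
        rcases List.mem_append.1 hs with h | h
        · exact hl.2 s h
        · exact hl'.2 s h

/-- The algebra generated by the subalgebras `𝒜 j` with `j ∈ J`, described as the span of the
alternating words in centered elements. -/
def generated (h1 : φ 1 = 1) (𝒜 : ι → Subalgebra ℂ A) (J : Set ι) : Subalgebra ℂ A :=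
  (wordSpan φ 𝒜 (altLists J)).toSubalgebra
    (word_le_wordSpan (L := altLists J) (l := []) ⟨by simp, by simp⟩ (by
      rw [word_nil]
      exact Submodule.one_le.1 le_rfl))
    (fun x y hx hy => wordSpan_mul_le (fun _ hl _ hl' => word_mul_word_le h1 hl hl')
      (Submodule.mul_mem_mul hx hy))

lemma le_generated (h1 : φ 1 = 1) {J : Set ι} {j : ι} (hj : j ∈ J) :
    𝒜 j ≤ generated h1 𝒜 J := by
  intro x hx
  have h := le_centered_sup_one h1 (𝒜 j) hx
  rw [← word_singleton, ← word_nil (φ := φ) (𝒜 := 𝒜)] at h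
  exact sup_le (word_le_wordSpan (L := altLists J) ⟨by simp, by simpa using hj⟩)
    (word_le_wordSpan ⟨by simp, by simp⟩) h

lemma generated_mono (h1 : φ 1 = 1) {J J' : Set ι} (h : J ⊆ J') :
    generated h1 𝒜 J ≤ generated h1 𝒜 J' := by
  intro x hx
  exact iSup₂_le (fun l hl => word_le_wordSpan (L := altLists J')
    ⟨hl.1, fun i hi => h (hl.2 i hi)⟩) hx

lemma centered_generated_le (hfree : FreeFamily φ 𝒜) (h1 : φ 1 = 1) (J : Set ι) :
    centered φ (generated h1 𝒜 J) ≤ wordSpan φ 𝒜 (altLists J \ {[]}) := by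
  rintro x ⟨hx, hφ⟩
  have hle : wordSpan φ 𝒜 (altLists J) ≤ 1 ⊔ wordSpan φ 𝒜 (altLists J \ {[]}) := by
    refine iSup₂_le fun l hl => ?_
    by_cases h : l = []
    · rw [h, word_nil]
      exact le_sup_left
    · exact (word_le_wordSpan (L := altLists J \ {[]}) ⟨hl, h⟩).trans le_sup_right
  obtain ⟨c, hc, w, hw, rfl⟩ := Submodule.mem_sup.1 (hle hx)
  have hφw : φ w = 0 :=
    (iSup₂_le fun l hl => hfree l hl.2 hl.1.1 : wordSpan φ 𝒜 (altLists J \ {[]}) ≤ _) hw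
  obtain ⟨z, rfl⟩ := Submodule.mem_one.1 hc
  have h0 : φ (algebraMap ℂ A z + w) = 0 := hφ
  rw [map_add, hφw, add_zero, Algebra.algebraMap_eq_smul_one, map_smul, h1, smul_eq_mul,
    mul_one] at h0
  simpa [h0] using hw

/-- The S-transform of the product of `a ∈ 𝒜 i` and an element `b` of the algebra generated by
the other members of a free family of algebras. -/
theorem IsSTransform.mul_of_freeFamily (hfree : FreeFamily φ 𝒜) (h1 : φ 1 = 1) {i : ι} {J : Set ι}
    (hi : i ∉ J) {a b : A} (ha : a ∈ 𝒜 i) (hb : b ∈ generated h1 𝒜 J) {T T' : PowerSeries ℂ}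
    (hT : IsSTransform (fun n => φ (a ^ n)) T) (hT' : IsSTransform (fun n => φ (b ^ n)) T') :
    IsSTransform (fun n => φ ((a * b) ^ n)) (T * T') := by
  -- `V` is spanned by the empty word and the words that start in `𝒜 i`; multiplication by centered
  -- elements of `generated h1 𝒜 J` leads to words that start in `J`
  set L : Set (List ι) := {l | l.IsChain (· ≠ ·) ∧ ∀ s ∈ l.head?, s = i} with hL
  set L₁ : Set (List ι) := {l | l ≠ [] ∧ l.IsChain (· ≠ ·) ∧ ∀ s ∈ l.head?, s ∈ J}
  set L₂ : Set (List ι) := {l | l ≠ [] ∧ l.IsChain (· ≠ ·) ∧ ∀ s ∈ l.head?, s = i}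
  have hker : ∀ {M : Set (List ι)}, (∀ l ∈ M, l ≠ [] ∧ l.IsChain (· ≠ ·)) →
      wordSpan φ 𝒜 M ≤ LinearMap.ker φ := fun hM =>
    iSup₂_le fun l hl => hfree l (hM l hl).1 (hM l hl).2
  have hB : centered φ (generated h1 𝒜 J) * wordSpan φ 𝒜 L ≤ wordSpan φ 𝒜 L₁ := by
    refine (mul_le_mul_left (centered_generated_le hfree h1 J) _).trans ?_
    refine wordSpan_mul_le fun l hl l' hl' => ?_
    rw [← word_append]
    have hne : l ≠ [] := hl.2
    refine word_le_wordSpan ⟨by simp [hne], ?_, ?_⟩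
    · rw [List.isChain_append]
      refine ⟨hl.1.1, hl'.1, fun s hs t ht => ?_⟩
      have := hl.1.2 s (List.mem_of_getLast? hs)
      rw [hl'.2 t ht]
      rintro rfl
      exact hi this
    · intro s hs
      rw [List.head?_append_of_ne_nil _ hne] at hs
      exact hl.1.2 s (List.mem_of_mem_head? hs)
  have hAB : centered φ (𝒜 i) * centered φ (generated h1 𝒜 J) * wordSpan φ 𝒜 L ≤
      wordSpan φ 𝒜 L₂ := by
    rw [mul_assoc]
    refine (mul_le_mul_right hB _).trans ?_
    rw [← word_singleton]
    refine (mul_le_mul_left (word_le_wordSpan (L := {[i]}) rfl) _).trans ?_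
    refine wordSpan_mul_le fun l hl l' hl' => ?_
    obtain rfl : l = [i] := hl
    rw [← word_append]
    refine word_le_wordSpan ⟨by simp, ?_, by simp⟩
    rw [List.isChain_append]
    refine ⟨by simp, hl'.2.1, fun s hs t ht => ?_⟩
    have := hl'.2.2 t ht
    simp only [List.getLast?_singleton, Option.mem_def, Option.some.injEq] at hs
    subst hs
    rintro rfl
    exact hi this
  refine IsSTransform.mul h1 ha hb (V := wordSpan φ 𝒜 L) ?_ ?_ (hAB.trans ?_)
    (hAB.trans (hker fun l hl => ⟨hl.1, hl.2.1⟩)) (hB.trans (hker fun l hl => ⟨hl.1, hl.2.1⟩))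
    hT hT'
  · rw [← word_nil (φ := φ) (𝒜 := 𝒜)]
    exact word_le_wordSpan ⟨by simp, by simp⟩
  · rw [← word_singleton]
    exact word_le_wordSpan ⟨by simp, by simp⟩
  · exact iSup₂_le fun l hl => word_le_wordSpan ⟨hl.2.1, hl.2.2⟩

/-- A product of submodules is spanned by the products of elements. -/
lemma word_le_span_prod (l : List ι) :
    word φ 𝒜 l ≤ Submodule.span ℂ
      {y | ∃ z : List A, List.Forall₂ (fun i a => a ∈ centered φ (𝒜 i)) l z ∧ y = z.prod} := by
  induction l with
  | nil =>
    rw [word_nil, Submodule.one_le]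
    exact Submodule.subset_span ⟨[], List.Forall₂.nil, by simp⟩
  | cons i l ih =>
    rw [word_cons]
    refine (mul_le_mul_right ih _).trans ?_
    rw [Submodule.mul_le]
    intro a ha y hy
    induction hy using Submodule.span_induction with
    | mem y hy =>
      obtain ⟨z, hz, rfl⟩ := hy
      exact Submodule.subset_span ⟨a :: z, List.Forall₂.cons ha hz, by simp⟩
    | zero => simp
    | add y y' _ _ h h' =>
      rw [mul_add]
      exact add_mem h h'
    | smul c y _ h =>
      rw [mul_smul_comm]
      exact Submodule.smul_mem _ c h

end Words

/-! ### Tracial states and freeness of closed subalgebras -/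

section CStar

variable {A : Type*} [CStarAlgebra A]

/-- A tracial state is continuous, since it is positive. -/
lemma TracialState.continuous (φ : TracialState A) : Continuous φ := by
  let : PartialOrder A := CStarAlgebra.spectralOrder A
  have : StarOrderedRing A := CStarAlgebra.spectralOrderedRing A
  let f : A →ₚ[ℂ] ℂ :=
    { toLinearMap := φ.toLinearMap
      monotone' := by
        intro a b hab
        obtain ⟨c, hc⟩ := CStarAlgebra.nonneg_iff_eq_star_mul_self.1 (sub_nonneg.2 hab)
        have h := φ.nonneg' c
        rw [← hc] at h
        have h' : (0 : ℂ) ≤ φ.toLinearMap (b - a) := h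
        rw [map_sub] at h'
        exact sub_nonneg.1 h' }
  exact map_continuous f

lemma TracialState.map_one (φ : TracialState A) : φ 1 = 1 := φ.map_one'

lemma TracialState.map_mul_comm (φ : TracialState A) (a b : A) : φ (a * b) = φ (b * a) :=
  φ.trace' a b

/-- The closed unital algebra generated by a single element. -/
def closedAdjoin (x : A) : Subalgebra ℂ A := (Algebra.adjoin ℂ {x}).topologicalClosure

/-- Freeness passes from the unital algebras generated by the single elements to their closures. -/
lemma IsFree.freeFamily {ι : Type*} {φ : TracialState A} {x : ι → A} (h : IsFree φ x) :
    FreeFamily φ.toLinearMap fun i => closedAdjoin (x i) := by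
  intro l hl hchain
  refine (word_le_span_prod l).trans (Submodule.span_le.2 ?_)
  rintro _ ⟨z, hz, rfl⟩
  change φ z.prod = 0
  rw [List.forall₂_iff_get] at hz
  obtain ⟨hlen, hz⟩ := hz
  obtain ⟨m, hm⟩ : ∃ m, z.length = m + 1 :=
    Nat.exists_eq_succ_of_ne_zero (by rw [← hlen]; simpa using hl)
  have hlm : l.length = m + 1 := hlen.trans hm
  let i : Fin (m + 1) → ι := fun j => l.get (j.cast hlm.symm)
  let a : Fin (m + 1) → A := fun j => z.get (j.cast hm.symm)
  have hza : z = List.ofFn a := by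
    apply List.ext_getElem
    · simp [hm]
    · intro n h1 h2
      rw [List.getElem_ofFn]
      rfl
  have ha : ∀ j, a j ∈ closedAdjoin (x (i j)) ∧ φ (a j) = 0 := fun j =>
    hz j (by have := j.2; omega) (by have := j.2; omega)
  have hi : ∀ j : Fin m, i j.castSucc ≠ i j.succ := by
    intro j
    have := List.isChain_iff_getElem.1 hchain j (by omega)
    simpa [i] using this
  have hseq : ∀ j, ∃ b : ℕ → A, (∀ r, b r ∈ Algebra.adjoin ℂ {x (i j)}) ∧
      Tendsto b atTop (𝓝 (a j)) := fun j => mem_closure_iff_seq_limit.1 (ha j).1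
  choose b hb hblim using hseq
  let c : Fin (m + 1) → ℕ → A := fun j r => b j r - φ (b j r) • (1 : A)
  have hclim : ∀ j, Tendsto (c j) atTop (𝓝 (a j)) := by
    intro j
    have h1 : Tendsto (fun r => φ (b j r)) atTop (𝓝 0) := by
      rw [← (ha j).2]
      exact (φ.continuous.tendsto _).comp (hblim j)
    simpa [c] using (hblim j).sub (h1.smul_const (1 : A))
  have hz0 : ∀ r, φ (List.ofFn fun j => c j r).prod = 0 := by
    intro r
    refine h m i (fun j => c j r) (fun j => ?_) (fun j => ?_) hi
    · exact sub_mem (hb j r) (Subalgebra.smul_mem _ (one_mem _) _)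
    · simp [c, φ.map_one]
  have hlim : Tendsto (fun r => φ (List.ofFn fun j => c j r).prod) atTop (𝓝 (φ z.prod)) := by
    refine (φ.continuous.tendsto _).comp ?_
    rw [hza]
    simp only [List.ofFn_eq_map]
    exact tendsto_list_prod _ fun j _ => hclim j
  simp only [hz0] at hlim
  exact (tendsto_nhds_unique hlim tendsto_const_nhds)

end CStar

/-! ### The S-transform of a perturbation of the identity -/

section PerturbationOfOne

open PowerSeries

variable {A : Type*} [Ring A] [Algebra ℂ A]

/-- In terms of `v = χ / (1 - χ)`, the resolvent of `1 + u` is `(1 + v) (1 - v u)⁻¹`. Hence the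
S-transform of `1 + u` can be read off the moments of `u`. -/
lemma isSTransform_one_add {φ : A →ₗ[ℂ] ℂ} (u : A) {v T : ℂ⟦X⟧}
    (hv : constantCoeff v = 0)
    (hv1 : (1 + v) * (mk fun n => φ (u ^ n) : ℂ⟦X⟧).subst v = 1 + X)
    (hT : X * T = 1 + X - (mk fun n => φ (u ^ n) : ℂ⟦X⟧).subst v) :
    IsSTransform (fun n => φ ((1 + u) ^ n)) T := by
  set P : ℂ⟦X⟧ := (mk fun n => φ (u ^ n) : ℂ⟦X⟧).subst v with hP
  set χ : ℂ⟦X⟧ := X * T * (1 + X)⁻¹ with hχdef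
  have hχ : constantCoeff χ = 0 := by simp [hχdef]
  have hχv : (1 + v) * χ = v := by
    have := one_add_X_mul_inv
    rw [hχdef, hT]
    linear_combination ((1 + v) - 1) * this - (1 + X : ℂ⟦X⟧)⁻¹ * hv1
  obtain ⟨R, hR1, hR2, hR⟩ := exists_resolvent (A := A) χ hχ (1 + u)
  obtain ⟨Q, hQ1, hQ2, hQ⟩ := exists_resolvent (A := A) v hv u
  have hΦR := mapFunctional_resolvent φ hχ hR
  have hΦQ := mapFunctional_resolvent φ hv hQ
  have e1 : scalarSeries A (1 + v) * (1 - scalarSeries A χ * C (1 + u)) =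
      1 - scalarSeries A v * C u := by
    rw [mul_sub, ← mul_assoc, ← map_mul, hχv, mul_one, map_add C, mul_add]
    simp only [map_add, map_one, mul_one]
    abel
  have e2 : R = scalarSeries A (1 + v) * Q := by
    have e3 : (scalarSeries A (1 + v) * Q) * (1 - scalarSeries A χ * C (1 + u)) = 1 := by
      rw [(scalarSeries_commute (1 + v) Q).eq, mul_assoc, e1, hQ2]
    calc R = (scalarSeries A (1 + v) * Q) * (1 - scalarSeries A χ * C (1 + u)) * R := by
          rw [e3, one_mul]
      _ = scalarSeries A (1 + v) * Q := by rw [mul_assoc, hR1, mul_one]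
  rw [IsSTransform, ← hχdef, ← hΦR, e2, mapFunctional_scalarSeries_mul, hΦQ, ← hP, hv1]

open Classical in
/-- The compositional inverse `v` of the power series `(1 + X) (∑ p_n Xⁿ) - 1`, if the linear
coefficient `1 + p₁` does not vanish. -/
noncomputable def invSeries (p : ℕ → ℂ) : ℂ⟦X⟧ :=
  if h : IsUnit (coeff 1 ((1 + X) * mk p - 1 : ℂ⟦X⟧)) then
    ((1 + X) * mk p - 1 : ℂ⟦X⟧).substInvOfIsUnit h
  else 0

/-- The S-transform of `1 + u`, expressed through the moments `p_n` of `u`. -/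
noncomputable def sSeries (p : ℕ → ℂ) : ℂ⟦X⟧ :=
  mk fun m => coeff (m + 1) (1 + X - (mk p : ℂ⟦X⟧).subst (invSeries p))

lemma constantCoeff_invSeries (p : ℕ → ℂ) : constantCoeff (invSeries p) = 0 := by
  unfold invSeries
  split_ifs with h
  · exact constantCoeff_substInvOfIsUnit _ _
  · simp

lemma coeff_one_add_X_mul_mk_sub_one (p : ℕ → ℂ) (j : ℕ) :
    coeff (j + 1) ((1 + X) * mk p - 1 : ℂ⟦X⟧) = p (j + 1) + p j := by
  rw [map_sub, add_mul, map_add, coeff_succ_X_mul]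
  simp [coeff_one]

lemma subst_invSeries {p : ℕ → ℂ} (h0 : p 0 = 1) (h1 : p 1 + 1 ≠ 0) :
    ((1 + X) * mk p - 1 : ℂ⟦X⟧).subst (invSeries p) = X := by
  have h : IsUnit (coeff 1 ((1 + X) * mk p - 1 : ℂ⟦X⟧)) := by
    rw [show (1 : ℕ) = 0 + 1 from rfl, coeff_one_add_X_mul_mk_sub_one, isUnit_iff_ne_zero]
    simpa [h0] using h1
  rw [invSeries, dif_pos h]
  exact subst_substInvOfIsUnit_right _ (by simp [h0]) h

lemma one_add_invSeries_mul {p : ℕ → ℂ} (h0 : p 0 = 1) (h1 : p 1 + 1 ≠ 0) :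
    (1 + invSeries p) * (mk p : ℂ⟦X⟧).subst (invSeries p) = 1 + X := by
  have hs : HasSubst (invSeries p) := HasSubst.of_constantCoeff_zero' (constantCoeff_invSeries p)
  have h := subst_invSeries h0 h1
  rw [← coe_substAlgHom hs, map_sub, map_mul, map_add, map_one, coe_substAlgHom hs, subst_X hs] at h
  linear_combination h

lemma isSTransform_sSeries {φ : A →ₗ[ℂ] ℂ} (h1 : φ 1 = 1) (u : A) (hu : φ u + 1 ≠ 0) :
    IsSTransform (fun n => φ ((1 + u) ^ n)) (sSeries fun n => φ (u ^ n)) := by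
  refine isSTransform_one_add u (constantCoeff_invSeries _)
    (one_add_invSeries_mul (by simpa using h1) (by simpa using hu)) ?_
  ext n
  rcases n with _ | n
  · have h0 := coeff_subst_eq_sum (constantCoeff_invSeries fun n => φ (u ^ n))
      (mk fun n => φ (u ^ n)) Nat.zero_lt_one
    rw [map_sub, h0]
    simp [h1]
  · rw [coeff_succ_X_mul, sSeries, coeff_mk]

end PerturbationOfOne

/-! ### First-order expansion of the S-transform -/

section Asymptotics

open PowerSeries Asymptotics

variable {κ : Type*} {l : Filter κ} {ε : κ → ℝ}

lemma isBigO_mul_sub {u w : κ → ℂ} {a b : ℂ} (hε : ε =O[l] fun _ => (1 : ℝ))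
    (hu : (fun x => u x - a) =O[l] ε) (hw : (fun x => w x - b) =O[l] ε) :
    (fun x => u x * w x - a * b) =O[l] ε := by
  have hw1 : w =O[l] fun _ => (1 : ℝ) := by
    have := (hw.trans hε).add (isBigO_const_const b (one_ne_zero (α := ℝ)) l)
    simpa using this
  have h1 : (fun x => (u x - a) * w x) =O[l] ε := by
    simpa using hu.mul hw1
  have h2 : (fun x => a * (w x - b)) =O[l] ε := hw.const_mul_left a
  refine (h1.add h2).congr_left fun x => ?_
  ring

/-- If the coefficients of `v` below the `n`-th one are those of `X` up to `O(ε)`, then so are the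
coefficients of `v ^ j` and of `X ^ j` below the `(n + j - 1)`-st one. -/
lemma isBigO_coeff_pow_sub (hε : ε =O[l] fun _ => (1 : ℝ)) {v : κ → ℂ⟦X⟧}
    (hv0 : ∀ x, constantCoeff (v x) = 0) {n : ℕ}
    (hv : ∀ m < n, (fun x => coeff m (v x) - if m = 1 then 1 else 0) =O[l] ε) (j : ℕ) :
    ∀ m < n + j, (fun x => coeff m (v x ^ (j + 1)) - if m = j + 1 then 1 else 0) =O[l] ε := by
  induction j with
  | zero => simpa using hv
  | succ j ih =>
    intro m hm
    have hterm : ∀ p ∈ Finset.HasAntidiagonal.antidiagonal m,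
        (fun x => coeff p.1 (v x) * coeff p.2 (v x ^ (j + 1)) -
          (if p.1 = 1 then (1 : ℂ) else 0) * (if p.2 = j + 1 then 1 else 0)) =O[l] ε := by
      rintro ⟨a, b⟩ hab
      rw [Finset.HasAntidiagonal.mem_antidiagonal] at hab
      dsimp only at hab ⊢
      by_cases ha : a = 0
      · subst ha
        refine (isBigO_zero ε l).congr_left fun x => ?_
        simp [hv0]
      by_cases hb : b < j + 1
      · refine (isBigO_zero ε l).congr_left fun x => ?_
        rw [coeff_pow_eq_zero_of_lt (hv0 x) hb, if_neg (by omega : ¬ b = j + 1)]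
        simp
      · exact isBigO_mul_sub hε (hv a (by omega)) (ih b (by omega))
    refine (IsBigO.sum hterm).congr_left fun x => ?_
    rw [Finset.sum_apply, Finset.sum_sub_distrib, pow_succ' (v x) (j + 1), coeff_mul]
    congr 1
    have := congrArg (coeff m) (pow_succ' (X : ℂ⟦X⟧) (j + 1))
    rw [coeff_mul, coeff_X_pow] at this
    rw [this]
    exact Finset.sum_congr rfl fun p _ => by rw [coeff_X, coeff_X_pow]

variable {p : κ → ℕ → ℂ} {k : ℕ}

lemma isBigO_coeff_invSeries_sub (hε : Tendsto ε l (𝓝 0)) (h0 : ∀ x, p x 0 = 1)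
    (hp : ∀ j, 1 ≤ j → j ≤ k → (fun x => p x j) =O[l] ε) (m : ℕ) (hm : m ≤ k) :
    (fun x => coeff m (invSeries (p x)) - if m = 1 then 1 else 0) =O[l] ε := by
  have hε1 : ε =O[l] fun _ => (1 : ℝ) := hε.isBigO_one ℝ
  induction m using Nat.strong_induction_on with
  | _ m ih =>
  rcases m with _ | m
  · refine (isBigO_zero ε l).congr_left fun x => ?_
    simp [constantCoeff_invSeries]
  have hp1 : Tendsto (fun x => p x 1 + 1) l (𝓝 1) := by
    simpa using ((hp 1 le_rfl (by omega)).trans_tendsto hε).add_const (1 : ℂ)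
  have hinv : (fun x => (p x 1 + 1)⁻¹) =O[l] fun _ => (1 : ℝ) :=
    (hp1.inv₀ one_ne_zero).isBigO_one ℝ
  have hpow := isBigO_coeff_pow_sub hε1 (fun x => constantCoeff_invSeries (p x))
    (n := m + 1) (fun i hi => ih i hi (by omega))
  have hterm : ∀ j ∈ Finset.range m,
      (fun x => (p x (j + 2) + p x (j + 1)) * coeff (m + 1) (invSeries (p x) ^ (j + 2)))
        =O[l] ε := by
    intro j hj
    have hj' := Finset.mem_range.1 hj
    have h1 := (hp (j + 2) (by omega) (by omega)).add (hp (j + 1) (by omega) (by omega))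
    have h2 : (fun x => coeff (m + 1) (invSeries (p x) ^ (j + 2))) =O[l] fun _ => (1 : ℝ) := by
      have := ((hpow (j + 1) (m + 1) (by omega)).trans hε1).add
        (isBigO_const_const (if m + 1 = j + 1 + 1 then (1 : ℂ) else 0) (one_ne_zero (α := ℝ)) l)
      simpa using this
    simpa using h1.mul h2
  have hsum := IsBigO.sum hterm
  have hrhs : (fun x => (p x 1 + 1)⁻¹ * (-((if m + 1 = 1 then 1 else 0) * p x 1) -
      ∑ j ∈ Finset.range m, (p x (j + 2) + p x (j + 1)) *
        coeff (m + 1) (invSeries (p x) ^ (j + 2)))) =O[l] ε := by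
    have := hinv.mul (((hp 1 le_rfl (by omega)).const_mul_left
      (if m + 1 = 1 then (1 : ℂ) else 0)).neg_left.sub hsum)
    simpa using this
  refine hrhs.congr' ?_ EventuallyEq.rfl
  filter_upwards [hp1.eventually_ne one_ne_zero] with x hx
  have h := congrArg (coeff (m + 1)) (subst_invSeries (h0 x) hx)
  rw [coeff_subst_eq_sum (constantCoeff_invSeries (p x)) _
    ((Nat.lt_succ_self _).trans (Nat.lt_succ_self _) : m + 1 < m + 1 + 1 + 1),
    Finset.sum_range_succ'] at h
  rw [Finset.sum_range_succ', Finset.sum_range_succ] at h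
  simp only [coeff_one_add_X_mul_mk_sub_one, coeff_zero_eq_constantCoeff_apply, pow_zero,
    coeff_one, coeff_X, h0, pow_one, zero_add,
    coeff_pow_eq_zero_of_lt (constantCoeff_invSeries (p x)) (Nat.lt_succ_self (m + 1))] at h
  simp only [Nat.succ_ne_zero, if_false, mul_zero, add_zero] at h
  rw [inv_mul_eq_iff_eq_mul₀ hx]
  linear_combination -h

/-- To first order in the moments `p_j` of `u`, the S-transform of `1 + u` is
`1 - ∑ p_{m+1} w ^ m`. -/
lemma isBigO_coeff_sSeries (hε : Tendsto ε l (𝓝 0)) (h0 : ∀ x, p x 0 = 1)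
    (hp : ∀ j, 1 ≤ j → j ≤ k → (fun x => p x j) =O[l] ε) (m : ℕ) (hm : m < k) :
    (fun x => coeff m (sSeries (p x)) - ((if m = 0 then 1 else 0) - p x (m + 1))) =O[l]
      fun x => ε x ^ 2 := by
  have hε1 : ε =O[l] fun _ => (1 : ℝ) := hε.isBigO_one ℝ
  have hpow := isBigO_coeff_pow_sub hε1 (fun x => constantCoeff_invSeries (p x))
    (n := k + 1) (fun i hi => isBigO_coeff_invSeries_sub hε h0 hp i (by omega))
  have hterm : ∀ j ∈ Finset.range (m + 1),
      (fun x => p x (j + 1) * (coeff (m + 1) (invSeries (p x) ^ (j + 1)) -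
        if m + 1 = j + 1 then 1 else 0)) =O[l] fun x => ε x ^ 2 := by
    intro j hj
    have hj' := Finset.mem_range.1 hj
    simp only [pow_two]
    exact (hp (j + 1) (by omega) (by omega)).mul (hpow j (m + 1) (by omega))
  refine (IsBigO.sum hterm).neg_left.congr_left fun x => ?_
  rw [Finset.sum_apply, sSeries, coeff_mk, map_sub, map_add,
    coeff_subst_eq_sum (constantCoeff_invSeries (p x)) _ (Nat.lt_succ_self (m + 1)),
    Finset.sum_range_succ' _ (m + 1)]
  simp only [coeff_mk, pow_zero, coeff_one, coeff_X, Nat.succ_ne_zero, if_false, mul_zero, add_zero,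
    mul_sub, Finset.sum_sub_distrib, Nat.add_right_cancel_iff, mul_ite, mul_one,
    Finset.sum_ite_eq, Finset.mem_range, Nat.lt_succ_self, if_true]
  have : (if m + 1 = 1 then (1 : ℂ) else 0) = if m = 0 then 1 else 0 := by simp
  rw [this]
  ring

end Asymptotics

/-! ### Products of power series close to the identity -/

section CoeffNorm

open PowerSeries Asymptotics

/-- The sum of the norms of the first `k` coefficients: a submultiplicative seminorm. -/
noncomputable def coeffNorm (k : ℕ) (f : ℂ⟦X⟧) : ℝ :=
  ∑ m ∈ Finset.range k, ‖coeff m f‖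

lemma coeffNorm_nonneg (k : ℕ) (f : ℂ⟦X⟧) : 0 ≤ coeffNorm k f :=
  Finset.sum_nonneg fun _ _ => norm_nonneg _

lemma coeffNorm_add_le (k : ℕ) (f g : ℂ⟦X⟧) :
    coeffNorm k (f + g) ≤ coeffNorm k f + coeffNorm k g := by
  rw [coeffNorm, coeffNorm, coeffNorm, ← Finset.sum_add_distrib]
  exact Finset.sum_le_sum fun m _ => by
    rw [map_add]
    exact norm_add_le _ _

lemma coeffNorm_one_le (k : ℕ) : coeffNorm k 1 ≤ 1 := by
  simp only [coeffNorm, coeff_one]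
  calc ∑ m ∈ Finset.range k, ‖(if m = 0 then 1 else 0 : ℂ)‖
      = ∑ m ∈ Finset.range k, if m = 0 then (1 : ℝ) else 0 :=
        Finset.sum_congr rfl fun m _ => by split_ifs <;> simp
    _ ≤ 1 := by
        rw [Finset.sum_ite_eq']
        split_ifs <;> simp

lemma coeffNorm_mul_le (k : ℕ) (f g : ℂ⟦X⟧) :
    coeffNorm k (f * g) ≤ coeffNorm k f * coeffNorm k g := by
  calc coeffNorm k (f * g)
      ≤ ∑ m ∈ Finset.range k, ∑ p ∈ Finset.HasAntidiagonal.antidiagonal m,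
          ‖coeff p.1 f‖ * ‖coeff p.2 g‖ := by
        refine Finset.sum_le_sum fun m _ => ?_
        rw [coeff_mul]
        refine (norm_sum_le _ _).trans (Finset.sum_le_sum fun p _ => ?_)
        rw [norm_mul]
    _ = ∑ p ∈ (Finset.range k).sigma fun m => Finset.HasAntidiagonal.antidiagonal m,
          ‖coeff p.2.1 f‖ * ‖coeff p.2.2 g‖ := Finset.sum_sigma' _ _ _
    _ = ∑ p ∈ ((Finset.range k).sigma fun m => Finset.HasAntidiagonal.antidiagonal m).image
          (fun p => p.2), ‖coeff p.1 f‖ * ‖coeff p.2 g‖ := by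
        rw [Finset.sum_image]
        rintro ⟨m, p⟩ hp ⟨m', p'⟩ hp' (rfl : p = p')
        simp only [Finset.coe_sigma, Set.mem_sigma_iff, Finset.mem_coe,
          Finset.HasAntidiagonal.mem_antidiagonal] at hp hp'
        rw [← hp.2, ← hp'.2]
    _ ≤ ∑ p ∈ Finset.range k ×ˢ Finset.range k, ‖coeff p.1 f‖ * ‖coeff p.2 g‖ := by
        refine Finset.sum_le_sum_of_subset_of_nonneg ?_ fun p _ _ => by positivity
        intro p hp
        simp only [Finset.mem_image, Finset.mem_sigma, Finset.mem_range,
          Finset.HasAntidiagonal.mem_antidiagonal] at hp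
        obtain ⟨⟨m, q⟩, ⟨h1, h2⟩, rfl⟩ := hp
        simp only [Finset.mem_product, Finset.mem_range]
        dsimp only at h1 h2
        omega
    _ = coeffNorm k f * coeffNorm k g := by
        rw [coeffNorm, coeffNorm, Finset.sum_mul_sum, ← Finset.sum_product']

lemma coeffNorm_prod_le {k : ℕ} {b : ℕ → ℂ⟦X⟧} {q : ℝ} (hb : ∀ i, coeffNorm k (b i) ≤ q) (n : ℕ) :
    coeffNorm k (∏ i ∈ Finset.range n, b i) ≤ q ^ n := by
  have hq : 0 ≤ q := (coeffNorm_nonneg k _).trans (hb 0)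
  induction n with
  | zero => simpa using coeffNorm_one_le k
  | succ n ih =>
    rw [Finset.prod_range_succ, pow_succ]
    exact (coeffNorm_mul_le k _ _).trans
      (mul_le_mul ih (hb n) (coeffNorm_nonneg k _) (pow_nonneg hq n))

/-- Telescoping estimate for the difference of two products. -/
lemma coeffNorm_prod_sub_prod_le {k : ℕ} {a b : ℕ → ℂ⟦X⟧} {q δ : ℝ} (hq : 1 ≤ q)
    (ha : ∀ i, coeffNorm k (a i) ≤ q) (hb : ∀ i, coeffNorm k (b i) ≤ q)
    (hab : ∀ i, coeffNorm k (a i - b i) ≤ δ) (n : ℕ) :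
    coeffNorm k (∏ i ∈ Finset.range n, a i - ∏ i ∈ Finset.range n, b i) ≤ n * δ * q ^ n := by
  have hδ : 0 ≤ δ := (coeffNorm_nonneg k _).trans (hab 0)
  induction n with
  | zero => simp [coeffNorm]
  | succ n ih =>
    rw [Finset.prod_range_succ, Finset.prod_range_succ]
    have e : (∏ i ∈ Finset.range n, a i) * a n - (∏ i ∈ Finset.range n, b i) * b n =
        (∏ i ∈ Finset.range n, a i - ∏ i ∈ Finset.range n, b i) * a n +
          (∏ i ∈ Finset.range n, b i) * (a n - b n) := by ring
    rw [e]
    have hqn : (0 : ℝ) ≤ q ^ n := by positivity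
    calc _ ≤ (n * δ * q ^ n) * q + q ^ n * δ := by
          refine (coeffNorm_add_le k _ _).trans (add_le_add ?_ ?_)
          · exact (coeffNorm_mul_le k _ _).trans
              (mul_le_mul ih (ha n) (coeffNorm_nonneg k _) (by positivity))
          · exact (coeffNorm_mul_le k _ _).trans
              (mul_le_mul (coeffNorm_prod_le hb n) (hab n) (coeffNorm_nonneg k _) hqn)
      _ ≤ (n * δ * q ^ n) * q + q ^ n * q * δ := by
          gcongr
          exact le_mul_of_one_le_right hqn hq
      _ = ((n + 1 : ℕ) : ℝ) * δ * q ^ (n + 1) := by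
          push_cast
          ring

/-- The formal power series `e ^ (c + d w)`. -/
noncomputable def expSeries (c d : ℂ) : ℂ⟦X⟧ :=
  C (Complex.exp c) * rescale d (PowerSeries.exp ℂ)

lemma coeff_expSeries (c d : ℂ) (m : ℕ) :
    coeff m (expSeries c d) = Complex.exp c * (d ^ m / m.factorial) := by
  rw [expSeries, coeff_C_mul, coeff_rescale, coeff_exp]
  simp [div_eq_mul_inv]

lemma expSeries_pow (c d : ℂ) (n : ℕ) : expSeries c d ^ n = expSeries (n * c) (n * d) := by
  rw [expSeries, mul_pow, ← map_pow, ← map_pow, exp_pow_eq_rescale_exp, ← Complex.exp_nat_mul,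
    rescale_rescale, expSeries, mul_comm (n : ℂ) d]

lemma isLittleO_coeff_expSeries (c d : ℂ) (m : ℕ) :
    (fun n : ℕ => coeff m (expSeries (c / n) (d / n)) -
      ((if m = 0 then 1 else 0) + ((if m = 0 then c else 0) + if m = 1 then d else 0) / n))
      =o[atTop] fun n : ℕ => (n : ℝ)⁻¹ := by
  have hinv : Tendsto (fun n : ℕ => (n : ℂ)⁻¹) atTop (𝓝 0) := tendsto_inv_atTop_nhds_zero_nat
  have hdiv : ∀ z : ℂ, Tendsto (fun n : ℕ => z / n) atTop (𝓝 0) := fun z => by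
    simpa [div_eq_mul_inv] using hinv.const_mul z
  have hO : ∀ z : ℂ, (fun n : ℕ => z / n) =O[atTop] fun n : ℕ => (n : ℝ)⁻¹ := fun z => by
    refine IsBigO.of_bound ‖z‖ (Eventually.of_forall fun n => ?_)
    simp [div_eq_mul_inv]
  have hexp : Tendsto (fun n : ℕ => Complex.exp (c / n)) atTop (𝓝 1) := by
    simpa [Function.comp_def] using (Complex.continuous_exp.tendsto 0).comp (hdiv c)
  simp only [coeff_expSeries]
  rcases m with _ | _ | m
  · have h1 : (fun n : ℕ => Complex.exp (c / n) - 1 - c / n) =O[atTop]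
        fun n : ℕ => (c / n) * (c / n) := by
      refine IsBigO.of_bound 1 ?_
      have := (hdiv c).norm.eventually_le_const (u := 1) (by simp)
      filter_upwards [this] with n hn
      have := Complex.norm_exp_sub_one_sub_id_le hn
      rw [one_mul, norm_mul, ← pow_two]
      exact this
    have h2 : (fun n : ℕ => (c / n) * (c / n)) =o[atTop] fun n : ℕ => (n : ℝ)⁻¹ := by
      simpa using ((isLittleO_one_iff ℝ).2 (hdiv c)).mul_isBigO (hO c)
    refine (h1.trans_isLittleO h2).congr_left fun n => ?_
    simp
    ring
  · have h1 : (fun n : ℕ => (Complex.exp (c / n) - 1) * (d / n)) =o[atTop]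
        fun n : ℕ => (n : ℝ)⁻¹ := by
      have : Tendsto (fun n : ℕ => Complex.exp (c / n) - 1) atTop (𝓝 0) := by
        simpa using hexp.sub_const 1
      simpa using ((isLittleO_one_iff ℝ).2 this).mul_isBigO (hO d)
    refine h1.congr_left fun n => ?_
    simp
    ring
  · have h1 : Tendsto (fun n : ℕ => Complex.exp (c / n) * ((d / n) ^ (m + 1) /
        (m + 2).factorial)) atTop (𝓝 0) := by
      simpa using hexp.mul (((hdiv d).pow (m + 1)).div_const ((m + 2).factorial : ℂ))
    have h2 := ((isLittleO_one_iff ℝ).2 h1).mul_isBigO (hO d)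
    simp only [one_mul] at h2
    refine h2.congr_left fun n => ?_
    simp
    ring

lemma exists_coeffNorm_le {κ : Type*} {l : Filter κ} {ε : κ → ℝ} (hε : ∀ x, 0 ≤ ε x)
    {k : ℕ} {f : κ → ℂ⟦X⟧} (hf : ∀ m < k, (fun x => coeff m (f x)) =o[l] ε) {δ : ℝ} (hδ : 0 < δ) :
    ∀ᶠ x in l, coeffNorm k (f x) ≤ δ * ε x := by
  have h : (fun x => coeffNorm k (f x)) =o[l] ε := by
    have := IsLittleO.sum (s := Finset.range k) (A := fun m x => ‖coeff m (f x)‖) (l := l)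
      fun m hm => (hf m (Finset.mem_range.1 hm)).norm_left
    refine this.congr_left fun x => ?_
    rw [Finset.sum_apply]
    rfl
  filter_upwards [h.bound hδ] with x hx
  rwa [Real.norm_of_nonneg (coeffNorm_nonneg _ _), Real.norm_of_nonneg (hε x)] at hx

/-- If the power series `t n i` agree with `1 + (c + d w) / n`, up to errors in the first `k`
coefficients which are `o(1/n)` uniformly in `i`, then the first `k` coefficients of
`∏ i < n, t n i` converge to those of `e ^ (c + d w)`. -/
theorem tendsto_coeff_prod {k : ℕ} {t : ℕ → ℕ → ℂ⟦X⟧} {c d : ℂ}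
    (ht : ∀ m < k, (fun x : ℕ × ℕ => coeff m (t x.1 x.2) - ((if m = 0 then 1 else 0) +
      ((if m = 0 then c else 0) + if m = 1 then d else 0) / (x.1 : ℂ)))
      =o[comap Prod.fst atTop] fun x => (x.1 : ℝ)⁻¹) {m : ℕ} (hm : m < k) :
    Tendsto (fun n => coeff m (∏ i ∈ Finset.range n, t n i)) atTop
      (𝓝 (coeff m (expSeries c d))) := by
  set E : ℕ → ℂ⟦X⟧ := fun n => expSeries (c / n) (d / n) with hE
  set B : ℕ → ℂ⟦X⟧ := fun n => 1 + C (n : ℂ)⁻¹ * (C c + C d * X) with hB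
  have hBc : ∀ (n m : ℕ), coeff m (B n) = (if m = 0 then 1 else 0) +
      ((if m = 0 then c else 0) + if m = 1 then d else 0) / (n : ℂ) := by
    intro n m
    rw [hB, map_add, coeff_C_mul, map_add, coeff_C_mul, coeff_one, coeff_C, coeff_X, div_eq_inv_mul]
    simp
  have h1 : ∀ m < k, (fun x : ℕ × ℕ => coeff m (t x.1 x.2 - E x.1)) =o[comap Prod.fst atTop]
      fun x => (x.1 : ℝ)⁻¹ := by
    intro m hm
    have h2 := (isLittleO_coeff_expSeries c d m).comp_tendsto
      (tendsto_comap : Tendsto (Prod.fst : ℕ × ℕ → ℕ) (comap Prod.fst atTop) atTop)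
    refine ((ht m hm).sub h2).congr_left fun x => ?_
    simp [hE]
  have h2 : ∀ m < k, (fun n : ℕ => coeff m (E n - B n)) =o[atTop] fun n : ℕ => (n : ℝ)⁻¹ := by
    intro m hm
    refine (isLittleO_coeff_expSeries c d m).congr_left fun n => ?_
    rw [map_sub, hBc]
  set K : ℝ := coeffNorm k (C c + C d * X) with hK
  have hK0 : 0 ≤ K := coeffNorm_nonneg _ _
  have hBN : ∀ n : ℕ, coeffNorm k (B n) ≤ 1 + K * (n : ℝ)⁻¹ := by
    intro n
    refine (coeffNorm_add_le k _ _).trans (add_le_add (coeffNorm_one_le k) (le_of_eq ?_))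
    simp only [coeffNorm, coeff_C_mul, hK, Finset.sum_mul]
    refine Finset.sum_congr rfl fun m _ => ?_
    rw [norm_mul, mul_comm, norm_inv, Complex.norm_natCast]
  -- compare `∏ i < n, t n i` with `E n ^ n = e ^ (c + d w)`
  have key : Tendsto (fun n => coeffNorm k (∏ i ∈ Finset.range n, t n i - expSeries c d)) atTop
      (𝓝 0) := by
    rw [Metric.tendsto_atTop]
    intro η hη
    obtain ⟨δ, hδ, hδ1, hδη⟩ : ∃ δ : ℝ, 0 < δ ∧ δ ≤ 1 ∧ δ * Real.exp (K + 2) < η := by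
      refine ⟨min 1 (η / (2 * Real.exp (K + 2))), by positivity, min_le_left _ _, ?_⟩
      calc min 1 (η / (2 * Real.exp (K + 2))) * Real.exp (K + 2)
          ≤ η / (2 * Real.exp (K + 2)) * Real.exp (K + 2) := by
            gcongr
            exact min_le_right _ _
        _ = η / 2 := by field_simp
        _ < η := half_lt_self hη
    have e1 := exists_coeffNorm_le (fun x : ℕ × ℕ => by positivity) h1 hδ
    rw [eventually_comap] at e1
    have e2 := exists_coeffNorm_le (fun n : ℕ => by positivity) h2 one_pos
    obtain ⟨N, hN⟩ := eventually_atTop.1 (e1.and (e2.and (eventually_gt_atTop 0)))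
    refine ⟨N, fun n hn => ?_⟩
    obtain ⟨ha, hb, hn0⟩ := hN n hn
    have hn0' : (n : ℝ) ≠ 0 := by positivity
    have hn0c : (n : ℂ) ≠ 0 := by exact_mod_cast hn0.ne'
    have ha' : ∀ i, coeffNorm k (t n i - E n) ≤ δ * (n : ℝ)⁻¹ := fun i => ha (n, i) rfl
    have hEN : coeffNorm k (E n) ≤ 1 + (K + 1) * (n : ℝ)⁻¹ := by
      have := coeffNorm_add_le k (E n - B n) (B n)
      rw [sub_add_cancel] at this
      have := hBN n
      linarith
    have hinv : (0 : ℝ) ≤ (n : ℝ)⁻¹ := by positivity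
    have htN : ∀ i, coeffNorm k (t n i) ≤ 1 + (K + 2) * (n : ℝ)⁻¹ := by
      intro i
      have h3 := coeffNorm_add_le k (t n i - E n) (E n)
      rw [sub_add_cancel] at h3
      have h4 := ha' i
      nlinarith
    have hpow : E n ^ n = expSeries c d := by
      rw [hE, expSeries_pow, mul_div_cancel₀ _ hn0c, mul_div_cancel₀ _ hn0c]
    have hmain := coeffNorm_prod_sub_prod_le (a := t n) (b := fun _ => E n)
      (q := 1 + (K + 2) * (n : ℝ)⁻¹) (by nlinarith) htN (fun _ => by nlinarith) ha' n
    rw [Finset.prod_const, Finset.card_range, hpow] at hmain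
    have hq : (1 + (K + 2) * (n : ℝ)⁻¹) ^ n ≤ Real.exp (K + 2) := by
      calc (1 + (K + 2) * (n : ℝ)⁻¹) ^ n ≤ Real.exp ((K + 2) * (n : ℝ)⁻¹) ^ n := by
            refine pow_le_pow_left₀ (by positivity) ?_ n
            rw [add_comm]
            exact Real.add_one_le_exp _
        _ = Real.exp (K + 2) := by
            rw [← Real.exp_nat_mul]
            congr 1
            field_simp
    rw [Real.dist_eq, sub_zero, abs_of_nonneg (coeffNorm_nonneg _ _)]
    calc _ ≤ (n : ℝ) * (δ * (n : ℝ)⁻¹) * (1 + (K + 2) * (n : ℝ)⁻¹) ^ n := hmain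
      _ = δ * (1 + (K + 2) * (n : ℝ)⁻¹) ^ n := by field_simp
      _ ≤ δ * Real.exp (K + 2) := by gcongr
      _ < η := hδη
  rw [tendsto_iff_norm_sub_tendsto_zero]
  refine squeeze_zero (fun _ => norm_nonneg _) (fun n => ?_) key
  rw [← map_sub]
  exact Finset.single_le_sum (f := fun m => ‖coeff m (∏ i ∈ Finset.range n, t n i - expSeries c d)‖)
    (fun _ _ => norm_nonneg _) (Finset.mem_range.2 hm)

end CoeffNorm

/-! ### Compositional inverses and free cumulants -/

section CumulantsAndSTransform

open PowerSeries

/-- The S-transform `T` determines the cumulants: `w T(w)` is the compositional inverse of the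
generating series of the free cumulants. -/
theorem IsSTransform.cumulantSeries_subst {m : ℕ → ℂ} (h0 : m 0 = 1) {T : ℂ⟦X⟧}
    (hT : IsSTransform m T) : (cumulantSeries m).subst (X * T : ℂ⟦X⟧) = X := by
  have hχ0 : constantCoeff (X * T * (1 + X)⁻¹ : ℂ⟦X⟧) = 0 := by simp
  have hχ : HasSubst (X * T * (1 + X)⁻¹ : ℂ⟦X⟧) := HasSubst.of_constantCoeff_zero' hχ0
  have hXM : HasSubst (X * mk m : ℂ⟦X⟧) := HasSubst.of_constantCoeff_zero' (by simp)
  have h := congrArg (substAlgHom hχ) (moment_eq_one_add_cumulantSeries_subst m h0)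
  rw [map_add, map_one, coe_substAlgHom hχ, subst_comp_subst_apply hXM hχ, subst_mul hχ,
    subst_X hχ, show (mk m : ℂ⟦X⟧).subst (X * T * (1 + X)⁻¹ : ℂ⟦X⟧) = 1 + X from hT,
    mul_assoc, mul_comm _ (1 + X), one_add_X_mul_inv, mul_one] at h
  exact (add_left_cancel h).symm

lemma tendsto_coeff_pow {k : ℕ} {V : ℕ → ℂ⟦X⟧} {V' : ℂ⟦X⟧}
    (hV : ∀ m ≤ k, Tendsto (fun n => coeff m (V n)) atTop (𝓝 (coeff m V'))) (s : ℕ) :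
    ∀ m ≤ k, Tendsto (fun n => coeff m (V n ^ s)) atTop (𝓝 (coeff m (V' ^ s))) := by
  induction s with
  | zero =>
    intro m _
    simp only [pow_zero]
    exact tendsto_const_nhds
  | succ s ih =>
    intro m hm
    simp only [pow_succ, coeff_mul]
    refine tendsto_finsetSum _ fun p hp => ?_
    rw [Finset.HasAntidiagonal.mem_antidiagonal] at hp
    exact (ih p.1 (by omega)).mul (hV p.2 (by omega))

lemma coeff_X_mul_pow_self (T : ℂ⟦X⟧) (j : ℕ) : coeff j ((X * T) ^ j) = constantCoeff T ^ j := by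
  rw [mul_pow, coeff_X_pow_mul' (T ^ j) j j]
  simp

/-- The coefficients of a compositional inverse depend continuously on those of the series. -/
theorem tendsto_coeff_of_subst_eq_X {k : ℕ} {K T : ℕ → ℂ⟦X⟧} {K' T' : ℂ⟦X⟧}
    (hK0 : ∀ n, constantCoeff (K n) = 0) (hK0' : constantCoeff K' = 0)
    (hK : ∀ᶠ n in atTop, (K n).subst (X * T n : ℂ⟦X⟧) = X) (hK' : K'.subst (X * T' : ℂ⟦X⟧) = X)
    (hT0 : constantCoeff T' ≠ 0)
    (hT : ∀ m < k, Tendsto (fun n => coeff m (T n)) atTop (𝓝 (coeff m T'))) :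
    ∀ j ≤ k, Tendsto (fun n => coeff j (K n)) atTop (𝓝 (coeff j K')) := by
  have hV : ∀ m ≤ k, Tendsto (fun n => coeff m (X * T n : ℂ⟦X⟧)) atTop
      (𝓝 (coeff m (X * T' : ℂ⟦X⟧))) := by
    intro m hm
    rcases m with _ | m
    · simp
    · simp only [coeff_succ_X_mul]
      exact hT m (by omega)
  have hrec : ∀ (K T : ℂ⟦X⟧), K.subst (X * T : ℂ⟦X⟧) = X → ∀ j,
      coeff j K * constantCoeff T ^ j = coeff j (X : ℂ⟦X⟧) -
        ∑ s ∈ Finset.range j, coeff s K * coeff j ((X * T) ^ s) := by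
    intro K T h j
    have hj := congrArg (coeff j) h
    rw [coeff_subst_eq_sum (by simp) K (Nat.lt_succ_self j), Finset.sum_range_succ,
      coeff_X_mul_pow_self] at hj
    linear_combination hj
  intro j
  induction j using Nat.strong_induction_on with
  | _ j ih =>
  intro hj
  rcases j with _ | j
  · simp [hK0, hK0']
  have hT0' : Tendsto (fun n => constantCoeff (T n)) atTop (𝓝 (constantCoeff T')) := by
    simpa using hT 0 (by omega)
  have hne : ∀ᶠ n in atTop, constantCoeff (T n) ≠ 0 := hT0'.eventually_ne hT0
  have hlim : Tendsto (fun n => (coeff (j + 1) (X : ℂ⟦X⟧) -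
      ∑ s ∈ Finset.range (j + 1), coeff s (K n) * coeff (j + 1) ((X * T n) ^ s)) /
        constantCoeff (T n) ^ (j + 1)) atTop (𝓝 ((coeff (j + 1) (X : ℂ⟦X⟧) -
      ∑ s ∈ Finset.range (j + 1), coeff s K' * coeff (j + 1) ((X * T') ^ s)) /
        constantCoeff T' ^ (j + 1))) := by
    refine Tendsto.div (tendsto_const_nhds.sub (tendsto_finsetSum _ fun s hs => ?_))
      (hT0'.pow _) (pow_ne_zero _ hT0)
    have := Finset.mem_range.1 hs
    exact (ih s this (by omega)).mul (tendsto_coeff_pow hV s (j + 1) hj)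
  rw [← hrec K' T' hK', mul_div_cancel_right₀ _ (pow_ne_zero _ hT0)] at hlim
  refine hlim.congr' ?_
  filter_upwards [hne, hK] with n hn hKn
  rw [← hrec (K n) (T n) hKn, mul_div_cancel_right₀ _ (pow_ne_zero _ hn)]

open fwdDiff in
lemma sum_choose_mul_pow_eq_zero (m : ℕ) :
    ∑ j ∈ Finset.range (m + 1 + 1), (-1 : ℂ) ^ (m + 1 - j) * ((m + 1).choose j) * (j : ℂ) ^ m
      = 0 := by
  have h := congrFun (fwdDiff_iter_pow_eq_zero_of_lt (R := ℂ) (Nat.lt_succ_self m)) 0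
  rw [fwdDiff_iter_eq_sum_shift] at h
  simpa using h

/-- The compositional inverse of `w e ^ (c + d w)` is `∑ j ^ (j - 1) / j! (-d) ^ (j - 1) e ^ (-j c)`
`w ^ j`. The comparison of coefficients amounts to the vanishing of the `m`-th finite difference of
a polynomial of degree `m - 1`. -/
theorem treeSeries_subst (c d : ℂ) :
    (mk fun j : ℕ => if j = 0 then 0 else
      (j : ℂ) ^ (j - 1) / j.factorial * (-d) ^ (j - 1) * Complex.exp (-(j * c)) : ℂ⟦X⟧).subst
      (X * expSeries c d : ℂ⟦X⟧) = X := by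
  ext m
  rw [coeff_subst_eq_sum (by simp) _ (Nat.lt_succ_self m)]
  rcases m with _ | m
  · simp
  have hterm : ∀ j ∈ Finset.range (m + 1 + 1), coeff j (mk fun j : ℕ => if j = 0 then 0 else
      (j : ℂ) ^ (j - 1) / j.factorial * (-d) ^ (j - 1) * Complex.exp (-(j * c)) : ℂ⟦X⟧) *
        coeff (m + 1) ((X * expSeries c d) ^ j) =
      (-d) ^ m / (m + 1).factorial * if j = 0 then 0 else
        ((-1 : ℂ) ^ (m + 1 - j) * ((m + 1).choose j) * (j : ℂ) ^ m) := by
    intro j hj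
    have hjm : j ≤ m + 1 := by
      have := Finset.mem_range.1 hj
      omega
    rcases j with _ | j
    · simp
    obtain ⟨i, rfl⟩ := Nat.exists_eq_add_of_le (Nat.le_of_succ_le_succ hjm)
    have hsub : j + i + 1 - (j + 1) = i := by omega
    have hexp : Complex.exp (-((j + 1 : ℕ) * c)) * Complex.exp ((j + 1 : ℕ) * c) = 1 := by
      rw [← Complex.exp_add, neg_add_cancel, Complex.exp_zero]
    have hch : ((j + i + 1).choose (j + 1) : ℂ) =
        (j + i + 1).factorial / ((j + 1).factorial * i.factorial) := by
      rw [Nat.cast_choose ℂ hjm, hsub]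
    rw [mul_pow, coeff_X_pow_mul', if_pos hjm, expSeries_pow, coeff_expSeries, coeff_mk, hsub, hch,
      if_neg (Nat.succ_ne_zero j), if_neg (Nat.succ_ne_zero j)]
    have hf1 : ((j + 1).factorial : ℂ) ≠ 0 := by exact_mod_cast Nat.factorial_ne_zero _
    have hf2 : (i.factorial : ℂ) ≠ 0 := by exact_mod_cast Nat.factorial_ne_zero _
    have hf3 : ((j + i + 1).factorial : ℂ) ≠ 0 := by exact_mod_cast Nat.factorial_ne_zero _
    have hd : ((j + 1 : ℕ) * d) ^ i = (-1) ^ i * ((-d) ^ i * ((j + 1 : ℕ) : ℂ) ^ i) := by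
      rw [mul_pow, neg_pow d i]
      have : (-1 : ℂ) ^ i * (-1) ^ i = 1 := by rw [← mul_pow]; simp
      linear_combination (-d ^ i * ((j + 1 : ℕ) : ℂ) ^ i) * this
    rw [hd, pow_add (-d), pow_add (((j + 1 : ℕ) : ℂ)), Nat.add_sub_cancel]
    generalize ((j + 1 : ℕ) : ℂ) = y at *
    field_simp
    linear_combination (y ^ j * y ^ i * d ^ j * d ^ i * (-1) ^ j * (-1) ^ i) * hexp
  rw [Finset.sum_congr rfl hterm, ← Finset.mul_sum]
  rcases Nat.eq_zero_or_pos m with rfl | hm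
  · simp [Finset.sum_range_succ]
  · have h := sum_choose_mul_pow_eq_zero m
    have e : ∑ j ∈ Finset.range (m + 1 + 1), (if j = 0 then (0 : ℂ) else
        ((-1 : ℂ) ^ (m + 1 - j) * ((m + 1).choose j) * (j : ℂ) ^ m)) = 0 := by
      refine (Finset.sum_congr rfl fun j _ => ?_).trans h
      split_ifs with hj
      · simp [hj, hm.ne']
      · rfl
    rw [e, mul_zero, coeff_X, if_neg (by omega)]

end CumulantsAndSTransform

/-! ### The spectral distribution -/

section Spectral

variable {A : Type*} [CStarAlgebra A] (φ : TracialState A) {x : A}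

lemma TracialState.nontrivial (φ : TracialState A) : Nontrivial A := by
  refine ⟨1, 0, fun h => ?_⟩
  have := φ.map_one
  rw [h, map_zero] at this
  exact zero_ne_one this

lemma abs_le_norm_of_mem_spectrum (φ : TracialState A) {t : ℝ} (ht : t ∈ spectrum ℝ x) :
    |t| ≤ ‖x‖ := by
  have := φ.nontrivial
  exact spectrum.norm_le_norm_of_mem ht

lemma apply_cfc_im (f : ℝ → ℝ) (hf : Continuous f) : (φ (cfc f x)).im = 0 := by
  have hpos : ∀ g : ℝ → ℝ, Continuous g → (∀ t, 0 ≤ g t) → (φ (cfc g x)).im = 0 := by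
    intro g hg h0
    have h3 := cfc_mul (fun t : ℝ => Real.sqrt (g t)) (fun t : ℝ => Real.sqrt (g t)) x
      hg.sqrt.continuousOn hg.sqrt.continuousOn
    simp only [Real.mul_self_sqrt (h0 _)] at h3
    have hp := φ.nonneg' (cfc (fun t : ℝ => Real.sqrt (g t)) x)
    rw [← cfc_star] at hp
    simp only [star_trivial] at hp
    rw [← h3] at hp
    exact (Complex.le_def.1 hp).2.symm
  have h := cfc_sub (fun t => max (f t) 0) (fun t => max (-f t) 0) x
    (hf.max continuous_const).continuousOn (hf.neg.max continuous_const).continuousOn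
  have e : (fun t => max (f t) 0 - max (-f t) 0) = f := by
    funext t
    rcases le_total 0 (f t) with h | h
    · simp [h]
    · simp [h]
  rw [e] at h
  rw [h, map_sub, Complex.sub_im, hpos _ (hf.max continuous_const) fun t => le_max_right _ _,
    hpos (fun t => max (-f t) 0) (hf.neg.max continuous_const) fun t => le_max_right _ _, sub_zero]

instance : IsFiniteMeasureOnCompacts (spectralDistribution φ x) := by
  unfold spectralDistribution
  infer_instance

lemma integral_spectralDistribution_compactlySupported {f : ℝ → ℝ} (hf : Continuous f)
    (hc : HasCompactSupport f) : ∫ t, f t ∂(spectralDistribution φ x) = (φ (cfc f x)).re :=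
  RealRMK.integral_rieszMeasure (functionalOf φ x) ⟨⟨f, hf⟩, hc⟩

/-- The spectral distribution is supported in `[-‖x‖, ‖x‖]`. -/
lemma ae_abs_le_norm : ∀ᵐ t ∂(spectralDistribution φ x), |t| ≤ ‖x‖ := by
  have hn : ∀ n : ℕ, ∀ᵐ t : ℝ ∂(spectralDistribution φ x), ‖x‖ < n → |t| < n → |t| ≤ ‖x‖ := by
    intro n
    by_cases hxn : ‖x‖ < n
    swap
    · exact ae_of_all _ fun t h => absurd h hxn
    set ψ : ℝ → ℝ := fun t => max 0 ((|t| - ‖x‖) * (n - |t|)) with hψ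
    have hψc : Continuous ψ := by fun_prop
    have hψs : HasCompactSupport ψ := by
      refine HasCompactSupport.intro (isCompact_Icc (a := -(n : ℝ)) (b := n)) fun t ht => ?_
      have : (n : ℝ) < |t| := by
        by_contra hcon
        exact ht (abs_le.1 (not_lt.1 hcon))
      exact max_eq_left (by nlinarith)
    have h0 : cfc ψ x = 0 := by
      rw [← cfc_zero ℝ x]
      refine cfc_congr fun t ht => ?_
      have := abs_le_norm_of_mem_spectrum φ ht
      exact max_eq_left (by nlinarith)
    have hint := integral_spectralDistribution_compactlySupported φ (x := x) hψc hψs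
    have hψ0 : 0 ≤ ψ := fun t => le_max_left _ _
    rw [h0, map_zero, Complex.zero_re, integral_eq_zero_iff_of_nonneg hψ0
      (hψc.integrable_of_hasCompactSupport hψs)] at hint
    filter_upwards [hint] with t ht _ htn
    by_contra hcon
    have h1 : 0 < (|t| - ‖x‖) * (n - |t|) :=
      mul_pos (sub_pos.2 (not_le.1 hcon)) (sub_pos.2 htn)
    have h2 : max 0 ((|t| - ‖x‖) * (n - |t|)) = 0 := ht
    rw [max_eq_right h1.le] at h2
    exact h1.ne' h2
  filter_upwards [ae_all_iff.2 hn] with t ht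
  obtain ⟨n, hn⟩ := exists_nat_gt (max ‖x‖ |t|)
  exact ht n ((le_max_left _ _).trans_lt hn) ((le_max_right _ _).trans_lt hn)

lemma exists_cutoff (f : ℝ → ℝ) (hf : Continuous f) (R : ℝ) : ∃ F : ℝ → ℝ, Continuous F ∧
    HasCompactSupport F ∧ ∀ t, |t| ≤ R → F t = f t := by
  refine ⟨fun t => max 0 (min 1 (R + 1 - |t|)) * f t, by fun_prop, ?_, fun t ht => ?_⟩
  · refine HasCompactSupport.intro (isCompact_Icc (a := -(R + 1)) (b := R + 1)) fun t ht => ?_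
    have : R + 1 < |t| := by
      by_contra hcon
      exact ht (abs_le.1 (not_lt.1 hcon))
    rw [max_eq_left ((min_le_right _ _).trans (by linarith)), zero_mul]
  · dsimp only
    rw [min_eq_left (by linarith), max_eq_right zero_le_one, one_mul]

lemma integrable_spectralDistribution {f : ℝ → ℝ} (hf : Continuous f) :
    Integrable f (spectralDistribution φ x) := by
  obtain ⟨F, hF, hFs, hFf⟩ := exists_cutoff f hf ‖x‖
  refine (hF.integrable_of_hasCompactSupport hFs).congr ?_
  filter_upwards [ae_abs_le_norm φ] with t ht
  exact hFf t ht

/-- The spectral distribution represents the functional calculus of all continuous functions. -/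
lemma apply_cfc_eq_integral {f : ℝ → ℝ} (hf : Continuous f) :
    φ (cfc f x) = ((∫ t, f t ∂(spectralDistribution φ x) : ℝ) : ℂ) := by
  obtain ⟨F, hF, hFs, hFf⟩ := exists_cutoff f hf ‖x‖
  have h1 : cfc f x = cfc F x :=
    cfc_congr fun t ht => (hFf t (abs_le_norm_of_mem_spectrum φ ht)).symm
  have h2 : ∫ t, f t ∂(spectralDistribution φ x) = ∫ t, F t ∂(spectralDistribution φ x) := by
    refine integral_congr_ae ?_
    filter_upwards [ae_abs_le_norm φ] with t ht
    exact (hFf t ht).symm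
  rw [h1, h2, integral_spectralDistribution_compactlySupported φ hF hFs]
  refine Complex.ext (by simp) ?_
  rw [apply_cfc_im φ F hF, Complex.ofReal_im]

lemma isProbabilityMeasure_spectralDistribution (hx : IsSelfAdjoint x) :
    IsProbabilityMeasure (spectralDistribution φ x) := by
  have hfin : IsFiniteMeasure (spectralDistribution φ x) := by
    have := integrable_spectralDistribution φ (x := x) (continuous_const (y := (1 : ℝ)))
    rw [integrable_const_iff] at this
    exact this.resolve_left one_ne_zero
  have h := apply_cfc_eq_integral φ (x := x) (continuous_const (y := (1 : ℝ)))
  rw [cfc_const_one ℝ x, φ.map_one, integral_const, smul_eq_mul, mul_one] at h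
  refine ⟨?_⟩
  have h' : (spectralDistribution φ x).real univ = 1 := by exact_mod_cast h.symm
  rw [measureReal_def] at h'
  rw [← ENNReal.ofReal_toReal (measure_ne_top (spectralDistribution φ x) univ), h',
    ENNReal.ofReal_one]

lemma integral_id_spectralDistribution (hx : IsSelfAdjoint x) :
    ((∫ t, t ∂(spectralDistribution φ x) : ℝ) : ℂ) = φ x := by
  have := apply_cfc_eq_integral φ (x := x) continuous_id
  rw [cfc_id ℝ x] at this
  exact this.symm

lemma integral_sq_spectralDistribution (hx : IsSelfAdjoint x) :
    ((∫ t, t ^ 2 ∂(spectralDistribution φ x) : ℝ) : ℂ) = φ (x ^ 2) := by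
  have := apply_cfc_eq_integral φ (x := x) (continuous_pow 2)
  rw [cfc_pow_id (R := ℝ) x 2] at this
  exact this.symm

end Spectral

/-! ### Functional calculus -/

section ApplyFun

variable {A : Type*} [CStarAlgebra A] {x : A} {g : ℝ → ℂ}

lemma applyFun_mem_closedAdjoin (hx : IsSelfAdjoint x) (g : ℝ → ℂ) (c : ℝ) :
    applyFun g ((c : ℂ) • x) ∈ closedAdjoin x := by
  set y := (c : ℂ) • x with hy
  have hysa : IsSelfAdjoint y := by
    rw [hy, Complex.coe_smul]
    exact (IsSelfAdjoint.all c).smul hx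
  have h := cfc_mem_elemental (fun z : ℂ => g z.re) y
  have hle : ((StarAlgebra.adjoin ℂ {y} : StarSubalgebra ℂ A) : Set A) ⊆
      (Algebra.adjoin ℂ {x} : Set A) := by
    intro z hz
    have hz' : z ∈ (StarAlgebra.adjoin ℂ {y} : StarSubalgebra ℂ A).toSubalgebra := hz
    rw [StarAlgebra.adjoin_toSubalgebra, Set.star_singleton, hysa.star_eq, Set.union_self] at hz'
    refine Algebra.adjoin_le ?_ hz'
    rw [Set.singleton_subset_iff]
    exact Subalgebra.smul_mem _ (Algebra.self_mem_adjoin_singleton ℂ x) _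
  exact closure_mono hle h

lemma star_applyFun (g : ℝ → ℂ) (y : A) :
    star (applyFun g y) = applyFun (fun t => star (g t)) y := by
  rw [applyFun, ← cfc_star]
  rfl

lemma star_applyFun_mul_applyFun (hx : IsSelfAdjoint x) (hg : Continuous g) (c : ℝ) :
    star (applyFun g ((c : ℂ) • x)) * applyFun g ((c : ℂ) • x) =
      cfc (fun t : ℝ => absSq g (c * t)) x := by
  have hysa : IsSelfAdjoint ((c : ℂ) • x) := by
    rw [Complex.coe_smul]
    exact (IsSelfAdjoint.all c).smul hx
  have hgc : Continuous fun z : ℂ => g z.re := hg.comp Complex.continuous_re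
  have habs : Continuous (absSq g) := hg.norm.pow 2
  have h1 : star (applyFun g ((c : ℂ) • x)) * applyFun g ((c : ℂ) • x) =
      cfc (absSq g) ((c : ℂ) • x) := by
    rw [star_applyFun, applyFun, applyFun, cfc_real_eq_complex _ hysa,
      ← cfc_mul (fun z : ℂ => star (g z.re)) (fun z : ℂ => g z.re) _
        (continuous_star.comp hgc).continuousOn hgc.continuousOn]
    refine cfc_congr fun z _ => ?_
    simp only [absSq]
    rw [Complex.star_def, Complex.conj_mul']
    push_cast
    rfl
  rw [h1, Complex.coe_smul]
  exact (cfc_comp_smul c (absSq g) x habs.continuousOn hx).symm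

end ApplyFun

/-! ### Taylor bounds with local Hölder seminorms -/

section Taylor

/-- If the derivative of `f` deviates from `d` by at most `C |z| ^ β`, then `f` deviates from its
linear approximation by at most `C |z| ^ (β + 1)`. -/
lemma abs_sub_linear_le {f : ℝ → ℝ} (hf : Differentiable ℝ f) {C β d y : ℝ} (hC : 0 ≤ C)
    (hβ : 0 ≤ β) (h : ∀ z ∈ uIcc 0 y, |deriv f z - d| ≤ C * |z| ^ β) :
    ∀ z ∈ uIcc 0 y, |f z - f 0 - d * z| ≤ C * |z| ^ (β + 1) := by
  intro z hz
  have hsub : uIcc 0 z ⊆ uIcc 0 y := uIcc_subset_uIcc left_mem_uIcc hz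
  have hder : ∀ w, HasDerivAt (fun w => f w - d * w) (deriv f w - d) w := fun w =>
    (hf w).hasDerivAt.fun_sub (((hasDerivAt_id w).const_mul d).congr_deriv (mul_one d))
  have hb : ∀ w ∈ uIcc 0 z, ‖deriv f w - d‖ ≤ C * |z| ^ β := by
    intro w hw
    refine (h w (hsub hw)).trans ?_
    have : |w| ≤ |z| := by
      have := abs_sub_left_of_mem_uIcc hw
      simpa using this
    gcongr
  have := (convex_uIcc (0 : ℝ) z).norm_image_sub_le_of_norm_hasDerivWithin_le
    (fun w _ => (hder w).hasDerivWithinAt) hb left_mem_uIcc right_mem_uIcc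
  rw [Real.norm_eq_abs, Real.norm_eq_abs, sub_zero] at this
  rcases eq_or_ne z 0 with rfl | hz0
  · simp
    positivity
  · rw [Real.rpow_add_one (abs_ne_zero.2 hz0), ← mul_assoc]
    convert this using 2
    ring

variable {γ : ℝ≥0} {α s t : ℝ} {h : ℝ → ℝ}

lemma mul_mem_localInterval (hs0 : 0 ≤ s) (hsα : s ≤ α) {z : ℝ} (hz : z ∈ uIcc 0 (s * t)) :
    z ∈ Icc (α * min t 0) (α * max t 0) := by
  have hα : 0 ≤ α := hs0.trans hsα
  rcases le_total 0 t with ht | ht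
  · rw [uIcc_of_le (by positivity)] at hz
    rw [min_eq_right ht, max_eq_left ht, mul_zero]
    exact ⟨hz.1, hz.2.trans (by gcongr)⟩
  · rw [uIcc_of_ge (mul_nonpos_of_nonneg_of_nonpos hs0 ht)] at hz
    rw [min_eq_left ht, max_eq_right ht, mul_zero]
    exact ⟨le_trans (mul_le_mul_of_nonpos_right hsα ht) hz.1, hz.2⟩

lemma abs_sub_le_localHolder (hs0 : 0 ≤ s) (hsα : s ≤ α) (hH : localHolder γ α h t ≠ ⊤) :
    ∀ z ∈ uIcc 0 (s * t), |h z - h 0| ≤ (localHolder γ α h t).toReal * |z| ^ (γ : ℝ) := by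
  intro z hz
  have hmem : MemHolder γ ((Icc (α * min t 0) (α * max t 0)).domRestrict h) :=
    eHolderNorm_ne_top.1 hH
  have hd := hmem.holderWith.dist_le ⟨z, mul_mem_localInterval hs0 hsα hz⟩
    ⟨0, mul_mem_localInterval hs0 hsα left_mem_uIcc⟩
  have e : dist (⟨z, mul_mem_localInterval hs0 hsα hz⟩ : Icc (α * min t 0) (α * max t 0))
      ⟨0, mul_mem_localInterval hs0 hsα left_mem_uIcc⟩ = |z| := by
    rw [Subtype.dist_eq, Real.dist_eq, sub_zero]
  rw [e] at hd
  exact hd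

/-- The constant `H` is allowed to be infinite, in which case the bound says that `v` vanishes if
`y` does. -/
lemma enorm_le_mul_rpow {H : ℝ≥0∞} {v y b : ℝ} (hb : 0 < b) (h0 : y = 0 → v = 0)
    (h : H ≠ ⊤ → |v| ≤ H.toReal * |y| ^ b) : ‖v‖ₑ ≤ H * ‖y‖ₑ ^ b := by
  rcases eq_or_ne y 0 with hy | hy
  · simp [h0 hy]
  rcases eq_or_ne H ⊤ with rfl | hH
  · rw [ENNReal.top_mul]
    · exact le_top
    · simp [hy]
  · rw [Real.enorm_eq_ofReal_abs, Real.enorm_eq_ofReal_abs, ENNReal.ofReal_rpow_of_nonneg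
      (abs_nonneg y) hb.le, ← ENNReal.ofReal_toReal hH, ← ENNReal.ofReal_mul ENNReal.toReal_nonneg]
    exact ENNReal.ofReal_le_ofReal (h hH)

lemma enorm_sub_le_localHolder (hs0 : 0 ≤ s) (hsα : s ≤ α) (hγ : 0 < γ) :
    ‖h (s * t) - h 0‖ₑ ≤ localHolder γ α h t * ‖s * t‖ₑ ^ (γ : ℝ) :=
  enorm_le_mul_rpow (by exact_mod_cast hγ) (fun h0 => by simp [h0]) fun hH =>
    abs_sub_le_localHolder hs0 hsα hH _ right_mem_uIcc

lemma enorm_taylor_two_le (hh : ContDiff ℝ 2 h) (hs0 : 0 ≤ s) (hsα : s ≤ α) :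
    ‖h (s * t) - h 0 - deriv h 0 * (s * t) - iteratedDeriv 2 h 0 / 2 * (s * t) ^ 2‖ₑ ≤
      localHolder γ α (iteratedDeriv 2 h) t * ‖s * t‖ₑ ^ ((γ : ℝ) + 2) := by
  refine enorm_le_mul_rpow (by positivity) (fun h0 => by simp [h0]) fun hH => ?_
  have hh1 : Differentiable ℝ h := hh.differentiable two_ne_zero
  have hh2 : Differentiable ℝ (deriv h) := by
    have := hh.differentiable_iteratedDeriv 1 (by norm_num)
    rwa [iteratedDeriv_one] at this
  have e2 : iteratedDeriv 2 h = deriv (deriv h) := by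
    rw [iteratedDeriv_succ, iteratedDeriv_one]
  have h1 := abs_sub_le_localHolder hs0 hsα hH
  set C := (localHolder γ α (iteratedDeriv 2 h) t).toReal
  rw [e2] at h1 ⊢
  set D := deriv (deriv h) 0
  have h2 := abs_sub_linear_le hh2 ENNReal.toReal_nonneg γ.2 h1
  have hder : ∀ z, HasDerivAt (fun z => h z - D / 2 * z ^ 2) (deriv h z - D * z) z := fun z =>
    (hh1 z).hasDerivAt.fun_sub (((hasDerivAt_pow 2 z).const_mul (D / 2)).congr_deriv (by
      simp
      ring))
  have h3 := abs_sub_linear_le (f := fun z => h z - D / 2 * z ^ 2) (d := deriv h 0)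
    (fun z => (hder z).differentiableAt) (C := C) (β := γ + 1) (y := s * t)
    ENNReal.toReal_nonneg (by positivity) (fun z hz => by
      rw [(hder z).deriv]
      rw [sub_right_comm]
      exact h2 z hz) (s * t) right_mem_uIcc
  rw [show (γ : ℝ) + 2 = γ + 1 + 1 by ring]
  convert h3 using 2
  simp
  ring

end Taylor

/-! ### Moment bounds for a single distribution -/

section MomentBounds

/-- Young's inequality for the exponents `1 + ζ⁻¹` and `1 + ζ`, with exponents below the critical
ones: this avoids all measurability questions for `F`. -/
lemma rpow_mul_rpow_le {ζ a b k q : ℝ} (hζ : 0 < ζ) (ha : 0 ≤ a) (hak : a ≤ k) (hb : 0 ≤ b)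
    (hbq : b ≤ q) (F τ : ℝ≥0∞) :
    F ^ a * τ ^ b ≤ 2 + F ^ (k * (1 + ζ⁻¹)) + τ ^ (q * (1 + ζ)) := by
  have hpq : (1 + ζ⁻¹).HolderConjugate (1 + ζ) := by
    rw [Real.holderConjugate_iff]
    refine ⟨by simpa using hζ, ?_⟩
    have : 1 + ζ ≠ 0 := by positivity
    have : ζ + 1 ≠ 0 := by positivity
    field_simp
    ring
  have hle : ∀ (G : ℝ≥0∞) {c d : ℝ}, 0 ≤ c → c ≤ d → G ^ c ≤ 1 + G ^ d := by
    intro G c d hc hcd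
    rcases le_total G 1 with hG | hG
    · exact (ENNReal.rpow_le_one hG hc).trans le_self_add
    · exact (ENNReal.rpow_le_rpow_of_exponent_le hG hcd).trans le_add_self
  have hdiv : ∀ (G : ℝ≥0∞) {c : ℝ}, 1 ≤ c → G / ENNReal.ofReal c ≤ G := fun G c hc =>
    ENNReal.div_le_of_le_mul (le_mul_of_one_le_right zero_le (ENNReal.one_le_ofReal.2 hc))
  calc F ^ a * τ ^ b
      ≤ (F ^ a) ^ (1 + ζ⁻¹) / ENNReal.ofReal (1 + ζ⁻¹) +
          (τ ^ b) ^ (1 + ζ) / ENNReal.ofReal (1 + ζ) :=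
        ENNReal.young_inequality _ _ hpq
    _ ≤ (F ^ a) ^ (1 + ζ⁻¹) + (τ ^ b) ^ (1 + ζ) :=
        add_le_add (hdiv _ (by simpa using hζ.le)) (hdiv _ (by simpa using hζ.le))
    _ ≤ (1 + F ^ (k * (1 + ζ⁻¹))) + (1 + τ ^ (q * (1 + ζ))) := by
        rw [← ENNReal.rpow_mul, ← ENNReal.rpow_mul]
        exact add_le_add (hle _ (by positivity) (by gcongr)) (hle _ (by positivity) (by gcongr))
    _ = 2 + F ^ (k * (1 + ζ⁻¹)) + τ ^ (q * (1 + ζ)) := by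
        rw [← one_add_one_eq_two]
        abel

variable {ν : Measure ℝ}

lemma abs_integral_le_of_enorm_le {v : ℝ → ℝ} {G : ℝ → ℝ≥0∞} {s b : ℝ} {N : ℝ≥0∞} (hN : N ≠ ⊤)
    (hs : 0 ≤ s) (hb : 0 ≤ b) (hv : ∀ t, ‖v t‖ₑ ≤ ‖s‖ₑ ^ b * G t) (hG : ∫⁻ t, G t ∂ν ≤ N) :
    |∫ t, v t ∂ν| ≤ s ^ b * N.toReal := by
  have h1 : ‖∫ t, v t ∂ν‖ₑ ≤ ‖s‖ₑ ^ b * N := by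
    calc ‖∫ t, v t ∂ν‖ₑ ≤ ∫⁻ t, ‖v t‖ₑ ∂ν := enorm_integral_le_lintegral_enorm _
      _ ≤ ∫⁻ t, ‖s‖ₑ ^ b * G t ∂ν := lintegral_mono hv
      _ = ‖s‖ₑ ^ b * ∫⁻ t, G t ∂ν :=
          lintegral_const_mul' _ _ (ENNReal.rpow_ne_top_of_nonneg hb enorm_ne_top)
      _ ≤ ‖s‖ₑ ^ b * N := by gcongr
  have h2 := ENNReal.toReal_mono
    (ENNReal.mul_ne_top (ENNReal.rpow_ne_top_of_nonneg hb enorm_ne_top) hN) h1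
  rwa [toReal_enorm, Real.norm_eq_abs, ENNReal.toReal_mul, ← ENNReal.toReal_rpow, toReal_enorm,
    Real.norm_of_nonneg hs] at h2

variable [IsProbabilityMeasure ν]

lemma lintegral_rpow_mul_rpow_le {ζ a b k q : ℝ} (hζ : 0 < ζ) (ha : 0 ≤ a) (hak : a ≤ k)
    (hb : 0 ≤ b) (hbq : b ≤ q) {F : ℝ → ℝ≥0∞} {M : ℝ≥0∞}
    (hF : ∫⁻ t, F t ^ (k * (1 + ζ⁻¹)) ∂ν ≤ M)
    (ht : ∫⁻ t, ENNReal.ofReal (|t| ^ (q * (1 + ζ))) ∂ν ≤ M) :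
    ∫⁻ t, F t ^ a * ‖t‖ₑ ^ b ∂ν ≤ 2 + M + M := by
  have hq : 0 ≤ q * (1 + ζ) := mul_nonneg (hb.trans hbq) (by positivity)
  have e : ∀ t : ℝ, ENNReal.ofReal (|t| ^ (q * (1 + ζ))) = ‖t‖ₑ ^ (q * (1 + ζ)) := fun t => by
    rw [Real.enorm_eq_ofReal_abs, ENNReal.ofReal_rpow_of_nonneg (abs_nonneg t) hq]
  simp only [e] at ht
  calc ∫⁻ t, F t ^ a * ‖t‖ₑ ^ b ∂ν
      ≤ ∫⁻ t, (2 + F t ^ (k * (1 + ζ⁻¹))) + ‖t‖ₑ ^ (q * (1 + ζ)) ∂ν :=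
        lintegral_mono fun t => rpow_mul_rpow_le hζ ha hak hb hbq _ _
    _ = (2 + ∫⁻ t, F t ^ (k * (1 + ζ⁻¹)) ∂ν) + ∫⁻ t, ‖t‖ₑ ^ (q * (1 + ζ)) ∂ν := by
        rw [lintegral_add_right _ (by fun_prop), lintegral_add_left measurable_const,
          lintegral_const, measure_univ, mul_one]
    _ ≤ 2 + M + M := by gcongr

variable {h : ℝ → ℝ} {ζ α s : ℝ} {γ : ℝ≥0} {k : ℕ} {M : ℝ≥0∞}

/-- The first moment of `h(s x) - h(0)` up to `O(s ^ (2 + γ))`, for a centered `x` with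
variance `v`. -/
lemma abs_integral_one_le (hint : ∀ f : ℝ → ℝ, Continuous f → Integrable f ν)
    (hh : ContDiff ℝ 2 h) (hζ : 0 < ζ) (hk : 1 ≤ k) (hγ1 : γ ≤ 1) (hs0 : 0 ≤ s) (hsα : s ≤ α)
    (hM : M ≠ ⊤)
    (ht : ∫⁻ t, ENNReal.ofReal (|t| ^ (((max k 3 : ℕ) : ℝ) * (1 + ζ))) ∂ν ≤ M)
    (h2 : ∫⁻ t, localHolder γ α (iteratedDeriv 2 h) t ^ ((k : ℝ) * (1 + ζ⁻¹)) ∂ν ≤ M)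
    {v : ℝ} (hm1 : ∫ t, t ∂ν = 0) (hm2 : ∫ t, t ^ 2 ∂ν = v) :
    |∫ t, (h (s * t) - h 0) ∂ν - iteratedDeriv 2 h 0 / 2 * s ^ 2 * v| ≤
      s ^ ((γ : ℝ) + 2) * (2 + M + M).toReal := by
  have hhc : Continuous h := hh.continuous
  have e : ∫ t, (h (s * t) - h 0) ∂ν - iteratedDeriv 2 h 0 / 2 * s ^ 2 * v =
      ∫ t, (h (s * t) - h 0 - deriv h 0 * (s * t) - iteratedDeriv 2 h 0 / 2 * (s * t) ^ 2) ∂ν := by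
    have i1 := integral_sub (μ := ν) (f := fun t => h (s * t) - h 0 - deriv h 0 * (s * t))
      (g := fun t => iteratedDeriv 2 h 0 / 2 * (s * t) ^ 2) (hint _ (by fun_prop))
      (hint _ (by fun_prop))
    have i2 := integral_sub (μ := ν) (f := fun t => h (s * t) - h 0)
      (g := fun t => deriv h 0 * (s * t)) (hint _ (by fun_prop)) (hint _ (by fun_prop))
    have i3 : ∫ t, deriv h 0 * (s * t) ∂ν = 0 := by
      simp_rw [← mul_assoc]
      rw [integral_const_mul, hm1, mul_zero]
    rw [i1, i2, i3, sub_zero]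
    simp_rw [mul_pow, ← mul_assoc]
    rw [integral_const_mul, hm2]
  rw [e]
  have hγ : (γ : ℝ) ≤ 1 := by exact_mod_cast hγ1
  have h3 : (3 : ℝ) ≤ (max k 3 : ℕ) := by exact_mod_cast le_max_right k 3
  refine abs_integral_le_of_enorm_le (by finiteness) hs0 (by positivity) (fun t => ?_)
    (lintegral_rpow_mul_rpow_le (a := 1) (b := γ + 2) (k := k) (q := (max k 3 : ℕ)) hζ zero_le_one
      (by exact_mod_cast hk) (by positivity) (by linarith) h2 ht)
  refine (enorm_taylor_two_le (γ := γ) hh hs0 hsα).trans (le_of_eq ?_)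
  rw [enorm_mul, ENNReal.mul_rpow_of_nonneg _ _ (by positivity), ENNReal.rpow_one]
  ring

/-- The second moment of `h(s x) - h(0)` up to `O(s³)`. -/
lemma abs_integral_sq_le (hint : ∀ f : ℝ → ℝ, Continuous f → Integrable f ν)
    (hh : ContDiff ℝ 2 h) (hζ : 0 < ζ) (hk : 2 ≤ k) (hs0 : 0 ≤ s) (hsα : s ≤ α)
    (hM : M ≠ ⊤)
    (ht : ∫⁻ t, ENNReal.ofReal (|t| ^ (((max k 3 : ℕ) : ℝ) * (1 + ζ))) ∂ν ≤ M)
    (h0 : ∫⁻ t, localHolder 1 α h t ^ ((k : ℝ) * (1 + ζ⁻¹)) ∂ν ≤ M)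
    (h1 : ∫⁻ t, localHolder 1 α (deriv h) t ^ ((k : ℝ) * (1 + ζ⁻¹)) ∂ν ≤ M)
    {v : ℝ} (hm2 : ∫ t, t ^ 2 ∂ν = v) :
    |∫ t, (h (s * t) - h 0) ^ 2 ∂ν - (deriv h 0 * s) ^ 2 * v| ≤
      s ^ (3 : ℝ) * ((2 + M + M) * (2 + ‖deriv h 0‖ₑ)).toReal := by
  have hhc : Continuous h := hh.continuous
  set c := deriv h 0 with hc
  have e : ∫ t, (h (s * t) - h 0) ^ 2 ∂ν - (c * s) ^ 2 * v =
      ∫ t, ((h (s * t) - h 0) ^ 2 - (c * s) ^ 2 * t ^ 2) ∂ν := by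
    have i1 := integral_sub (μ := ν) (f := fun t => (h (s * t) - h 0) ^ 2)
      (g := fun t => (c * s) ^ 2 * t ^ 2) (hint _ (by fun_prop)) (hint _ (by fun_prop))
    rw [i1, integral_const_mul, hm2]
  have h3 : (3 : ℝ) ≤ (max k 3 : ℕ) := by exact_mod_cast le_max_right k 3
  have hk' : (2 : ℝ) ≤ k := by exact_mod_cast hk
  have hs3 : ‖s‖ₑ ^ (3 : ℝ) ≠ ⊤ := ENNReal.rpow_ne_top_of_nonneg (by norm_num) enorm_ne_top
  have hb : ∀ {F : ℝ → ℝ≥0∞} {f : ℝ → ℝ} (a : ℝ), 0 ≤ a → a ≤ 2 →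
      ∫⁻ t, F t ^ ((k : ℝ) * (1 + ζ⁻¹)) ∂ν ≤ M →
      (∀ t, ‖f t‖ₑ ≤ F t ^ a * ‖s * t‖ₑ ^ (3 : ℝ)) →
      ∫⁻ t, ‖f t‖ₑ ∂ν ≤ ‖s‖ₑ ^ (3 : ℝ) * (2 + M + M) := by
    intro F f a ha ha2 hF hf
    calc ∫⁻ t, ‖f t‖ₑ ∂ν ≤ ∫⁻ t, ‖s‖ₑ ^ (3 : ℝ) * (F t ^ a * ‖t‖ₑ ^ (3 : ℝ)) ∂ν := by
          refine lintegral_mono fun t => (hf t).trans (le_of_eq ?_)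
          rw [enorm_mul, ENNReal.mul_rpow_of_nonneg _ _ (by norm_num)]
          ring
      _ = ‖s‖ₑ ^ (3 : ℝ) * ∫⁻ t, F t ^ a * ‖t‖ₑ ^ (3 : ℝ) ∂ν := lintegral_const_mul' _ _ hs3
      _ ≤ _ := by
          gcongr
          exact lintegral_rpow_mul_rpow_le (k := k) (q := (max k 3 : ℕ)) hζ ha
            (ha2.trans hk') (by norm_num) h3 hF ht
  have hu : ∀ t, localHolder 1 α h t ≠ ⊤ →
      |h (s * t) - h 0| ≤ (localHolder 1 α h t).toReal * |s * t| := fun t hH => by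
    simpa using abs_sub_le_localHolder hs0 hsα hH _ right_mem_uIcc
  have ha : ∀ t, localHolder 1 α (deriv h) t ≠ ⊤ → |h (s * t) - h 0 - c * (s * t)| ≤
      (localHolder 1 α (deriv h) t).toReal * |s * t| ^ 2 := fun t hH => by
    have := abs_sub_linear_le (hh.differentiable two_ne_zero) ENNReal.toReal_nonneg
      (NNReal.coe_nonneg 1) (abs_sub_le_localHolder hs0 hsα hH) _ right_mem_uIcc
    rw [NNReal.coe_one, one_add_one_eq_two, Real.rpow_two] at this
    exact this
  -- With `a = h (s t) - h 0 - c s t` and `u = h (s t) - h 0`, the difference of squares is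
  -- `a u + c s t a`, where `|a u| ≤ a² / |s t| + u² |s t|`. The three terms are measurable, while
  -- their upper bounds in terms of local Hölder norms need not be.
  have b1 := hb (F := localHolder 1 α (deriv h))
    (f := fun t => (h (s * t) - h 0 - c * (s * t)) ^ 2 / (s * t)) 2 (by norm_num) le_rfl h1
    fun t => enorm_le_mul_rpow (by norm_num) (fun h0 => by simp [h0]) fun hH => by
      have hH' : localHolder 1 α (deriv h) t ≠ ⊤ := by
        rintro hT
        simp [hT] at hH
      rcases eq_or_ne (s * t) 0 with h0 | h0
      · simp [h0]
      have h0' : 0 < |s * t| := abs_pos.2 h0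
      rw [abs_div, abs_pow, div_le_iff₀ h0', ← ENNReal.toReal_rpow, Real.rpow_two,
        show (3 : ℝ) = (3 : ℕ) by norm_num, Real.rpow_natCast]
      calc |h (s * t) - h 0 - c * (s * t)| ^ 2
          ≤ ((localHolder 1 α (deriv h) t).toReal * |s * t| ^ 2) ^ 2 :=
            pow_le_pow_left₀ (abs_nonneg _) (ha t hH') 2
        _ = _ := by ring
  have b2 := hb (F := localHolder 1 α h)
    (f := fun t => (h (s * t) - h 0) ^ 2 * (s * t)) 2 (by norm_num) le_rfl h0
    fun t => enorm_le_mul_rpow (by norm_num) (fun h0 => by simp [h0]) fun hH => by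
      have hH' : localHolder 1 α h t ≠ ⊤ := by
        rintro hT
        simp [hT] at hH
      rw [abs_mul, abs_pow, ← ENNReal.toReal_rpow, Real.rpow_two,
        show (3 : ℝ) = (3 : ℕ) by norm_num, Real.rpow_natCast]
      calc |h (s * t) - h 0| ^ 2 * |s * t|
          ≤ ((localHolder 1 α h t).toReal * |s * t|) ^ 2 * |s * t| := by
            gcongr
            exact hu t hH'
        _ = _ := by ring
  have b3 := hb (F := localHolder 1 α (deriv h))
    (f := fun t => (s * t) * (h (s * t) - h 0 - c * (s * t))) 1 (by norm_num) (by norm_num) h1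
    fun t => enorm_le_mul_rpow (by norm_num) (fun h0 => by simp [h0]) fun hH => by
      rw [ENNReal.rpow_one] at hH ⊢
      rw [abs_mul, show (3 : ℝ) = (3 : ℕ) by norm_num, Real.rpow_natCast]
      calc |s * t| * |h (s * t) - h 0 - c * (s * t)|
          ≤ |s * t| * ((localHolder 1 α (deriv h) t).toReal * |s * t| ^ 2) := by
            gcongr
            exact ha t hH
        _ = _ := by ring
  rw [e]
  have hle : ∀ t, ‖(h (s * t) - h 0) ^ 2 - (c * s) ^ 2 * t ^ 2‖ₑ ≤
      (‖(h (s * t) - h 0 - c * (s * t)) ^ 2 / (s * t)‖ₑ + ‖(h (s * t) - h 0) ^ 2 * (s * t)‖ₑ) +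
        ‖c‖ₑ * ‖(s * t) * (h (s * t) - h 0 - c * (s * t))‖ₑ := by
    intro t
    rw [← enorm_mul]
    have hsplit : (h (s * t) - h 0) ^ 2 - (c * s) ^ 2 * t ^ 2 =
        (h (s * t) - h 0 - c * (s * t)) * (h (s * t) - h 0) +
          c * ((s * t) * (h (s * t) - h 0 - c * (s * t))) := by ring
    rw [hsplit]
    refine (enorm_add_le _ _).trans (add_le_add ?_ le_rfl)
    simp only [Real.enorm_eq_ofReal_abs]
    rw [← ENNReal.ofReal_add (abs_nonneg _) (abs_nonneg _)]
    refine ENNReal.ofReal_le_ofReal ?_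
    rcases eq_or_ne (s * t) 0 with h0 | h0
    · simp [h0]
    rw [abs_div, abs_mul, abs_mul (_ ^ 2), abs_pow, abs_pow]
    set p := |h (s * t) - h 0 - c * (s * t)|
    set q := |h (s * t) - h 0|
    have h0' : 0 < |s * t| := abs_pos.2 h0
    have hp : 0 ≤ p := abs_nonneg _
    have hq : 0 ≤ q := abs_nonneg _
    have : p * q ≤ p ^ 2 / |s * t| + q ^ 2 * |s * t| := by
      rw [div_add' _ _ _ h0'.ne', le_div_iff₀ h0']
      nlinarith [sq_nonneg (p - q * |s * t|), mul_nonneg (mul_nonneg hp hq) h0'.le]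
    exact this
  have hfin : ∫⁻ t, ‖(h (s * t) - h 0) ^ 2 - (c * s) ^ 2 * t ^ 2‖ₑ ∂ν ≤
      ‖s‖ₑ ^ (3 : ℝ) * ((2 + M + M) * (2 + ‖c‖ₑ)) := by
    refine (lintegral_mono hle).trans ?_
    rw [lintegral_add_left (by fun_prop), lintegral_add_left (by fun_prop),
      lintegral_const_mul _ (by fun_prop)]
    refine (add_le_add (add_le_add b1 b2) (mul_le_mul_right b3 _)).trans (le_of_eq ?_)
    ring
  have h2 := ENNReal.toReal_mono (by finiteness) ((enorm_integral_le_lintegral_enorm _).trans hfin)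
  rwa [toReal_enorm, Real.norm_eq_abs, ENNReal.toReal_mul, ← ENNReal.toReal_rpow, toReal_enorm,
    Real.norm_of_nonneg hs0] at h2

/-- The `j`-th moment of `h(s x) - h(0)` is `O(s ^ j)`. -/
lemma abs_integral_pow_le (hζ : 0 < ζ) (hs0 : 0 ≤ s) (hsα : s ≤ α)
    (hM : M ≠ ⊤)
    (ht : ∫⁻ t, ENNReal.ofReal (|t| ^ (((max k 3 : ℕ) : ℝ) * (1 + ζ))) ∂ν ≤ M)
    (h0 : ∫⁻ t, localHolder 1 α h t ^ ((k : ℝ) * (1 + ζ⁻¹)) ∂ν ≤ M) {j : ℕ} (hjk : j ≤ k) :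
    |∫ t, (h (s * t) - h 0) ^ j ∂ν| ≤ s ^ (j : ℝ) * (2 + M + M).toReal := by
  have hj : (j : ℝ) ≤ k := by exact_mod_cast hjk
  have h3 : (k : ℝ) ≤ (max k 3 : ℕ) := by exact_mod_cast le_max_left k 3
  refine abs_integral_le_of_enorm_le (by finiteness) hs0 (by positivity) (fun t => ?_)
    (lintegral_rpow_mul_rpow_le (a := j) (b := j) (k := k) (q := (max k 3 : ℕ)) hζ (by positivity)
      hj (by positivity) (hj.trans h3) h0 ht)
  have := enorm_sub_le_localHolder (h := h) (t := t) hs0 hsα zero_lt_one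
  rw [NNReal.coe_one, ENNReal.rpow_one, enorm_mul] at this
  rw [enorm_pow, ENNReal.rpow_natCast, ENNReal.rpow_natCast, ENNReal.rpow_natCast, ← mul_pow,
    ← mul_pow]
  refine pow_le_pow_left₀ zero_le (this.trans (le_of_eq ?_)) j
  ring

end MomentBounds

/-! ### The S-transform of the product -/

section Product

variable {A : Type*} [CStarAlgebra A]

lemma TracialState.map_mul_pow_comm (φ : TracialState A) (a b : A) (n : ℕ) :
    φ ((a * b) ^ n) = φ ((b * a) ^ n) := by
  rcases n with _ | n
  · simp
  · rw [pow_succ, ← mul_assoc, mul_pow_mul, φ.map_mul_comm, ← mul_assoc, pow_succ']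

lemma isSTransform_one {B : Type*} [Ring B] [Algebra ℂ B] {φ : B →ₗ[ℂ] ℂ} (h1 : φ 1 = 1) :
    IsSTransform (fun n => φ (1 ^ n)) 1 := by
  have e : (PowerSeries.mk fun n => φ ((0 : B) ^ n) : PowerSeries ℂ) = 1 := by
    ext n
    rcases n with _ | n <;> simp [h1, PowerSeries.coeff_one]
  have hX : PowerSeries.subst (PowerSeries.X : PowerSeries ℂ) (1 : PowerSeries ℂ) = 1 := by
    have hs : PowerSeries.HasSubst (PowerSeries.X : PowerSeries ℂ) :=
      PowerSeries.HasSubst.of_constantCoeff_zero' (by simp)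
    rw [← PowerSeries.coe_substAlgHom hs, map_one]
  have := isSTransform_one_add (φ := φ) 0 (v := PowerSeries.X) (T := 1) (by simp)
    (by rw [e, hX, mul_one]) (by rw [e, hX]; ring)
  simpa using this

/-- The S-transform of `P P⋆` for a product `P = G_s G_{s+1} ⋯` of elements of free algebras is the
product of the S-transforms of the `G_i⋆ G_i`: by traciality `G B G⋆` has the moments of
`(G⋆ G) B`, where `G⋆ G` and `B` are free. -/
theorem isSTransform_prod_mul_star {φ : TracialState A} {𝒜 : ℕ → Subalgebra ℂ A}
    (hfree : FreeFamily φ.toLinearMap 𝒜) {G : ℕ → A} (hG : ∀ i, G i ∈ 𝒜 i)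
    (hG' : ∀ i, star (G i) ∈ 𝒜 i) (T : ℕ → PowerSeries ℂ) (m : ℕ) :
    ∀ s, (∀ i < m, IsSTransform (fun j => φ ((star (G (s + i)) * G (s + i)) ^ j)) (T (s + i))) →
      (List.ofFn fun i : Fin m => G (s + i)).prod * star (List.ofFn fun i : Fin m => G (s + i)).prod
        ∈ generated (φ := φ.toLinearMap) φ.map_one' 𝒜 {j | s ≤ j} ∧
      IsSTransform (fun j => φ (((List.ofFn fun i : Fin m => G (s + i)).prod *
        star (List.ofFn fun i : Fin m => G (s + i)).prod) ^ j))
        (∏ i ∈ Finset.range m, T (s + i)) := by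
  induction m with
  | zero =>
    intro s _
    simp only [List.ofFn_zero, List.prod_nil, star_one, mul_one, Finset.range_zero,
      Finset.prod_empty]
    exact ⟨one_mem _, isSTransform_one (φ := φ.toLinearMap) φ.map_one'⟩
  | succ m ih =>
    intro s hT
    obtain ⟨hmem, hS⟩ := ih (s + 1) fun i hi => by
      have := hT (i + 1) (by omega)
      rwa [← add_assoc, add_right_comm] at this
    set Q := (List.ofFn fun i : Fin m => G (s + 1 + i)).prod with hQ
    have e : (List.ofFn fun i : Fin (m + 1) => G (s + i)).prod = G s * Q := by
      rw [List.ofFn_succ, List.prod_cons, hQ]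
      simp only [Fin.val_zero, add_zero, Fin.val_succ, add_assoc, add_comm 1]
    have e' : (G s * Q) * star (G s * Q) = (G s * (Q * star Q)) * star (G s) := by
      rw [star_mul]
      simp only [mul_assoc]
    have hmono := generated_mono (φ := φ.toLinearMap) (𝒜 := 𝒜) φ.map_one'
      (J := {j | s + 1 ≤ j}) (J' := {j | s ≤ j}) fun j (hj : s + 1 ≤ j) => by
        change s ≤ j
        omega
    have hle := le_generated (φ := φ.toLinearMap) (𝒜 := 𝒜) φ.map_one' (J := {j | s ≤ j}) (j := s)
      (le_refl s)
    rw [e, e']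
    refine ⟨mul_mem (mul_mem (hle (hG s)) (hmono hmem)) (hle (hG' s)), ?_⟩
    have hmul := IsSTransform.mul_of_freeFamily hfree φ.map_one' (i := s) (J := {j | s + 1 ≤ j})
      (by simp) (mul_mem (hG' s) (hG s)) hmem (hT 0 (by omega)) hS
    have hmom : (fun j => φ ((G s * (Q * star Q) * star (G s)) ^ j)) =
        fun j => φ ((star (G s) * G s * (Q * star Q)) ^ j) := by
      funext j
      rw [φ.map_mul_pow_comm, ← mul_assoc]
    rw [hmom, Finset.prod_range_succ', mul_comm, add_zero]
    simp only [add_assoc, add_comm 1] at hmul ⊢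
    exact hmul

end Product

/-! ### First-order asymptotics, uniformly in the factor -/

section FirstOrder

open Asymptotics

lemma tendsto_inv_sqrt_fst :
    Tendsto (fun x : ℕ × ℕ => (√(x.1 : ℝ))⁻¹) (comap Prod.fst atTop) (𝓝 0) :=
  (tendsto_inv_atTop_zero.comp (Real.tendsto_sqrt_atTop.comp tendsto_natCast_atTop_atTop)).comp
    tendsto_comap

lemma isLittleO_of_abs_le_rpow {f : ℕ × ℕ → ℝ} {b C : ℝ} (hb : 2 < b)
    (hf : ∀ᶠ x in comap Prod.fst atTop, |f x| ≤ (√(x.1 : ℝ))⁻¹ ^ b * C) :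
    f =o[comap Prod.fst atTop] fun x => (x.1 : ℝ)⁻¹ := by
  have h1 : f =O[comap Prod.fst atTop] fun x => (√(x.1 : ℝ))⁻¹ ^ (b - 2) * (x.1 : ℝ)⁻¹ := by
    refine IsBigO.of_bound C ?_
    filter_upwards [hf, tendsto_comap.eventually (eventually_gt_atTop 0)] with x hx hx0
    have hpos : 0 < (√(x.1 : ℝ))⁻¹ := by positivity
    have e : (√(x.1 : ℝ))⁻¹ ^ b = (√(x.1 : ℝ))⁻¹ ^ (b - 2) * (x.1 : ℝ)⁻¹ := by
      have : (x.1 : ℝ)⁻¹ = (√(x.1 : ℝ))⁻¹ ^ (2 : ℝ) := by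
        rw [Real.rpow_two, inv_pow, Real.sq_sqrt (by positivity)]
      rw [this, ← Real.rpow_add hpos, sub_add_cancel]
    rw [← e, Real.norm_eq_abs, Real.norm_of_nonneg (by positivity), mul_comm]
    exact hx
  refine h1.trans_isLittleO ?_
  have h2 : (fun x : ℕ × ℕ => (√(x.1 : ℝ))⁻¹ ^ (b - 2)) =o[comap Prod.fst atTop]
      fun _ => (1 : ℝ) := by
    rw [isLittleO_one_iff]
    have := tendsto_inv_sqrt_fst.rpow_const (p := b - 2) (Or.inr (by linarith))
    rwa [Real.zero_rpow (by linarith)] at this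
  simpa using h2.mul_isBigO (isBigO_refl (fun x : ℕ × ℕ => (x.1 : ℝ)⁻¹) _)

/-- The moments of `h(x_i / √n) - 1`, where `ν i` is the distribution of `x_i`. -/
noncomputable def perturbationMoment (ν : ℕ → Measure ℝ) (h : ℝ → ℝ) (x : ℕ × ℕ) (j : ℕ) : ℂ :=
  ((∫ t, (h ((√(x.1 : ℝ))⁻¹ * t) - 1) ^ j ∂(ν x.2) : ℝ) : ℂ)

variable {ν : ℕ → Measure ℝ} [∀ i, IsProbabilityMeasure (ν i)] {h : ℝ → ℝ} {ζ α σ : ℝ} {γ : ℝ≥0}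
  {k : ℕ} {M : ℝ≥0∞}

/-- To first order in `1 / n` only the first two moments of `h(x_i / √n) - 1` contribute. -/
lemma isLittleO_perturbationMoment
    (hint : ∀ i, ∀ f : ℝ → ℝ, Continuous f → Integrable f (ν i))
    (hh : ContDiff ℝ 2 h) (hh0 : h 0 = 1) (hζ : 0 < ζ) (hγ0 : 0 < γ) (hγ1 : γ ≤ 1)
    (hα : 0 < α) (hM : M ≠ ⊤)
    (ht : ∀ i, ∫⁻ t, ENNReal.ofReal (|t| ^ (((max k 3 : ℕ) : ℝ) * (1 + ζ))) ∂(ν i) ≤ M)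
    (h0 : ∀ i, ∫⁻ t, localHolder 1 α h t ^ ((k : ℝ) * (1 + ζ⁻¹)) ∂(ν i) ≤ M)
    (h1 : ∀ i, ∫⁻ t, localHolder 1 α (deriv h) t ^ ((k : ℝ) * (1 + ζ⁻¹)) ∂(ν i) ≤ M)
    (h2 : ∀ i, ∫⁻ t, localHolder γ α (iteratedDeriv 2 h) t ^ ((k : ℝ) * (1 + ζ⁻¹)) ∂(ν i) ≤ M)
    (hm1 : ∀ i, ∫ t, t ∂(ν i) = 0) (hm2 : ∀ i, ∫ t, t ^ 2 ∂(ν i) = σ ^ 2)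
    {j : ℕ} (hj : 1 ≤ j) (hjk : j ≤ k) :
    (fun x => perturbationMoment ν h x j -
      ((if j = 1 then iteratedDeriv 2 h 0 / 2 * σ ^ 2 else 0 : ℝ) +
        (if j = 2 then (deriv h 0 * σ) ^ 2 else 0 : ℝ) : ℂ) / (x.1 : ℂ))
      =o[comap Prod.fst atTop] fun x => (x.1 : ℝ)⁻¹ := by
  have hs : ∀ᶠ x : ℕ × ℕ in comap Prod.fst atTop, (√(x.1 : ℝ))⁻¹ ≤ α :=
    tendsto_inv_sqrt_fst.eventually (eventually_le_nhds hα)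
  have hs2 : ∀ n : ℕ, (√(n : ℝ))⁻¹ ^ 2 = (n : ℝ)⁻¹ := fun n => by
    rw [inv_pow, Real.sq_sqrt (by positivity)]
  suffices H : (fun x : ℕ × ℕ => ∫ t, (h ((√(x.1 : ℝ))⁻¹ * t) - 1) ^ j ∂(ν x.2) -
      ((if j = 1 then iteratedDeriv 2 h 0 / 2 * σ ^ 2 else 0) +
        (if j = 2 then (deriv h 0 * σ) ^ 2 else 0)) / (x.1 : ℝ))
      =o[comap Prod.fst atTop] fun x => (x.1 : ℝ)⁻¹ by
    refine (IsLittleO.of_norm_left (f' := fun x => (_ : ℂ)) (H.norm_left.congr_left fun x => ?_))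
    rw [← Complex.norm_real, perturbationMoment]
    push_cast
    rfl
  rcases (by omega : j = 1 ∨ j = 2 ∨ 3 ≤ j) with rfl | rfl | hj3
  · refine isLittleO_of_abs_le_rpow (b := γ + 2) (C := (2 + M + M).toReal)
      (by simpa using hγ0) ?_
    filter_upwards [hs] with x hx
    have := abs_integral_one_le (hint x.2) hh hζ hjk hγ1 (by positivity) hx hM (ht x.2) (h2 x.2)
      (hm1 x.2) (hm2 x.2)
    rw [hh0, hs2] at this
    convert this using 2
    simp
    ring
  · refine isLittleO_of_abs_le_rpow (b := 3) (C := ((2 + M + M) * (2 + ‖deriv h 0‖ₑ)).toReal)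
      (by norm_num) ?_
    filter_upwards [hs] with x hx
    have := abs_integral_sq_le (hint x.2) hh hζ hjk (by positivity) hx hM (ht x.2) (h0 x.2)
      (h1 x.2) (hm2 x.2)
    rw [hh0, mul_pow, hs2] at this
    convert this using 2
    simp
    ring
  · have hj1 : j ≠ 1 := by omega
    have hj2 : j ≠ 2 := by omega
    simp only [if_neg hj1, if_neg hj2, add_zero, zero_div, sub_zero]
    refine isLittleO_of_abs_le_rpow (b := j) (C := (2 + M + M).toReal)
      (by exact_mod_cast (by omega : 2 < j)) ?_
    filter_upwards [hs] with x hx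
    have := abs_integral_pow_le hζ (by positivity) hx hM (ht x.2) (h0 x.2) hjk
    rwa [hh0] at this

variable {p : ℕ × ℕ → ℕ → ℂ} {a b : ℂ}

lemma isBigO_of_isLittleO_sub {j : ℕ} (hp : (fun x => p x j -
    ((if j = 1 then a else 0) + if j = 2 then b else 0) / (x.1 : ℂ))
      =o[comap Prod.fst atTop] fun x => (x.1 : ℝ)⁻¹) :
    (fun x => p x j) =O[comap Prod.fst atTop] fun x => (x.1 : ℝ)⁻¹ := by
  have h2 : (fun x : ℕ × ℕ => ((if j = 1 then a else 0) + if j = 2 then b else 0) / (x.1 : ℂ))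
      =O[comap Prod.fst atTop] fun x => (x.1 : ℝ)⁻¹ := by
    simp only [div_eq_mul_inv]
    refine IsBigO.const_mul_left (IsBigO.of_norm_right ?_) _
    refine IsBigO.of_norm_norm ((isBigO_refl _ _).congr_left fun x => ?_)
    simp
  simpa using hp.isBigO.add h2

/-- The limit of the S-transforms of the products, if the moments `p (n, i) j` are `a / n` for
`j = 1`, `b / n` for `j = 2` and `0` for larger `j`, up to `o(1 / n)` uniformly in `i`. -/
lemma tendsto_coeff_prod_sSeries (h0 : ∀ x, p x 0 = 1)
    (hp : ∀ j, 1 ≤ j → j ≤ k → (fun x => p x j -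
      ((if j = 1 then a else 0) + if j = 2 then b else 0) / (x.1 : ℂ))
        =o[comap Prod.fst atTop] fun x => (x.1 : ℝ)⁻¹) {m : ℕ} (hm : m < k) :
    Tendsto (fun n => PowerSeries.coeff m (∏ i ∈ Finset.range n, sSeries (p (n, i)))) atTop
      (𝓝 (PowerSeries.coeff m (expSeries (-a) (-b)))) := by
  refine tendsto_coeff_prod (t := fun n i => sSeries (p (n, i))) (fun m hm => ?_) hm
  have hε : Tendsto (fun x : ℕ × ℕ => (x.1 : ℝ)⁻¹) (comap Prod.fst atTop) (𝓝 0) :=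
    (tendsto_inv_atTop_zero.comp tendsto_natCast_atTop_atTop).comp tendsto_comap
  have hS := isBigO_coeff_sSeries hε h0 (fun j hj hjk => isBigO_of_isLittleO_sub (hp j hj hjk)) m hm
  have hsq : (fun x : ℕ × ℕ => (x.1 : ℝ)⁻¹ ^ 2) =o[comap Prod.fst atTop]
      fun x => (x.1 : ℝ)⁻¹ := by
    have h1 : (fun x : ℕ × ℕ => (x.1 : ℝ)⁻¹) =o[comap Prod.fst atTop] fun _ => (1 : ℝ) :=
      (isLittleO_one_iff ℝ).2 hε
    simpa [pow_two] using h1.mul_isBigO (isBigO_refl (fun x : ℕ × ℕ => (x.1 : ℝ)⁻¹) _)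
  refine ((hS.trans_isLittleO hsq).sub (hp (m + 1) (by omega) (by omega))).congr_left fun x => ?_
  rcases m with _ | _ | m
  · simp
    ring
  · simp
    ring
  · simp

end FirstOrder

/-! ### The limit of the free cumulants -/

section Main

lemma contDiff_absSq {g : ℝ → ℂ} {n : WithTop ℕ∞} (hg : ContDiff ℝ n g) : ContDiff ℝ n (absSq g) :=
  hg.norm_sq ℝ

variable {A : Type*} [CStarAlgebra A]

lemma lintegral_rpow_le_of_normLp_le {φ : TracialState A} {K : ℝ} (hK : 0 < K) {F : ℝ → ℝ≥0∞}
    {x : A} {S : ℝ≥0∞} (h : normLp φ K F x ≤ S) :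
    ∫⁻ t, F t ^ K ∂(spectralDistribution φ x) ≤ S ^ K := by
  rwa [normLp, one_div, ENNReal.rpow_inv_le_iff hK] at h

/-- The moments of `|g(c x)|² - 1` as integrals against the spectral distribution of `x`. -/
lemma apply_star_applyFun_mul_sub_one_pow (φ : TracialState A) {x : A} (hx : IsSelfAdjoint x)
    {g : ℝ → ℂ} (hg : Continuous g) (c : ℝ) (j : ℕ) :
    φ ((star (applyFun g ((c : ℂ) • x)) * applyFun g ((c : ℂ) • x) - 1) ^ j) =
      ((∫ t, (absSq g (c * t) - 1) ^ j ∂(spectralDistribution φ x) : ℝ) : ℂ) := by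
  have hc : Continuous fun t : ℝ => absSq g (c * t) :=
    (hg.norm.pow 2).comp (continuous_const_mul c)
  have hc1 : Continuous fun t : ℝ => absSq g (c * t) - 1 := hc.sub continuous_const
  have e : cfc (fun t : ℝ => absSq g (c * t)) x - 1 = cfc (fun t : ℝ => absSq g (c * t) - 1) x := by
    rw [cfc_sub _ _ x hc.continuousOn continuousOn_const, cfc_const_one ℝ x]
  rw [star_applyFun_mul_applyFun hx hg, e, ← cfc_pow _ j x hc1.continuousOn]
  exact apply_cfc_eq_integral φ (hc1.pow j)

end Main

end FreeProb

theorem theoremA7 {A : Type*} [CStarAlgebra A] (φ : FreeProb.TracialState A)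
    (x : ℕ → A) (σ : ℝ)
    (hsa : ∀ i, IsSelfAdjoint (x i))
    (hfree : FreeProb.IsFree φ x)
    (hcentered : ∀ i, φ (x i) = 0)
    (hvar : ∀ i, φ (x i ^ 2) = ((σ ^ 2 : ℝ) : ℂ))
    (k : ℕ) (hk : 1 ≤ k)
    (ζ : ℝ) (hζ : 0 < ζ)
    (hmom : (⨆ i, FreeProb.absMoment φ ((max k 3 : ℕ) * (1 + ζ)) (x i)) < ⊤)
    (γ : ℝ≥0) (hγ0 : 0 < γ) (hγ1 : γ ≤ 1)
    (g : ℝ → ℂ) (hg : FreeProb.IsC2Holder γ g) (hg0 : g 0 = 1)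
    (α : ℝ) (hα0 : 0 < α) (hα1 : α < 1)
    (hL0 : (⨆ i, FreeProb.normLp φ (k * (1 + ζ⁻¹))
      (FreeProb.localHolder 1 α (FreeProb.absSq g)) (x i)) < ⊤)
    (hL1 : (⨆ i, FreeProb.normLp φ (k * (1 + ζ⁻¹))
      (FreeProb.localHolder 1 α (deriv (FreeProb.absSq g))) (x i)) < ⊤)
    (hL2 : (⨆ i, FreeProb.normLp φ (k * (1 + ζ⁻¹))
      (FreeProb.localHolder γ α (iteratedDeriv 2 (FreeProb.absSq g))) (x i)) < ⊤) :
    Tendsto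
      (fun n : ℕ => FreeProb.freeCumulant φ k
        (FreeProb.prodPi g x n * star (FreeProb.prodPi g x n)))
      atTop
      (𝓝 (((k : ℝ) ^ (k - 1) / (k.factorial : ℝ)
        * (deriv (FreeProb.absSq g) 0 * σ) ^ (2 * (k - 1))
        * Real.exp ((k : ℝ) / 2 * iteratedDeriv 2 (FreeProb.absSq g) 0 * σ ^ 2) : ℝ) : ℂ)) := by
  open FreeProb in
  set h := absSq g with hdef
  have hh : ContDiff ℝ 2 h := contDiff_absSq hg.1
  have hgc : Continuous g := hg.1.continuous
  have hh0 : h 0 = 1 := by simp [hdef, absSq, hg0]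
  set ν : ℕ → Measure ℝ := fun i => spectralDistribution φ (x i) with hν
  have hprob : ∀ i, IsProbabilityMeasure (ν i) := fun i =>
    isProbabilityMeasure_spectralDistribution φ (hsa i)
  have hK : 0 < (k : ℝ) * (1 + ζ⁻¹) := by positivity
  obtain ⟨M, hM, hMt, hM0, hM1, hM2⟩ : ∃ M : ℝ≥0∞, M ≠ ⊤ ∧
      (∀ i, ∫⁻ t, ENNReal.ofReal (|t| ^ (((max k 3 : ℕ) : ℝ) * (1 + ζ))) ∂(ν i) ≤ M) ∧
      (∀ i, ∫⁻ t, localHolder 1 α h t ^ ((k : ℝ) * (1 + ζ⁻¹)) ∂(ν i) ≤ M) ∧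
      (∀ i, ∫⁻ t, localHolder 1 α (deriv h) t ^ ((k : ℝ) * (1 + ζ⁻¹)) ∂(ν i) ≤ M) ∧
      ∀ i, ∫⁻ t, localHolder γ α (iteratedDeriv 2 h) t ^ ((k : ℝ) * (1 + ζ⁻¹)) ∂(ν i) ≤ M := by
    have bd : ∀ {F : ℝ → ℝ≥0∞}, (⨆ i, normLp φ (k * (1 + ζ⁻¹)) F (x i)) < ⊤ →
        ∃ M : ℝ≥0∞, M ≠ ⊤ ∧ ∀ i, ∫⁻ t, F t ^ ((k : ℝ) * (1 + ζ⁻¹)) ∂(ν i) ≤ M := fun hF =>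
      ⟨_, ENNReal.rpow_ne_top_of_nonneg hK.le hF.ne, fun i =>
        lintegral_rpow_le_of_normLp_le hK (le_iSup (fun i => normLp φ _ _ (x i)) i)⟩
    obtain ⟨M0, hM0, h0⟩ := bd hL0
    obtain ⟨M1, hM1, h1⟩ := bd hL1
    obtain ⟨M2, hM2, h2⟩ := bd hL2
    refine ⟨max (max M0 M1) (max M2 (⨆ i, absMoment φ ((max k 3 : ℕ) * (1 + ζ)) (x i))),
      ?_, fun i => ?_, fun i => ?_, fun i => ?_, fun i => ?_⟩
    · exact (max_lt (max_lt hM0.lt_top hM1.lt_top) (max_lt hM2.lt_top hmom)).ne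
    · exact (le_iSup (fun i => absMoment φ ((max k 3 : ℕ) * (1 + ζ)) (x i)) i).trans
        ((le_max_right _ _).trans (le_max_right _ _))
    · exact (h0 i).trans ((le_max_left _ _).trans (le_max_left _ _))
    · exact (h1 i).trans ((le_max_right _ _).trans (le_max_left _ _))
    · exact (h2 i).trans ((le_max_left _ _).trans (le_max_right _ _))
  set a : ℂ := ((iteratedDeriv 2 h 0 / 2 * σ ^ 2 : ℝ) : ℂ) with ha
  set b : ℂ := (((deriv h 0 * σ) ^ 2 : ℝ) : ℂ) with hb
  have hp0 : ∀ y, perturbationMoment ν h y 0 = 1 := fun y => by simp [perturbationMoment]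
  have hp : ∀ j, 1 ≤ j → j ≤ k → (fun y => perturbationMoment ν h y j -
      ((if j = 1 then a else 0) + if j = 2 then b else 0) / (y.1 : ℂ))
        =o[comap Prod.fst atTop] fun y => (y.1 : ℝ)⁻¹ := by
    intro j hj hjk
    have := isLittleO_perturbationMoment (ν := ν) (σ := σ)
      (fun i f hf => integrable_spectralDistribution φ hf) hh hh0 hζ hγ0 hγ1 hα0 hM hMt hM0 hM1
      hM2 (fun i => by
        have := integral_id_spectralDistribution φ (hsa i)
        rw [hcentered i] at this
        exact_mod_cast this)
      (fun i => by
        have := integral_sq_spectralDistribution φ (hsa i)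
        rw [hvar i] at this
        exact_mod_cast this) hj hjk
    simpa only [apply_ite Complex.ofReal, Complex.ofReal_zero] using this
  -- the S-transform of `π_n π_n⋆`
  have hS : ∀ᶠ n : ℕ in atTop, IsSTransform (fun j => φ ((prodPi g x n * star (prodPi g x n)) ^ j))
      (∏ i ∈ Finset.range n, sSeries (perturbationMoment ν h (n, i))) := by
    have hlim : Tendsto (fun y => perturbationMoment ν h y 1 + 1) (comap Prod.fst atTop)
        (𝓝 (0 + 1)) :=
      ((isBigO_of_isLittleO_sub (hp 1 le_rfl hk)).trans_tendsto
        ((tendsto_inv_atTop_zero.comp tendsto_natCast_atTop_atTop).comp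
          tendsto_comap)).add_const 1
    have hne := hlim.eventually_ne (by simp : (0 + 1 : ℂ) ≠ 0)
    rw [eventually_comap] at hne
    filter_upwards [hne] with n hn
    set c : ℝ := (√(n : ℝ))⁻¹ with hc
    have hcc : ((√(n : ℝ) : ℂ))⁻¹ = (c : ℂ) := by rw [hc, Complex.ofReal_inv]
    have hmem : ∀ (f : ℝ → ℂ) i, applyFun f ((c : ℂ) • x i) ∈ closedAdjoin (x i) := fun f i =>
      applyFun_mem_closedAdjoin (hsa i) f c
    have := (isSTransform_prod_mul_star hfree.freeFamily (G := fun i => applyFun g ((c : ℂ) • x i))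
      (hmem g) (fun i => by rw [star_applyFun]; exact hmem _ i)
      (fun i => sSeries (perturbationMoment ν h (n, i))) n 0 fun i _ => ?_).2
    · simpa only [zero_add, prodPi, hcc] using this
    · rw [zero_add]
      set u := star (applyFun g ((c : ℂ) • x i)) * applyFun g ((c : ℂ) • x i) - 1 with hu
      have hmomu : (fun j => φ (u ^ j)) = perturbationMoment ν h (n, i) := by
        funext j
        exact apply_star_applyFun_mul_sub_one_pow φ (hsa i) hgc c j
      have := isSTransform_sSeries (φ := φ.toLinearMap) φ.map_one' u (by
        have e := congrFun hmomu 1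
        rw [pow_one] at e
        have := hn (n, i) rfl
        rwa [← e] at this)
      rw [hu, add_sub_cancel] at this
      rw [← hmomu]
      exact this
  have hlim := tendsto_coeff_of_subst_eq_X (k := k)
    (K := fun n => cumulantSeries fun j => φ ((prodPi g x n * star (prodPi g x n)) ^ j))
    (T := fun n => ∏ i ∈ Finset.range n, sSeries (perturbationMoment ν h (n, i)))
    (fun n => by simp [cumulantSeries]) (by simp)
    (hS.mono fun n hn => hn.cumulantSeries_subst (by simp [φ.map_one]))
    (treeSeries_subst (-a) (-b)) (by
      rw [← PowerSeries.coeff_zero_eq_constantCoeff_apply, coeff_expSeries]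
      simp [Complex.exp_ne_zero])
    (fun m hm => tendsto_coeff_prod_sSeries hp0 hp hm) k le_rfl
  have hk0 : k ≠ 0 := by omega
  simp only [cumulantSeries, PowerSeries.coeff_mk, if_neg hk0] at hlim
  have hval : (k : ℂ) ^ (k - 1) / (k.factorial : ℂ) * (- -b) ^ (k - 1) *
      Complex.exp (-((k : ℂ) * -a)) =
      (((k : ℝ) ^ (k - 1) / (k.factorial : ℝ) * (deriv h 0 * σ) ^ (2 * (k - 1))
        * Real.exp ((k : ℝ) / 2 * iteratedDeriv 2 h 0 * σ ^ 2) : ℝ) : ℂ) := by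
    have he : -((k : ℂ) * -a) = (((k : ℝ) / 2 * iteratedDeriv 2 h 0 * σ ^ 2 : ℝ) : ℂ) := by
      rw [ha]
      push_cast
      ring
    rw [neg_neg, he, hb, pow_mul]
    push_cast
    rfl
  rw [hval] at hlim
  exact hlim
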